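/- \textbf{Setting.} Let $\mathbb X,\mathbb U,\mathcal M$ be nonempty finite sets (source states, control actions, channel symbols), $P(x'|x,u)$ a transition kernel, $c:\mathbb X\times\mathbb U\to\mathbb R$ a cost and $\beta\in(0,1)$. Let $\mathcal Q$ be the set of quantizers $Q:\mathbb X\to\mathcal M$ and $\mathcal H$ the set of maps $\eta:\mathcal Q\times\mathcal M\to\mathbb U$. At time $t$ an action $(Q_t,\eta_t)\in\mathcal Q\times\mathcal H$ produces $q_t=Q_t(x_t)$ and $u_t=\eta_t(Q_t,q_t)$, and then $x_{t+1}\sim P(\cdot|x_t,u_t)$. For $\pi\in\mathcal P(\mathbb X)$ with $\pi(Q^{-1}(q))>0$ put $F(\pi,Q,\eta,q)(x')=\frac1{\pi(Q^{-1}(q))}\sum_{x\in Q^{-1}(q)}P(x'|x,\eta(Q,q))\pi(x)$; where $\pi(Q^{-1}(q))=0$ fix $F=\pi$ by convention. For a window $I=(q_i,Q_i,\eta_i)_{i=1}^N$ let $\psi(\pi,I)$ be the result of applying $F$ to $\pi$ successively along $I$. Let $\delta(P,u)=\min_{i,k}\sum_j\min(P(j|i,u),P(j|k,u))$. \emph{Uniform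 exploration} means that $(Q_t,\eta_t)$ is uniform on $\mathcal Q\times\mathcal H$, independent of the past. Assume that $\delta(P,u)>1/2$ for all $u\in\mathbb U$, that $\{x_t\}$ is positive Harris recurrent under uniform exploration, and let $\zeta$ be its invariant distribution. Call a window $I$ \emph{possible} if it has positive probability under uniform exploration with $x_0\sim\zeta$. \emph{The model $\mathrm{MDP}_N$} has as states the windows $I\in(\mathcal M\times\mathcal Q\times\mathcal H)^N$ (that is, $\hat\kappa=(\zeta,I)$), as actions $\mathcal Q\times\mathcal H$, cost $c_N(I,Q,\eta)=\sum_x\psi(\zeta,I)(x)\,c(x,\eta(Q,Q(x)))$, and kernel $P_N(\cdot|I,Q,\eta)$, the law of the window obtained from $I$ by dropping its oldest entry and appending $(Q(x),Q,\eta)$, $x\sim\psi(\zeta,I)$. \emph{Q-learning.} Under uniform exploration from an arbitrary initial distribution, let $I_t$ be the window of the last $N$ entries (the first $N$ steps fill the first window), $\mathbf Q_0\equiv0$, and $$\mathbf Q_{t+1}(I,a)=(1-\alpha_t(I,a))\mathbf Q_t(I,a)+\alpha_t(I,a)\Big[c_N(I_t,a_t)+\beta\min_{a'}\mathbf Q_t(I_{t+1},a')\Big],\qquad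 a_t=(Q_t,\eta_t),$$ where $\alpha_t(I,a)=\big(1+\#\{k\le t:(I_k,a_k)=(I,a)\}\big)^{-1}$ if $(I_t,a_t)=(I,a)$ and $\alpha_t(I,a)=0$ otherwise. \emph{Costs.} For $\kappa_0=(\pi,I)$, $J_\beta(\kappa_0,\gamma)=E\big[\sum_{k\ge0}\beta^kc(x_k,u_k)\big]$ with $x_0\sim\psi(\pi,I)$, and $J_\beta(\kappa_0)$ is the infimum over all admissible joint policies (encoder $q_t=\gamma^e_t(x_{[0,t]},q_{[0,t-1]})$, controller $u_t=\gamma^c_t(q_{[0,t]},u_{[0,t-1]})$). \textbf{Theorem.} For every $N\ge 0$ there is a function $\mathbf Q^*_N$ of (window, action) such that the following hold. (1) From every initial distribution, almost surely $\mathbf Q_t(I,a)\to\mathbf Q^*_N(I,a)$ for every possible window $I$ and every action $a$. (2) For all $I,a$: $\ \mathbf Q^*_N(I,a)=c_N(I,a)+\beta\sum_{I'}P_N(I'|I,a)\min_{a'}\mathbf Q^*_N(I',a')$. This is the DCOE of $\mathrm{MDP}_N$: the optimal discounted cost of $\mathrm{MDP}_N$ from $I$ is $\min_a\mathbf Q_N^*(I,a)$,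 and every policy $\hat\gamma_N(I)\in\arg\min_a\mathbf Q^*_N(I,a)$ is optimal for $\mathrm{MDP}_N$. (3) For each $N$ let $\hat\gamma^*_N(I)\in\arg\min_a\mathbf Q^*_N(I,a)$ (for all possible $I$) and let $\tilde\gamma^*_N(\pi,I)=\hat\gamma^*_N(I)$. For each $N$ let $\nu_N$ be any distribution on $\mathbb X$, let $g_N$ be any (possibly randomized) policy choosing $(Q_t,\eta_t)$ from past $(q,Q,\eta)$'s, and let $\kappa^N_0=(\nu_N,I^N)$, where $I^N$ is the random window produced by $N$ steps of $g_N$ started from $x\sim\nu_N$. Then, whatever the joint law of $(I^N)_{N\ge 0}$ with these marginals, almost surely $$\lim_{N\to\infty}\mathbf 1_{\{I^N\text{ possible}\}}\,\big|J_\beta(\kappa^N_0,\tilde\gamma_N^*)-J_\beta(\kappa^N_0)\big|=0 .$$ -/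

import Mathlib

open MeasureTheory ProbabilityTheory Filter Topology

noncomputable section

namespace NetCtrl

/-! ### Laws of discrete-time processes on a finite set -/

section PathLaw

variable {S : Type*} [Fintype S] [MeasurableSpace S]

/-- The probability measure on a finite set with the given probability vector. -/
def simplexMeasure (p : stdSimplex ℝ S) : Measure S :=
  ∑ s, ENNReal.ofReal (p s) • Measure.dirac s

instance (p : stdSimplex ℝ S) : IsProbabilityMeasure (simplexMeasure p) := by
  constructor
  simp only [simplexMeasure, Measure.coe_finsetSum, Finset.sum_apply, Measure.smul_apply,
    measure_univ, smul_eq_mul, mul_one]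
  rw [← ENNReal.ofReal_sum_of_nonneg (fun i _ => stdSimplex.zero_le p i), stdSimplex.sum_eq_one,
    ENNReal.ofReal_one]

variable [MeasurableSingletonClass S]

/-- One step of a process: the law of the state at time `n + 1` given the states at
times `0, …, n`. -/
def stepKernel (step : ∀ n : ℕ, (Fin (n + 1) → S) → stdSimplex ℝ S) (n : ℕ) :
    Kernel (∀ _ : Finset.Iic n, S) S where
  toFun h := simplexMeasure
    (step n fun i => h ⟨i, Finset.mem_Iic.2 (Nat.lt_succ_iff.1 i.isLt)⟩)
  measurable' := Measurable.of_discrete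

instance (step : ∀ n : ℕ, (Fin (n + 1) → S) → stdSimplex ℝ S) (n : ℕ) :
    IsMarkovKernel (stepKernel step n) :=
  ⟨fun h => inferInstanceAs (IsProbabilityMeasure (simplexMeasure
    (step n fun i => h ⟨i, Finset.mem_Iic.2 (Nat.lt_succ_iff.1 i.isLt)⟩)))⟩

/-- The law on the path space of the process with initial distribution `p₀` whose state at time
`n + 1` has the conditional distribution `step n (s₀, …, sₙ)` given the past. -/
def processLaw (p₀ : stdSimplex ℝ S)
    (step : ∀ n : ℕ, (Fin (n + 1) → S) → stdSimplex ℝ S) : Measure (ℕ → S) :=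
  Kernel.trajMeasure (X := fun _ => S) (simplexMeasure p₀) (stepKernel step)

end PathLaw

/-- The product of two probability vectors. -/
def prodVec {S T : Type*} [Fintype S] [Fintype T] (p : stdSimplex ℝ S) (r : stdSimplex ℝ T) :
    stdSimplex ℝ (S × T) :=
  ⟨fun z => p z.1 * r z.2, fun z => mul_nonneg (p.2.1 z.1) (r.2.1 z.2), by
    rw [Fintype.sum_prod_type, ← Fintype.sum_mul_sum]
    exact (congrArg₂ (· * ·) p.2.2 r.2.2).trans (one_mul 1)⟩

/-! ### The controlled source over a noiseless channel

`X`, `U`, `M` are the finite sets of source states, control actions and channel symbols. The source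
moves by the transition kernel `P x u`, and `c x u` is the stage cost. -/

/-- An action `(Q, η)`: a quantizer `Q : X → M` and a map `η` from (quantizer, channel symbol) to
control actions. -/
abbrev Act (X U M : Type*) := (X → M) × ((X → M) → M → U)

/-- What is recorded in one time step: `(q, (Q, η))`. -/
abbrev Rec (X U M : Type*) := M × Act X U M

/-- A window `I = (q, Q, η)_{[t-N, t-1]}`, oldest entry first. -/
abbrev Window (X U M : Type*) (N : ℕ) := Fin N → Rec X U M

instance {X U M : Type*} [Fintype X] [DecidableEq X] [DecidableEq U] [Fintype M] [DecidableEq M]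
    {N : ℕ} : DecidableEq (Window X U M N) := Fintype.decidablePiFintype

section Model

variable {X U M : Type*}

/-- The channel symbol `q = Q(x)`. -/
def sym (a : Act X U M) (x : X) : M := a.1 x

/-- The control `u = η(Q, Q(x))`. -/
def control (a : Act X U M) (x : X) : U := a.2 a.1 (a.1 x)

/-- The record `(Q(x), (Q, η))` produced by source state `x` and action `(Q, η)`. -/
def record (z : X × Act X U M) : Rec X U M := (sym z.2 z.1, z.2)

/-- Drop the oldest entry of a window and append a new one. -/
def shift {N : ℕ} (I : Window X U M N) (w : Rec X U M) : Window X U M N :=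
  Fin.tail (Fin.snoc (α := fun _ => Rec X U M) I w)

/-- Along a path of (source state, action): the window recorded at times `t, …, t + N - 1`. -/
def windowAt (N t : ℕ) (ω : ℕ → X × Act X U M) : Window X U M N := fun i => record (ω (t + i))

variable [Fintype X]

/-- The Dobrushin coefficient `δ(P, u) = min_{i,k} ∑_j min (P(j|i,u), P(j|k,u))`. -/
def dobrushin (P : X → U → stdSimplex ℝ X) (u : U) : ℝ :=
  ⨅ p : X × X, ∑ j, min (P p.1 u j) (P p.2 u j)

variable [DecidableEq M]

/-- `π(Q⁻¹(q))`. -/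
def symProb (π : stdSimplex ℝ X) (w : Rec X U M) : ℝ := ∑ x, if w.2.1 x = w.1 then π x else 0

/-- The predictor update `F(π, Q, η, q)(x') = π(Q⁻¹(q))⁻¹ ∑_{x ∈ Q⁻¹(q)} P(x'|x, η(Q,q)) π(x)`.
If `π(Q⁻¹(q)) = 0` the update is undefined, and the value is (arbitrarily) set to `π`. -/
def update (P : X → U → stdSimplex ℝ X) (π : stdSimplex ℝ X) (w : Rec X U M) : stdSimplex ℝ X :=
  if h : symProb π w = 0 then π else
    ⟨fun x' => (symProb π w)⁻¹ *
        ∑ x, if w.2.1 x = w.1 then P x (w.2.2 w.2.1 w.1) x' * π x else 0, by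
      refine ⟨fun x' => mul_nonneg (inv_nonneg.2 ?_) ?_, ?_⟩
      · refine Finset.sum_nonneg fun x _ => ?_
        split_ifs
        exacts [π.2.1 x, le_rfl]
      · refine Finset.sum_nonneg fun x _ => ?_
        split_ifs
        exacts [mul_nonneg ((P x _).2.1 x') (π.2.1 x), le_rfl]
      · rw [← Finset.mul_sum, Finset.sum_comm]
        have key : (∑ x, ∑ x', if w.2.1 x = w.1 then P x (w.2.2 w.2.1 w.1) x' * π x else 0)
            = symProb π w := by
          refine Finset.sum_congr rfl fun x _ => ?_
          split_ifs
          · rw [← Finset.sum_mul, stdSimplex.sum_eq_one, one_mul]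
          · simp
        rw [key, inv_mul_cancel₀ h]⟩

/-- `ψ(π, I)`: the predictor obtained from `π` by updating along the window `I`. -/
def psi (P : X → U → stdSimplex ℝ X) (π : stdSimplex ℝ X) :
    ∀ {N : ℕ}, Window X U M N → stdSimplex ℝ X
  | 0, _ => π
  | _ + 1, I => psi P (update P π (I 0)) (Fin.tail I)

/-! ### Policies that use the common information, and sliding window policies -/

/-- A (randomized) rule selecting the action `(Q_t, η_t)` from the records at times
`0, …, t - 1`. -/
abbrev CommonPolicy (X U M : Type*) [Fintype X] [DecidableEq X] [Fintype M] [DecidableEq M]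
    [Fintype U] := ∀ n : ℕ, (Fin n → Rec X U M) → stdSimplex ℝ (Act X U M)

/-- The state `κ = (π_{t-N}, I_t^N)`. -/
abbrev WState (X U M : Type*) [Fintype X] (N : ℕ) := stdSimplex ℝ X × Window X U M N

/-- `κ_{t+1}` from `κ_t` and the record at time `t`. -/
def advance (P : X → U → stdSimplex ℝ X) {N : ℕ} (κ : WState X U M N) (w : Rec X U M) :
    WState X U M N :=
  (update P κ.1 (Fin.snoc (α := fun _ => Rec X U M) κ.2 w 0), shift κ.2 w)

/-- `κ_n` from `κ_0` and the records at times `0, …, n - 1`. -/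
def stateAfter (P : X → U → stdSimplex ℝ X) {N : ℕ} (κ : WState X U M N) :
    ∀ n : ℕ, (Fin n → Rec X U M) → WState X U M N
  | 0, _ => κ
  | n + 1, h => advance P (stateAfter P κ n (Fin.init h)) (h (Fin.last n))

variable [DecidableEq X] [Fintype M] [Fintype U] [DecidableEq U]

/-- The sliding window policy `γ : κ_t ↦ (Q_t, η_t)` started from `κ_0 = κ`. -/
def windowPolicy (P : X → U → stdSimplex ℝ X) {N : ℕ} (κ : WState X U M N)
    (γ : WState X U M N → Act X U M) : CommonPolicy X U M :=
  fun n h => stdSimplex.vertex (γ (stateAfter P κ n h))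

/-- The extension `γ̃(π, I) = γ̂(I)` of a policy for the finite window model. -/
def extend {N : ℕ} (γ : Window X U M N → Act X U M) : WState X U M N → Act X U M :=
  fun κ => γ κ.2

variable [MeasurableSpace X] [MeasurableSingletonClass X] [MeasurableSpace U]
  [MeasurableSingletonClass U] [MeasurableSpace M] [MeasurableSingletonClass M]

/-- The law of the process `(x_t, (Q_t, η_t))_{t ≥ 0}` when `x_0 ∼ π` and actions are selected by
`g`: given the past, `x_{t+1} ∼ P(· | x_t, η_t(Q_t, Q_t(x_t)))` and, independently,
`(Q_{t+1}, η_{t+1}) ∼ g (records up to time t)`. -/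
def commonLaw (P : X → U → stdSimplex ℝ X) (π : stdSimplex ℝ X) (g : CommonPolicy X U M) :
    Measure (ℕ → X × Act X U M) :=
  processLaw (prodVec π (g 0 Fin.elim0)) fun n h =>
    prodVec (P (h (Fin.last n)).1 (control (h (Fin.last n)).2 (h (Fin.last n)).1))
      (g (n + 1) fun i => record (h i))

/-- The expected discounted cost `E [∑ β^k c(x_k, u_k)]` of the sliding window policy `γ` started
from `κ_0 = κ` (so `x_0 ∼ ψ(κ)`). -/
def windowCost (P : X → U → stdSimplex ℝ X) (c : X → U → ℝ) (β : ℝ) {N : ℕ}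
    (κ : WState X U M N) (γ : WState X U M N → Act X U M) : ℝ :=
  ∑' k : ℕ, β ^ k * ∫ ω, c (ω k).1 (control (ω k).2 (ω k).1)
    ∂(commonLaw P (psi P κ.1 κ.2) (windowPolicy P κ γ))

/-! ### All admissible joint coding-control policies -/

/-- An admissible joint coding-control policy: the encoder chooses `q_t` from
`x_{[0,t]}, q_{[0,t-1]}`, the controller chooses `u_t` from `q_{[0,t]}, u_{[0,t-1]}`. -/
structure JointPolicy (X U M : Type*) where
  /-- the encoder -/
  enc : ∀ t : ℕ, (Fin (t + 1) → X) → (Fin t → M) → M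
  /-- the controller -/
  ctl : ∀ t : ℕ, (Fin (t + 1) → M) → (Fin t → U) → U

/-- The triple `(x_t, q_t, u_t)` from the past triples and `x_t`. -/
def JointPolicy.act (γ : JointPolicy X U M) (t : ℕ) (h : Fin t → X × M × U) (x : X) :
    X × M × U :=
  let q := γ.enc t (Fin.snoc (α := fun _ => X) (fun i => (h i).1) x) (fun i => (h i).2.1)
  (x, q, γ.ctl t (Fin.snoc (α := fun _ => M) (fun i => (h i).2.1) q) (fun i => (h i).2.2))

/-- The law of `(x_t, q_t, u_t)_{t ≥ 0}` under the joint policy `γ` when `x_0 ∼ π`. -/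
def jointLaw (P : X → U → stdSimplex ℝ X) (π : stdSimplex ℝ X) (γ : JointPolicy X U M) :
    Measure (ℕ → X × M × U) :=
  processLaw (stdSimplex.map (γ.act 0 Fin.elim0) π) fun n h =>
    stdSimplex.map (γ.act (n + 1) h) (P (h (Fin.last n)).1 (h (Fin.last n)).2.2)

/-- The expected discounted cost of a joint policy. -/
def jointCost (P : X → U → stdSimplex ℝ X) (c : X → U → ℝ) (β : ℝ) (π : stdSimplex ℝ X)
    (γ : JointPolicy X U M) : ℝ :=
  ∑' k : ℕ, β ^ k * ∫ ω, c (ω k).1 (ω k).2.2 ∂(jointLaw P π γ)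

/-- The optimal cost `J_β(κ)` over all admissible joint policies, started from `κ_0 = κ`. -/
def optCost (P : X → U → stdSimplex ℝ X) (c : X → U → ℝ) (β : ℝ) {N : ℕ}
    (κ : WState X U M N) : ℝ :=
  ⨅ γ : JointPolicy X U M, jointCost P c β (psi P κ.1 κ.2) γ

/-! ### Uniform exploration and positive Harris recurrence -/

section Exploration

variable [Nonempty U] [Nonempty M]

/-- Uniform exploration: `(Q_t, η_t)` is uniform on all actions, independently of the past. -/
def explore : CommonPolicy X U M := fun _ _ => stdSimplex.barycenter

variable (M) in
/-- `ζ` is an invariant distribution of the source under uniform exploration. -/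
def IsInvariant (P : X → U → stdSimplex ℝ X) (ζ : stdSimplex ℝ X) : Prop :=
  ∀ x', ζ x' = ∑ x, ζ x *
    ((Fintype.card (Act X U M) : ℝ)⁻¹ * ∑ a : Act X U M, P x (control a x) x')

variable (M) in
/-- Positive Harris recurrence of the source process `(x_t)` under uniform exploration: for some
nonzero measure `φ`, every set charged by `φ` is visited infinitely often, almost surely, from
every initial state, and there is an invariant probability measure. -/
def SourcePHR (P : X → U → stdSimplex ℝ X) : Prop :=
  (∃ φ : Measure X, φ ≠ 0 ∧ ∀ (x : X) (B : Set X), 0 < φ B →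
    ∀ᵐ ω ∂(commonLaw P (stdSimplex.vertex x) (explore : CommonPolicy X U M)),
      ∃ᶠ t in atTop, (ω t).1 ∈ B) ∧
  ∃ ζ : stdSimplex ℝ X, IsInvariant M P ζ

/-- The window has positive probability under uniform exploration when the source starts from
`ζ`. -/
def PosWindow (P : X → U → stdSimplex ℝ X) (ζ : stdSimplex ℝ X) {N : ℕ}
    (I : Window X U M N) : Prop :=
  0 < commonLaw P ζ (explore : CommonPolicy X U M) {ω | windowAt N 0 ω = I}

end Exploration

/-! ### The finite window model `MDP_N` with prior `μ`

Its state `(μ, I)` is represented by the window `I`. -/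

/-- The cost `c_N(I, Q, η) = ∑_x ψ(μ, I)(x) c(x, η(Q, Q(x)))`. -/
def mdpStageCost (P : X → U → stdSimplex ℝ X) (c : X → U → ℝ) (μ : stdSimplex ℝ X) {N : ℕ}
    (I : Window X U M N) (a : Act X U M) : ℝ :=
  ∑ x, psi P μ I x * c x (control a x)

/-- The transition kernel `P_N(· | I, Q, η)`: the law of the next window, which is `I` shifted by
`(Q(x), (Q, η))` with `x ∼ ψ(μ, I)`. -/
def mdpKernel (P : X → U → stdSimplex ℝ X) (μ : stdSimplex ℝ X) {N : ℕ}
    (I : Window X U M N) (a : Act X U M) : stdSimplex ℝ (Window X U M N) :=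
  stdSimplex.map (fun x => shift I (record (x, a))) (psi P μ I)

/-- A (history dependent) policy for `MDP_N`. -/
abbrev MdpPolicy (X U M : Type*) (N : ℕ) := ∀ n : ℕ, (Fin (n + 1) → Window X U M N) → Act X U M

/-- The stationary policy given by `γ`. -/
def stationary {N : ℕ} (γ : Window X U M N → Act X U M) : MdpPolicy X U M N :=
  fun n h => γ (h (Fin.last n))

/-- The law of the state-action process of `MDP_N` from the initial state `I` under `d`. -/
def mdpLaw (P : X → U → stdSimplex ℝ X) (μ : stdSimplex ℝ X) {N : ℕ} (I : Window X U M N)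
    (d : MdpPolicy X U M N) : Measure (ℕ → Window X U M N × Act X U M) :=
  processLaw (stdSimplex.vertex (I, d 0 fun _ => I)) fun n h =>
    stdSimplex.map
      (fun I' => (I', d (n + 1) (Fin.snoc (α := fun _ => Window X U M N) (fun i => (h i).1) I')))
      (mdpKernel P μ (h (Fin.last n)).1 (h (Fin.last n)).2)

/-- The discounted cost of the policy `d` in `MDP_N`. -/
def mdpCost (P : X → U → stdSimplex ℝ X) (c : X → U → ℝ) (β : ℝ) (μ : stdSimplex ℝ X) {N : ℕ}
    (I : Window X U M N) (d : MdpPolicy X U M N) : ℝ :=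
  ∑' k : ℕ, β ^ k * ∫ ω, mdpStageCost P c μ (ω k).1 (ω k).2 ∂(mdpLaw P μ I d)

/-- The optimal discounted cost of `MDP_N`. -/
def mdpOptCost (P : X → U → stdSimplex ℝ X) (c : X → U → ℝ) (β : ℝ) (μ : stdSimplex ℝ X) {N : ℕ}
    (I : Window X U M N) : ℝ :=
  ⨅ d : MdpPolicy X U M N, mdpCost P c β μ I d

/-! ### Q-learning on windows -/

/-- The number of `k ≤ t` at which the window-action pair `(I, a)` occurs. The first window is
complete after `N` steps of the path, so the `t`-th pair is formed by the window of times
`t, …, t + N - 1` and the action of time `t + N`. -/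
def visits {N : ℕ} (ω : ℕ → X × Act X U M) (t : ℕ) (I : Window X U M N) (a : Act X U M) : ℕ :=
  ((Finset.range (t + 1)).filter fun k => windowAt N k ω = I ∧ (ω (k + N)).2 = a).card

/-- The learning rate `α_t(I, a)`. -/
def rate {N : ℕ} (ω : ℕ → X × Act X U M) (t : ℕ) (I : Window X U M N) (a : Act X U M) : ℝ :=
  if windowAt N t ω = I ∧ (ω (t + N)).2 = a then (1 + (visits ω t I a : ℝ))⁻¹ else 0

/-- The Q-learning iterates `𝐐_t(I, a)` along a path. -/
def qIter (P : X → U → stdSimplex ℝ X) (c : X → U → ℝ) (β : ℝ) (μ : stdSimplex ℝ X) {N : ℕ}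
    (ω : ℕ → X × Act X U M) : ℕ → Window X U M N → Act X U M → ℝ
  | 0, _, _ => 0
  | t + 1, I, a =>
      (1 - rate ω t I a) * qIter P c β μ ω t I a +
        rate ω t I a * (mdpStageCost P c μ (windowAt N t ω) (ω (t + N)).2 +
          β * ⨅ a' : Act X U M, qIter P c β μ ω t (windowAt N (t + 1) ω) a')

end Model

end NetCtrl

end

open NetCtrl

set_option linter.unusedSectionVars false

noncomputable section

/-! Everything rests on one estimate. Work with unnormalised filters, whose mass is the probability
of the observed symbols under the recorded actions, so that sums over symbols are expectations. The
`gap` measures the distance from a filter `p` to the predictor `z` carrying the same mass.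
Conditioning both on a cell of the quantizer and matching masses costs at most a factor 2, and the
transition under the common control contracts by `1 - δ` (`Overlap.gap_push_le`). As `δ > 1/2`, the
factor `2 * (1 - δ)` is below 1, and the filter forgets its prior geometrically under every policy
(`Overlap.wsum_gap_le`).

The model predictor is meaningless on windows impossible from `ζ`. The probability that a possible
history becomes impossible is also controlled by the gap (`Overlap.possMass_sub_le`), and invariance
of `ζ` keeps histories possible when old records are dropped (`Possible.of_append`).

The Bellman equation of the finite model therefore holds for the true dynamics up to the predictor
error `err`. Comparing finite-horizon values with the minimum of the fixed point, from above for the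
greedy policy and from below for the optimum, gives `abs_windowCost_sub_optCost_le`. Errors are
summed over all continuations, so one bound serves all policies at the price of a factor `card ^ t`.
The horizon is fixed first and then `N → ∞`, so this factor is harmless; expected errors are
summable in `N`, which gives almost sure convergence for any coupling of the windows. The lower
bound must cover all admissible joint policies: given the common information such a policy acts as a
randomized quantizer, and randomization does not help because the optimal cost is concave in the
belief (`optValue_succ_le_randomized`, `sum_optValue_jointProb_le`).

For Q-learning, the learning rate makes each iterate a running average of its targets
(`IsAveragedIteration.mul_eq`). Uniform exploration sometimes uses a constant control, so the source
mixes geometrically and empirical averages converge (`Overlap.ae_tendsto_average`). Pathwise, each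
round of averaging then shrinks the asymptotic error by a factor below 1
(`IsAveragedIteration.tendsto`). The empirical transition law out of a window has `ψ(ζ, I)` as
hidden-state law, so the limit is the fixed point of the model. -/

namespace NetCtrl

/-! ### Finite probability vectors and laws of discrete-time processes -/

section ProcessLaw

variable {S : Type*} [Fintype S]

theorem sum_map_mul {T : Type*} [Fintype T] (f : S → T) (p : stdSimplex ℝ S) (φ : T → ℝ) :
    ∑ t, stdSimplex.map f p t * φ t = ∑ s, p s * φ (f s) := by
  classical
  simp only [stdSimplex.map_coe, FunOnFinite.linearMap_apply_apply, Finset.sum_mul]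
  rw [← Finset.sum_fiberwise Finset.univ f]
  refine Finset.sum_congr rfl fun t _ => Finset.sum_congr rfl fun s hs => ?_
  rw [(Finset.mem_filter.1 hs).2]

theorem sum_vertex_mul [DecidableEq S] (s : S) (φ : S → ℝ) :
    ∑ t, stdSimplex.vertex (S := ℝ) s t * φ t = φ s := by
  simp [Pi.single_apply]

theorem barycenter_coe [Nonempty S] (s : S) :
    (stdSimplex.barycenter : stdSimplex ℝ S) s = (Fintype.card S : ℝ)⁻¹ := rfl

@[simp] theorem prodVec_apply {T : Type*} [Fintype T] (p : stdSimplex ℝ S) (r : stdSimplex ℝ T)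
    (z : S × T) : prodVec p r z = p z.1 * r z.2 := rfl

theorem sum_prodVec_mul {T : Type*} [Fintype T] (p : stdSimplex ℝ S) (r : stdSimplex ℝ T)
    (φ : S × T → ℝ) : ∑ z, prodVec p r z * φ z = ∑ s, p s * ∑ t, r t * φ (s, t) := by
  rw [Fintype.sum_prod_type]
  simp [Finset.mul_sum, mul_assoc]

theorem abs_sum_mul_le {p : S → ℝ} (hp : ∀ s, 0 ≤ p s) {φ : S → ℝ} {C : ℝ} (h : ∀ s, |φ s| ≤ C) :
    |∑ s, p s * φ s| ≤ (∑ s, p s) * C := by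
  rw [Finset.sum_mul]
  refine (Finset.abs_sum_le_sum_abs _ _).trans (Finset.sum_le_sum fun s _ => ?_)
  rw [abs_mul, abs_of_nonneg (hp s)]
  exact mul_le_mul_of_nonneg_left (h s) (hp s)

theorem abs_sum_stdSimplex_mul_le (p : stdSimplex ℝ S) {φ : S → ℝ} {C : ℝ} (h : ∀ s, |φ s| ≤ C) :
    |∑ s, p s * φ s| ≤ C := by
  simpa using abs_sum_mul_le (stdSimplex.zero_le p) h

variable [MeasurableSpace S] [MeasurableSingletonClass S]

theorem integral_simplexMeasure (p : stdSimplex ℝ S) (f : S → ℝ) :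
    ∫ s, f s ∂simplexMeasure p = ∑ s, p s * f s := by
  rw [simplexMeasure, integral_finsetSum_measure]
  · refine Finset.sum_congr rfl fun s _ => ?_
    rw [integral_smul_measure, integral_dirac, ENNReal.toReal_ofReal (stdSimplex.zero_le p s),
      smul_eq_mul]
  · intro s _
    exact Integrable.of_finite.smul_measure ENNReal.ofReal_ne_top

instance (p₀ : stdSimplex ℝ S) (step : ∀ n : ℕ, (Fin (n + 1) → S) → stdSimplex ℝ S) :
    IsProbabilityMeasure (processLaw p₀ step) :=
  inferInstanceAs (IsProbabilityMeasure (Kernel.trajMeasure _ _))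

/-- The states at times `0, …, n`. -/
def upTo (n : ℕ) (ω : ℕ → S) : Fin (n + 1) → S := fun i => ω i

theorem measurable_upTo {S : Type*} [MeasurableSpace S] (n : ℕ) : Measurable (upTo (S := S) n) :=
  measurable_pi_lambda _ fun _ => measurable_pi_apply _

variable (p₀ : stdSimplex ℝ S) (step : ∀ n : ℕ, (Fin (n + 1) → S) → stdSimplex ℝ S)

theorem integral_processLaw_zero (φ : S → ℝ) :
    ∫ ω, φ (ω 0) ∂processLaw p₀ step = ∑ s, p₀ s * φ s := by
  have hmap : (processLaw p₀ step).map (Preorder.frestrictLe (π := fun _ : ℕ => S) 0)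
      = (simplexMeasure p₀).map (MeasurableEquiv.piUnique fun _ : Finset.Iic 0 => S).symm := by
    rw [processLaw, Kernel.trajMeasure, Measure.map_comp _ _ (by fun_prop),
      Kernel.traj_map_frestrictLe, Kernel.partialTraj_self, Measure.id_comp]
  have h := integral_map (μ := processLaw p₀ step)
    (φ := Preorder.frestrictLe (π := fun _ : ℕ => S) 0)
    (by fun_prop) (f := fun z : (∀ _ : Finset.Iic 0, S) => φ (z ⟨0, by simp⟩))
    Measurable.of_discrete.aestronglyMeasurable
  rw [hmap, integral_map (by fun_prop) Measurable.of_discrete.aestronglyMeasurable] at h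
  refine h.symm.trans ?_
  exact integral_simplexMeasure p₀ φ

/-- The joint law of the past and the next state is the law of the past composed with the step
kernel. With `integral_processLaw_zero` and total mass one, this is all that is used later of the
construction of the path measure. -/
theorem integral_processLaw_succ (n : ℕ) (Ψ : (Fin (n + 1) → S) → S → ℝ) :
    ∫ ω, Ψ (upTo n ω) (ω (n + 1)) ∂processLaw p₀ step
      = ∫ ω, ∑ s, step n (upTo n ω) s * Ψ (upTo n ω) s ∂processLaw p₀ step := by
  have key := Kernel.map_frestrictLe_trajMeasure_compProd_eq_map_trajMeasure
    (X := fun _ => S) (μ₀ := simplexMeasure p₀) (κ := stepKernel step) (a := n)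
  let Φ : (∀ _ : Finset.Iic n, S) × S → ℝ := fun z =>
    Ψ (fun i => z.1 ⟨i, Finset.mem_Iic.2 (Nat.lt_succ_iff.1 i.isLt)⟩) z.2
  have h1 : ∫ z, Φ z ∂((processLaw p₀ step).map (Preorder.frestrictLe n) ⊗ₘ stepKernel step n)
      = ∫ z, Φ z ∂((processLaw p₀ step).map
          (fun x => (Preorder.frestrictLe (π := fun _ => S) n x, x (n + 1)))) := by
    rw [processLaw, key]
  have hm : Measurable (Preorder.frestrictLe (π := fun _ : ℕ => S) n) := by fun_prop
  have := Measure.isProbabilityMeasure_map (μ := processLaw p₀ step) hm.aemeasurable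
  rw [Measure.integral_compProd Integrable.of_finite,
    integral_map hm.aemeasurable (Measurable.of_discrete.aestronglyMeasurable),
    integral_map (by fun_prop) (Measurable.of_discrete.aestronglyMeasurable)] at h1
  refine h1.symm.trans (integral_congr_ae (Eventually.of_forall fun ω => ?_))
  exact integral_simplexMeasure _ _

end ProcessLaw

/-! ### Windows as lists, unnormalised filters and possible histories -/

section Filtering

variable {X U M : Type*}

/-- The records of a window, newest first. -/
def rev {n : ℕ} (I : Fin n → Rec X U M) : List (Rec X U M) := (List.ofFn I).reverse

@[simp] theorem length_rev {n : ℕ} (I : Fin n → Rec X U M) : (rev I).length = n := by simp [rev]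

@[simp] theorem rev_zero (I : Fin 0 → Rec X U M) : rev I = [] := by simp [rev]

@[simp] theorem rev_snoc {n : ℕ} (I : Fin n → Rec X U M) (w : Rec X U M) :
    rev (Fin.snoc (α := fun _ => Rec X U M) I w) = w :: rev I := by
  rw [rev, List.ofFn_succ_last]
  simp [rev]

theorem rev_succ {n : ℕ} (I : Fin (n + 1) → Rec X U M) : rev I = rev (Fin.tail I) ++ [I 0] := by
  simp [rev, List.ofFn_succ, Fin.tail_def]

/-- With the newest record first, a window is a prefix of the history, so forgetting old records is
truncation. This is the reason for the reversed order. -/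
theorem rev_shift {N : ℕ} (I : Window X U M N) (w : Rec X U M) :
    rev (shift I w) = (w :: rev I).take N := by
  have h := rev_succ (Fin.snoc (α := fun _ => Rec X U M) I w)
  rw [rev_snoc] at h
  rw [h, List.take_append_of_le_length (by simp), List.take_of_length_le (by simp)]
  rfl

/-- The records at times `0, …, n - 1` of a path. -/
def recs (n : ℕ) (ω : ℕ → X × Act X U M) : Fin n → Rec X U M := fun i => record (ω i)

theorem recs_succ (n : ℕ) (ω : ℕ → X × Act X U M) :
    recs (n + 1) ω = Fin.snoc (α := fun _ => Rec X U M) (recs n ω) (record (ω n)) := by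
  funext i
  refine Fin.lastCases ?_ (fun i => ?_) i <;> simp [recs]

theorem windowAt_zero (N : ℕ) (ω : ℕ → X × Act X U M) : windowAt N 0 ω = recs N ω := by
  funext i
  simp [windowAt, recs]

theorem windowAt_succ (N t : ℕ) (ω : ℕ → X × Act X U M) :
    windowAt N (t + 1) ω = shift (windowAt N t ω) (record (ω (t + N))) := by
  funext i
  have h : (Fin.snoc (α := fun _ => Rec X U M) (windowAt N t ω) (record (ω (t + N))))
      = windowAt (N + 1) t ω := by
    funext j
    refine Fin.lastCases ?_ (fun j => ?_) j <;> simp [windowAt]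
  simp only [shift, h, Fin.tail_def, windowAt, Fin.val_succ]
  congr 2
  ring

variable [Fintype X]

/-- The total mass of a vector. -/
def mass (p : X → ℝ) : ℝ := ∑ x, p x

@[simp] theorem mass_stdSimplex (p : stdSimplex ℝ X) : mass p = 1 := stdSimplex.sum_eq_one p

theorem mass_nonneg {p : X → ℝ} (hp : ∀ x, 0 ≤ p x) : 0 ≤ mass p :=
  Finset.sum_nonneg fun x _ => hp x

theorem mass_mul (r : ℝ) (p : X → ℝ) : mass (fun x => r * p x) = r * mass p :=
  (Finset.mul_sum _ _ _).symm

variable [DecidableEq M]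

/-- The unnormalised predictor update. -/
def push (P : X → U → stdSimplex ℝ X) (p : X → ℝ) (w : Rec X U M) : X → ℝ := fun x' =>
  ∑ x, if w.2.1 x = w.1 then P x (w.2.2 w.2.1 w.1) x' * p x else 0

/-- The unnormalised filter along a list of records, newest first. -/
def filt (P : X → U → stdSimplex ℝ X) (p : X → ℝ) : List (Rec X U M) → X → ℝ
  | [] => p
  | w :: l => push P (filt P p l) w

/-- The predictor after a list of records, newest first. -/
def post (P : X → U → stdSimplex ℝ X) (π : stdSimplex ℝ X) : List (Rec X U M) → stdSimplex ℝ X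
  | [] => π
  | w :: l => update P (post P π l) w

variable (P : X → U → stdSimplex ℝ X)

theorem push_nonneg {p : X → ℝ} (hp : ∀ x, 0 ≤ p x) (w : Rec X U M) (x : X) :
    0 ≤ push P p w x := by
  refine Finset.sum_nonneg fun y _ => ?_
  split_ifs
  exacts [mul_nonneg (stdSimplex.zero_le _ _) (hp y), le_rfl]

theorem push_mul (r : ℝ) (p : X → ℝ) (w : Rec X U M) :
    push P (fun x => r * p x) w = fun x => r * push P p w x := by
  funext x
  simp only [push, Finset.mul_sum]
  refine Finset.sum_congr rfl fun y _ => ?_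
  split_ifs <;> ring

theorem push_add (p p' : X → ℝ) (w : Rec X U M) :
    push P (fun x => p x + p' x) w = fun x => push P p w x + push P p' w x := by
  funext x
  simp only [push, ← Finset.sum_add_distrib]
  refine Finset.sum_congr rfl fun y _ => ?_
  split_ifs <;> ring

theorem push_mono {p p' : X → ℝ} (h : ∀ x, p x ≤ p' x) (w : Rec X U M) (x : X) :
    push P p w x ≤ push P p' w x := by
  refine Finset.sum_le_sum fun y _ => ?_
  split_ifs
  exacts [mul_le_mul_of_nonneg_left (h y) (stdSimplex.zero_le _ _), le_rfl]

theorem mass_push (p : X → ℝ) (w : Rec X U M) :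
    mass (push P p w) = ∑ x, if w.2.1 x = w.1 then p x else 0 := by
  rw [mass]
  simp only [push]
  rw [Finset.sum_comm]
  refine Finset.sum_congr rfl fun x _ => ?_
  split_ifs
  · rw [← Finset.sum_mul, stdSimplex.sum_eq_one, one_mul]
  · simp

theorem mass_push_le {p : X → ℝ} (hp : ∀ x, 0 ≤ p x) (w : Rec X U M) :
    mass (push P p w) ≤ mass p := by
  rw [mass_push]
  refine Finset.sum_le_sum fun y _ => ?_
  split_ifs
  exacts [le_rfl, hp y]

theorem symProb_eq_mass_push (π : stdSimplex ℝ X) (w : Rec X U M) :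
    symProb π w = mass (push P π w) := (mass_push P π w).symm

/-- Multiplying by the normaliser removes the division. For a symbol of probability zero both sides
vanish, so the conventional value of the update plays no role. -/
theorem symProb_mul_update (π : stdSimplex ℝ X) (w : Rec X U M) (x : X) :
    symProb π w * update P π w x = push P π w x := by
  by_cases h : symProb π w = 0
  · rw [h, zero_mul]
    have h0 : mass (push P π w) = 0 := by rw [← symProb_eq_mass_push, h]
    exact ((Finset.sum_eq_zero_iff_of_nonneg
      fun y _ => push_nonneg P (stdSimplex.zero_le π) w y).1 h0 x (Finset.mem_univ x)).symm
  · rw [update, dif_neg h]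
    exact mul_inv_cancel_left₀ h _

theorem filt_nonneg {p : X → ℝ} (hp : ∀ x, 0 ≤ p x) (l : List (Rec X U M)) (x : X) :
    0 ≤ filt P p l x := by
  induction l generalizing x with
  | nil => exact hp x
  | cons w l ih => exact push_nonneg P ih w x

theorem filt_mul (r : ℝ) (p : X → ℝ) (l : List (Rec X U M)) :
    filt P (fun x => r * p x) l = fun x => r * filt P p l x := by
  induction l with
  | nil => rfl
  | cons w l ih => rw [filt, ih, push_mul]; rfl

theorem filt_mono {p p' : X → ℝ} (h : ∀ x, p x ≤ p' x) (l : List (Rec X U M)) (x : X) :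
    filt P p l x ≤ filt P p' l x := by
  induction l generalizing x with
  | nil => exact h x
  | cons w l ih => exact push_mono P ih w x

theorem filt_append (p : X → ℝ) (l l' : List (Rec X U M)) :
    filt P p (l ++ l') = filt P (filt P p l') l := by
  induction l with
  | nil => rfl
  | cons w l ih => rw [List.cons_append, filt, ih, filt]

/-- The filter is linear in its prior, so normalising at every step or once at the end is the same.
On impossible lists both sides are zero. -/
theorem filt_eq_mass_mul_post (π : stdSimplex ℝ X) (l : List (Rec X U M)) (x : X) :
    filt P π l x = mass (filt P π l) * post P π l x := by
  induction l generalizing x with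
  | nil => simp [filt, post]
  | cons w l ih =>
    have h : filt P π l = fun x => mass (filt P π l) * post P π l x := funext ih
    have h2 : filt P π (w :: l)
        = fun x => mass (filt P π l) * push P (post P π l) w x := by
      rw [filt]
      conv_lhs => rw [h]
      exact push_mul P _ _ _
    rw [h2, mass_mul, ← symProb_eq_mass_push, post, mul_assoc, symProb_mul_update]

theorem post_append_singleton (π : stdSimplex ℝ X) (l : List (Rec X U M)) (w : Rec X U M) :
    post P π (l ++ [w]) = post P (update P π w) l := by
  induction l with
  | nil => rfl
  | cons v l ih => rw [List.cons_append, post, ih, post]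

theorem psi_eq_post (π : stdSimplex ℝ X) {N : ℕ} (I : Window X U M N) :
    psi P π I = post P π (rev I) := by
  induction N generalizing π with
  | zero => simp [psi, post]
  | succ N ih => rw [psi, ih, rev_succ, post_append_singleton]

/-- A list of records (newest first) that has positive probability from the prior `p`. -/
def Possible (p : X → ℝ) (l : List (Rec X U M)) : Prop := 0 < mass (filt P p l)

variable {P} in
theorem Possible.of_cons {p : X → ℝ} (hp : ∀ x, 0 ≤ p x) {w : Rec X U M} {l : List (Rec X U M)}
    (h : Possible P p (w :: l)) : Possible P p l :=
  lt_of_lt_of_le h (mass_push_le P (filt_nonneg P hp l) w)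

variable {P} in
theorem Possible.symProb_pos {π : stdSimplex ℝ X} {w : Rec X U M} {l : List (Rec X U M)}
    (h : Possible P π (w :: l)) : 0 < symProb (post P π l) w := by
  have h1 := h.of_cons (stdSimplex.zero_le π)
  have h2 : mass (filt P π (w :: l)) = mass (filt P π l) * symProb (post P π l) w := by
    have h : filt P π l = fun x => mass (filt P π l) * post P π l x :=
      funext fun x => filt_eq_mass_mul_post P π l x
    rw [filt]
    conv_lhs => rw [h]
    rw [push_mul, mass_mul, ← symProb_eq_mass_push]
  exact pos_of_mul_pos_right (h2 ▸ h) h1.le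

/-- Chain rule: the mass of the longer list is the mass of `l` times the predicted probability of
the newest symbol. -/
theorem possible_cons_iff {π : stdSimplex ℝ X} {w : Rec X U M} {l : List (Rec X U M)} :
    Possible P π (w :: l) ↔ Possible P π l ∧ symProb (post P π l) w ≠ 0 := by
  refine ⟨fun h => ⟨h.of_cons (stdSimplex.zero_le π), h.symProb_pos.ne'⟩, fun ⟨h1, h2⟩ => ?_⟩
  have h : filt P π l = fun x => mass (filt P π l) * post P π l x :=
    funext fun x => filt_eq_mass_mul_post P π l x
  rw [Possible, filt, h, push_mul, mass_mul, ← symProb_eq_mass_push]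
  refine mul_pos h1 (lt_of_le_of_ne ?_ h2.symm)
  rw [symProb_eq_mass_push P]
  exact mass_nonneg (push_nonneg P (stdSimplex.zero_le _) w)

/-- The window after further records. -/
def winAfter {N : ℕ} (I : Window X U M N) : ∀ {n : ℕ}, (Fin n → Rec X U M) → Window X U M N
  | 0, _ => I
  | _ + 1, h => shift (winAfter I (Fin.init h)) (h (Fin.last _))

@[simp] theorem winAfter_snoc {N : ℕ} (I : Window X U M N) {n : ℕ} (h : Fin n → Rec X U M)
    (w : Rec X U M) :
    winAfter I (Fin.snoc (α := fun _ => Rec X U M) h w) = shift (winAfter I h) w := by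
  simp [winAfter]

theorem stateAfter_snd {N : ℕ} (κ : WState X U M N) (n : ℕ) (h : Fin n → Rec X U M) :
    (stateAfter P κ n h).2 = winAfter κ.2 h := by
  induction n with
  | zero => rfl
  | succ n ih => simp only [stateAfter, advance, winAfter, ih]

end Filtering

/-! ### Sums over record sequences weighted by a policy -/

section WeightedSums

variable {X U M : Type*} [Fintype X] [DecidableEq X] [Fintype U] [Fintype M] [DecidableEq M]

/-- The weights used to select actions from past records. -/
abbrev Weights (X U M : Type*) := ∀ n : ℕ, (Fin n → Rec X U M) → Act X U M → ℝ

/-- The sum of `Φ` over all sequences of `n` records, weighted by the product of the weights of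
the actions. -/
def wsum (g : Weights X U M) : ∀ n : ℕ, ((Fin n → Rec X U M) → ℝ) → ℝ
  | 0, Φ => Φ Fin.elim0
  | n + 1, Φ => wsum g n fun K => ∑ w : Rec X U M,
      g n K w.2 * Φ (Fin.snoc (α := fun _ => Rec X U M) K w)

/-- The weights of a randomized policy. -/
def CommonPolicy.weights (g : CommonPolicy X U M) : Weights X U M := fun n h a => g n h a

variable {g : Weights X U M}

theorem wsum_mono (hg : ∀ n h a, 0 ≤ g n h a) {n : ℕ} {Φ Ψ : (Fin n → Rec X U M) → ℝ}
    (h : ∀ K, Φ K ≤ Ψ K) : wsum g n Φ ≤ wsum g n Ψ := by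
  induction n with
  | zero => exact h _
  | succ n ih =>
    exact ih fun K => Finset.sum_le_sum fun w _ => mul_le_mul_of_nonneg_left (h _) (hg _ _ _)

theorem wsum_mul (r : ℝ) {n : ℕ} (Φ : (Fin n → Rec X U M) → ℝ) :
    wsum g n (fun K => r * Φ K) = r * wsum g n Φ := by
  induction n with
  | zero => rfl
  | succ n ih =>
    simp only [wsum, ← ih, Finset.mul_sum]
    congr 1; funext K; exact Finset.sum_congr rfl fun w _ => by ring

theorem wsum_add {n : ℕ} (Φ Ψ : (Fin n → Rec X U M) → ℝ) :
    wsum g n (fun K => Φ K + Ψ K) = wsum g n Φ + wsum g n Ψ := by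
  induction n with
  | zero => rfl
  | succ n ih => simp only [wsum, ← ih, mul_add, Finset.sum_add_distrib]

theorem wsum_sub {n : ℕ} (Φ Ψ : (Fin n → Rec X U M) → ℝ) :
    wsum g n (fun K => Φ K - Ψ K) = wsum g n Φ - wsum g n Ψ := by
  have h := wsum_add (g := g) Φ fun K => (-1) * Ψ K
  rw [wsum_mul] at h
  simpa [sub_eq_add_neg] using h

theorem wsum_congr_weights {g' : Weights X U M} {n : ℕ} (h : ∀ m < n, g m = g' m)
    (Φ : (Fin n → Rec X U M) → ℝ) : wsum g n Φ = wsum g' n Φ := by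
  induction n with
  | zero => rfl
  | succ n ih =>
    rw [wsum, wsum, ih fun m hm => h m (hm.trans n.lt_succ_self), h n n.lt_succ_self]

theorem sum_rec (f : Rec X U M → ℝ) : ∑ w, f w = ∑ a : Act X U M, ∑ q : M, f (q, a) :=
  (Fintype.sum_prod_type f).trans Finset.sum_comm

variable (P : X → U → stdSimplex ℝ X)

theorem sum_push_mul (p : X → ℝ) (w : Rec X U M) (φ : X → ℝ) :
    ∑ x', push P p w x' * φ x'
      = ∑ x, if w.2.1 x = w.1 then p x * ∑ x', P x (w.2.2 w.2.1 w.1) x' * φ x' else 0 := by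
  simp only [push, Finset.sum_mul]
  rw [Finset.sum_comm]
  refine Finset.sum_congr rfl fun x _ => ?_
  split_ifs
  · rw [Finset.mul_sum]
    exact Finset.sum_congr rfl fun x' _ => by ring
  · simp

/-- The cells of the quantizer partition the state space, so summing over symbols restores a full
step of the source. -/
theorem sum_sum_push_mul (p : X → ℝ) (a : Act X U M) (φ : Rec X U M → X → ℝ) :
    ∑ q : M, ∑ x', push P p (q, a) x' * φ (q, a) x'
      = ∑ x, p x * ∑ x', P x (control a x) x' * φ (record (x, a)) x' := by
  simp only [sum_push_mul]
  rw [Finset.sum_comm]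
  refine Finset.sum_congr rfl fun x _ => ?_
  simp [control, record, sym]

theorem sum_mass_push (p : X → ℝ) (a : Act X U M) : ∑ q : M, mass (push P p (q, a)) = mass p := by
  have h := sum_sum_push_mul P p a fun _ _ => 1
  simpa [mass] using h

end WeightedSums

/-! ### Expectations under policies based on common information -/

section CommonLaw

variable {X U M : Type*} [Fintype X] [DecidableEq X] [Fintype U] [DecidableEq U] [Fintype M]
  [DecidableEq M] [MeasurableSpace X] [MeasurableSingletonClass X] [MeasurableSpace U]
  [MeasurableSingletonClass U] [MeasurableSpace M] [MeasurableSingletonClass M]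
  (P : X → U → stdSimplex ℝ X)

instance (π : stdSimplex ℝ X) (g : CommonPolicy X U M) : IsProbabilityMeasure (commonLaw P π g) :=
  inferInstanceAs (IsProbabilityMeasure (processLaw _ _))

/-- Actions depend on the past only through the records, so the weight of a record sequence factors
into policy weights and the unnormalised filter. The filter does not depend on the policy; this
separation lets one filter estimate serve all policies. -/
theorem integral_commonLaw (π : stdSimplex ℝ X) (g : CommonPolicy X U M) (n : ℕ)
    (φ : (Fin n → Rec X U M) → X × Act X U M → ℝ) :
    ∫ ω, φ (recs n ω) (ω n) ∂commonLaw P π g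
      = wsum g.weights n fun K => ∑ x, filt P π (rev K) x * ∑ a, g n K a * φ K (x, a) := by
  induction n with
  | zero =>
    have h := integral_processLaw_zero (prodVec π (g 0 Fin.elim0)) (fun n h =>
      prodVec (P (h (Fin.last n)).1 (control (h (Fin.last n)).2 (h (Fin.last n)).1))
        (g (n + 1) fun i => record (h i))) (φ Fin.elim0)
    rw [sum_prodVec_mul] at h
    simp only [wsum, rev_zero, filt]
    rw [← h]
    refine integral_congr_ae (Eventually.of_forall fun ω => ?_)
    simp only
    congr 1
    exact Subsingleton.elim _ _
  | succ n ih =>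
    have h := integral_processLaw_succ (prodVec π (g 0 Fin.elim0)) (fun n h =>
      prodVec (P (h (Fin.last n)).1 (control (h (Fin.last n)).2 (h (Fin.last n)).1))
        (g (n + 1) fun i => record (h i))) n (fun h s => φ (fun i => record (h i)) s)
    simp only [sum_prodVec_mul] at h
    refine h.trans ?_
    have h2 := ih fun K s => ∑ x', P s.1 (control s.2 s.1) x' *
      ∑ a', g (n + 1) (Fin.snoc (α := fun _ => Rec X U M) K (record s)) a' *
        φ (Fin.snoc (α := fun _ => Rec X U M) K (record s)) (x', a')
    refine Eq.trans (integral_congr_ae (Eventually.of_forall fun ω => ?_)) (h2.trans ?_)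
    · have : (fun i => record (upTo n ω i)) = recs (n + 1) ω := rfl
      simp only [this, recs_succ]
      rfl
    · rw [wsum]
      congr 1
      funext K
      rw [sum_rec]
      simp only [← Finset.mul_sum, CommonPolicy.weights, rev_snoc, filt]
      rw [Finset.sum_congr rfl fun a _ => congrArg (g n K a * ·)
        (sum_sum_push_mul P (filt P π (rev K)) a fun w x' => ∑ a',
          g (n + 1) (Fin.snoc (α := fun _ => Rec X U M) K w) a' *
            φ (Fin.snoc (α := fun _ => Rec X U M) K w) (x', a'))]
      simp only [Finset.mul_sum]
      rw [Finset.sum_comm]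
      refine Finset.sum_congr rfl fun a _ => Finset.sum_congr rfl fun x _ => ?_
      refine Finset.sum_congr rfl fun x' _ => Finset.sum_congr rfl fun a' _ => by ring

theorem integral_recs_commonLaw (π : stdSimplex ℝ X) (g : CommonPolicy X U M) (n : ℕ)
    (φ : (Fin n → Rec X U M) → ℝ) :
    ∫ ω, φ (recs n ω) ∂commonLaw P π g
      = wsum g.weights n fun K => mass (filt P π (rev K)) * φ K := by
  rw [integral_commonLaw P π g n fun K _ => φ K]
  congr 1
  funext K
  simp [← Finset.sum_mul, mass]

end CommonLaw

/-! ### Uniform exploration and possible windows -/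

section PossibleWindows

variable {X U M : Type*} [Fintype X] [DecidableEq X] [Fintype U] [DecidableEq U] [Fintype M]
  [DecidableEq M]

theorem wsum_const (r : ℝ) (n : ℕ) (Φ : (Fin n → Rec X U M) → ℝ) :
    wsum (fun _ _ _ => r) n Φ = r ^ n * ∑ K, Φ K := by
  induction n with
  | zero => simp [wsum, Subsingleton.elim default (Fin.elim0 : Fin 0 → Rec X U M)]
  | succ n ih =>
    have h : ∀ K : Fin n → Rec X U M, ∑ w, r * Φ (Fin.snoc (α := fun _ => Rec X U M) K w)
        = r * ∑ w, Φ (Fin.snoc (α := fun _ => Rec X U M) K w) := fun K => by rw [Finset.mul_sum]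
    rw [wsum, ih]
    simp only [h, ← Finset.mul_sum]
    rw [← (Fin.snocEquiv fun _ : Fin (n + 1) => Rec X U M).sum_comp, Fintype.sum_prod_type,
      Finset.sum_comm]
    simp only [pow_succ, mul_assoc]
    rfl

theorem weights_explore [Nonempty U] [Nonempty M] :
    CommonPolicy.weights (explore : CommonPolicy X U M)
      = fun _ _ _ => (Fintype.card (Act X U M) : ℝ)⁻¹ := rfl

section

variable [MeasurableSpace X] [MeasurableSingletonClass X] [MeasurableSpace U]
  [MeasurableSingletonClass U] [MeasurableSpace M] [MeasurableSingletonClass M]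
  [Nonempty U] [Nonempty M] (P : X → U → stdSimplex ℝ X)

theorem integral_explore (π : stdSimplex ℝ X) (n : ℕ)
    (φ : (Fin n → Rec X U M) → X × Act X U M → ℝ) :
    ∫ ω, φ (recs n ω) (ω n) ∂commonLaw P π explore
      = (Fintype.card (Act X U M) : ℝ)⁻¹ ^ (n + 1) *
        ∑ K : Fin n → Rec X U M, ∑ x, filt P π (rev K) x * ∑ a, φ K (x, a) := by
  rw [integral_commonLaw, weights_explore, wsum_const, pow_succ, mul_assoc]
  congr 1
  simp only [Finset.mul_sum]
  refine Finset.sum_congr rfl fun K _ => Finset.sum_congr rfl fun x _ =>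
    Finset.sum_congr rfl fun a _ => ?_
  exact mul_left_comm _ _ _

theorem measurable_recs (n : ℕ) : Measurable (recs (X := X) (U := U) (M := M) n) := by
  refine measurable_pi_lambda _ fun i => ?_
  exact (Measurable.of_discrete (f := record)).comp (measurable_pi_apply _)

theorem measurable_windowAt (N t : ℕ) : Measurable (windowAt (X := X) (U := U) (M := M) N t) := by
  refine measurable_pi_lambda _ fun i => ?_
  exact (Measurable.of_discrete (f := record)).comp (measurable_pi_apply _)

/-- Exploration gives every action sequence the same positive weight, so only the probability of the
symbols under the recorded actions, which is the mass of the filter, decides positivity. -/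
theorem posWindow_iff (ζ : stdSimplex ℝ X) {N : ℕ} (I : Window X U M N) :
    PosWindow P ζ I ↔ Possible P ζ (rev I) := by
  have h := integral_recs_commonLaw P ζ (explore : CommonPolicy X U M) N
    (({I} : Set (Window X U M N)).indicator fun _ => 1)
  have hs : {ω : ℕ → X × Act X U M | windowAt N 0 ω = I} = recs N ⁻¹' {I} := by
    ext ω; simp [windowAt_zero]
  have hm : MeasurableSet (recs N ⁻¹' {I} : Set (ℕ → X × Act X U M)) :=
    measurable_recs N (measurableSet_singleton I)
  have h2 : ∫ ω, (({I} : Set (Window X U M N)).indicator (fun _ => (1 : ℝ))) (recs N ω)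
      ∂commonLaw P ζ (explore : CommonPolicy X U M)
      = (commonLaw P ζ (explore : CommonPolicy X U M)).real (recs N ⁻¹' {I}) :=
    integral_indicator_one hm
  rw [h2, weights_explore, wsum_const, Finset.sum_eq_single I] at h
  · have hp : 0 < commonLaw P ζ (explore : CommonPolicy X U M) (recs N ⁻¹' {I})
        ↔ 0 < (commonLaw P ζ (explore : CommonPolicy X U M)).real (recs N ⁻¹' {I}) := by
      rw [measureReal_def, ENNReal.toReal_pos_iff]
      simp [measure_lt_top]
    rw [PosWindow, hs, hp, h, Possible]
    have hc : (0 : ℝ) < (Fintype.card (Act X U M) : ℝ)⁻¹ ^ N := by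
      have : 0 < Fintype.card (Act X U M) := Fintype.card_pos
      positivity
    rw [Set.indicator_of_mem (Set.mem_singleton I), mul_one, mul_pos_iff_of_pos_left hc]
  · intro K _ hK
    simp [hK]
  · simp

end

/-- Summing over symbols gives a source step, and summing over actions gives `card` times the
exploration kernel, which fixes `ζ`. -/
theorem sum_push_rec [Nonempty U] [Nonempty M] {P : X → U → stdSimplex ℝ X} {ζ : stdSimplex ℝ X}
    (hζ : IsInvariant M P ζ) (x' : X) :
    ∑ w : Rec X U M, push P ζ w x' = Fintype.card (Act X U M) * ζ x' := by
  rw [sum_rec]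
  have h : ∀ a : Act X U M, ∑ q : M, push P ζ (q, a) x' = ∑ x, ζ x * P x (control a x) x' := by
    intro a
    simpa using sum_sum_push_mul P ζ a fun _ y => if y = x' then 1 else 0
  have hc : (Fintype.card (Act X U M) : ℝ) ≠ 0 := Nat.cast_ne_zero.2 Fintype.card_ne_zero
  rw [Finset.sum_congr rfl fun a _ => h a, hζ x', Finset.sum_comm, Finset.mul_sum]
  refine Finset.sum_congr rfl fun x _ => ?_
  rw [← Finset.mul_sum]
  field_simp

/-- Invariance: a possible list of records stays possible when its oldest records are dropped. -/
theorem Possible.of_append [Nonempty U] [Nonempty M] {P : X → U → stdSimplex ℝ X}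
    {ζ : stdSimplex ℝ X} (hζ : IsInvariant M P ζ) {l l' : List (Rec X U M)}
    (h : Possible P ζ (l ++ l')) : Possible P ζ l := by
  induction l' using List.reverseRecOn with
  | nil => simpa using h
  | append_singleton l' w ih =>
    refine ih ?_
    rw [← List.append_assoc, Possible, filt_append] at h
    -- One record started from `ζ` leaves a vector dominated by a multiple of `ζ`, being a single
    -- term of the sum in `sum_push_rec`. Monotonicity of the filter then allows the restart from
    -- `ζ` itself.
    have hle : ∀ x, filt P ζ [w] x ≤ (Fintype.card (Act X U M) : ℝ) * ζ x := fun x => by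
      rw [← sum_push_rec hζ x]
      exact Finset.single_le_sum (f := fun w : Rec X U M => push P ζ w x)
        (fun v _ => push_nonneg P (stdSimplex.zero_le ζ) v x) (Finset.mem_univ w)
    have h2 := lt_of_lt_of_le h (Finset.sum_le_sum fun x _ => filt_mono P hle (l ++ l') x)
    rw [filt_mul] at h2
    change 0 < mass _ at h2
    rw [mass_mul] at h2
    exact pos_of_mul_pos_right h2 (Nat.cast_nonneg _)

theorem Possible.take [Nonempty U] [Nonempty M] {P : X → U → stdSimplex ℝ X}
    {ζ : stdSimplex ℝ X} (hζ : IsInvariant M P ζ) {l : List (Rec X U M)}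
    (h : Possible P ζ l) (n : ℕ) : Possible P ζ (l.take n) := by
  rw [← List.take_append_drop n l] at h
  exact h.of_append hζ

end PossibleWindows

/-! ### Dobrushin contraction and the one-step estimate for the filter -/

section Contraction

variable {X U M : Type*} [Fintype X]

/-- Any two rows of any of the transition matrices have overlap at least `δ`. -/
def Overlap (P : X → U → stdSimplex ℝ X) (δ : ℝ) : Prop :=
  ∀ u x y, δ ≤ ∑ j, min (P x u j) (P y u j)

/-- The strict bound survives the minimum over finitely many controls. A row overlaps itself with
mass 1, whence `δ ≤ 1`. -/
theorem exists_overlap [Finite U] [Nonempty X] [Nonempty U] {P : X → U → stdSimplex ℝ X} {r : ℝ}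
    (h : ∀ u, r < dobrushin P u) : ∃ δ, r < δ ∧ δ ≤ 1 ∧ Overlap P δ := by
  obtain ⟨u₀, hu₀⟩ := Finite.exists_min (dobrushin P)
  have hle : ∀ u x y, dobrushin P u ≤ ∑ j, min (P x u j) (P y u j) := fun u x y =>
    ciInf_le (Set.finite_range fun p : X × X => ∑ j, min (P p.1 u j) (P p.2 u j)).bddBelow (x, y)
  refine ⟨dobrushin P u₀, h u₀, ?_, fun u x y => (hu₀ u).trans (hle u x y)⟩
  obtain ⟨x⟩ := ‹Nonempty X›
  simpa using hle u₀ x x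

variable {P : X → U → stdSimplex ℝ X} {δ : ℝ}

/-- The common part of the two rows cancels; at most `1 - δ` of mass remains on each side, and it
sees at most the oscillation of `f`. -/
theorem Overlap.sum_sub_sum_le (hP : Overlap P δ) {f : X → ℝ} {d : ℝ}
    (hf : ∀ x y, f x - f y ≤ d) (u : U) (x y : X) :
    ∑ j, P x u j * f j - ∑ j, P y u j * f j ≤ (1 - δ) * d := by
  have : Nonempty X := ⟨x⟩
  obtain ⟨i, hi⟩ := Finite.exists_max f
  obtain ⟨k, hk⟩ := Finite.exists_min f
  set s := ∑ j, min (P x u j) (P y u j) with hs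
  have hd : 0 ≤ d := by simpa using hf x x
  have hxs : ∑ j, (P x u j - min (P x u j) (P y u j)) = 1 - s := by
    rw [Finset.sum_sub_distrib, stdSimplex.sum_eq_one]
  have hys : ∑ j, (P y u j - min (P x u j) (P y u j)) = 1 - s := by
    rw [Finset.sum_sub_distrib, stdSimplex.sum_eq_one]
  have h1 : ∑ j, (P x u j - min (P x u j) (P y u j)) * f j ≤ (1 - s) * f i := by
    rw [← hxs, Finset.sum_mul]
    exact Finset.sum_le_sum fun j _ =>
      mul_le_mul_of_nonneg_left (hi j) (sub_nonneg.2 (min_le_left _ _))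
  have h2 : (1 - s) * f k ≤ ∑ j, (P y u j - min (P x u j) (P y u j)) * f j := by
    rw [← hys, Finset.sum_mul]
    exact Finset.sum_le_sum fun j _ =>
      mul_le_mul_of_nonneg_left (hk j) (sub_nonneg.2 (min_le_right _ _))
  have h3 : ∑ j, P x u j * f j - ∑ j, P y u j * f j
      = ∑ j, (P x u j - min (P x u j) (P y u j)) * f j
        - ∑ j, (P y u j - min (P x u j) (P y u j)) * f j := by
    rw [← Finset.sum_sub_distrib, ← Finset.sum_sub_distrib]
    exact Finset.sum_congr rfl fun j _ => by ring
  have hs1 : 0 ≤ 1 - s := by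
    rw [← hxs]
    exact Finset.sum_nonneg fun j _ => sub_nonneg.2 (min_le_left _ _)
  have hsδ : 1 - s ≤ 1 - δ := sub_le_sub_left (hP u x y) 1
  calc _ ≤ (1 - s) * f i - (1 - s) * f k := h3 ▸ sub_le_sub h1 h2
    _ = (1 - s) * (f i - f k) := by ring
    _ ≤ (1 - s) * d := mul_le_mul_of_nonneg_left (hf i k) hs1
    _ ≤ (1 - δ) * d := mul_le_mul_of_nonneg_right hsδ hd

/-- Dual form of the oscillation bound. Test against signs, which have oscillation at most 2; their
image under the kernel oscillates by at most `2 * (1 - δ)`, and may be centred at its midrange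
because `m` has total mass zero. -/
theorem Overlap.sum_abs_le (hP : Overlap P δ) (u : U) {m : X → ℝ} (hm : ∑ x, m x = 0) :
    ∑ j, |∑ x, P x u j * m x| ≤ (1 - δ) * ∑ x, |m x| := by
  rcases isEmpty_or_nonempty X with hX | hX
  · simp
  let f : X → ℝ := fun j => if 0 ≤ ∑ x, P x u j * m x then 1 else -1
  have hf : ∀ j, |∑ x, P x u j * m x| = (∑ x, P x u j * m x) * f j := fun j => by
    simp only [f]
    split_ifs with h
    · rw [abs_of_nonneg h, mul_one]
    · rw [abs_of_neg (not_le.1 h), mul_neg, mul_one]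
  have hfd : ∀ x y, f x - f y ≤ 2 := fun x y => by
    simp only [f]
    split_ifs <;> norm_num
  let g : X → ℝ := fun x => ∑ j, P x u j * f j
  have hg : ∀ x y, g x - g y ≤ (1 - δ) * 2 := fun x y => hP.sum_sub_sum_le hfd u x y
  obtain ⟨i, hi⟩ := Finite.exists_max g
  obtain ⟨k, hk⟩ := Finite.exists_min g
  have hgc : ∀ x, |g x - (g i + g k) / 2| ≤ 1 - δ := fun x => by
    have h1 := hi x
    have h2 := hk x
    have h3 := hg i k
    rw [abs_le]
    constructor <;> linarith
  have h4 : ∑ j, |∑ x, P x u j * m x| = ∑ x, m x * (g x - (g i + g k) / 2) := by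
    simp only [mul_sub, Finset.sum_sub_distrib, ← Finset.sum_mul, hm, zero_mul, sub_zero, g]
    rw [Finset.sum_congr rfl fun j _ => hf j]
    simp only [Finset.sum_mul, Finset.mul_sum]
    rw [Finset.sum_comm]
    exact Finset.sum_congr rfl fun x _ => Finset.sum_congr rfl fun j _ => by ring
  rw [h4, mul_comm, Finset.sum_mul]
  refine Finset.sum_le_sum fun x _ => (le_abs_self _).trans ?_
  rw [abs_mul]
  exact mul_le_mul_of_nonneg_left (hgc x) (abs_nonneg _)

/-- The distance of `p` from the multiple of `z` with the same mass. -/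
def gap (p : X → ℝ) (z : stdSimplex ℝ X) : ℝ := ∑ x, |p x - mass p * z x|

theorem gap_nonneg (p : X → ℝ) (z : stdSimplex ℝ X) : 0 ≤ gap p z :=
  Finset.sum_nonneg fun _ _ => abs_nonneg _

theorem gap_le {p : X → ℝ} (hp : ∀ x, 0 ≤ p x) (z : stdSimplex ℝ X) : gap p z ≤ 2 * mass p := by
  have h : ∀ x, |p x - mass p * z x| ≤ p x + mass p * z x := fun x => by
    have h1 := hp x
    have h2 := mul_nonneg (mass_nonneg hp) (stdSimplex.zero_le z x)
    rw [abs_le]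
    constructor <;> linarith
  refine (Finset.sum_le_sum fun x _ => h x).trans_eq ?_
  rw [Finset.sum_add_distrib, ← Finset.mul_sum, stdSimplex.sum_eq_one, mul_one, two_mul, mass]

theorem gap_mul {r : ℝ} (hr : 0 ≤ r) (p : X → ℝ) (z : stdSimplex ℝ X) :
    gap (fun x => r * p x) z = r * gap p z := by
  simp only [gap, mass_mul, Finset.mul_sum]
  refine Finset.sum_congr rfl fun x _ => ?_
  rw [mul_assoc, ← mul_sub, abs_mul, abs_of_nonneg hr]

variable [DecidableEq M]

theorem mass_push_sub_eq (P : X → U → stdSimplex ℝ X) (p : X → ℝ) (z : stdSimplex ℝ X)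
    (w : Rec X U M) :
    mass (push P p w) - mass p * symProb z w
      = ∑ x, if w.2.1 x = w.1 then p x - mass p * z x else 0 := by
  rw [mass_push, symProb, Finset.mul_sum, ← Finset.sum_sub_distrib]
  refine Finset.sum_congr rfl fun x _ => ?_
  split_ifs <;> ring

theorem abs_mass_push_sub_le (P : X → U → stdSimplex ℝ X) (p : X → ℝ) (z : stdSimplex ℝ X)
    (w : Rec X U M) :
    |mass (push P p w) - mass p * symProb z w|
      ≤ ∑ x, if w.2.1 x = w.1 then |p x - mass p * z x| else 0 := by
  rw [mass_push_sub_eq]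
  refine (Finset.abs_sum_le_sum_abs _ _).trans_eq (Finset.sum_congr rfl fun x _ => ?_)
  split_ifs
  exacts [rfl, abs_zero]

/-- On the cell of the symbol both measures move under the same control. Let `A` be the part of the
gap on the cell: matching the masses there adds at most another `A`, and the transition contracts
the resulting mean-zero difference by `1 - δ`. The renormalisation is the origin of the 2, and hence
of the threshold `1/2`. -/
theorem Overlap.gap_push_le (hP : Overlap P δ) (hδ : δ ≤ 1) (p : X → ℝ) (z : stdSimplex ℝ X)
    (w : Rec X U M) (hw : symProb z w ≠ 0) :
    gap (push P p w) (update P z w)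
      ≤ 2 * (1 - δ) * ∑ x, if w.2.1 x = w.1 then |p x - mass p * z x| else 0 := by
  set s := symProb z w with hs
  have hs0 : 0 < s := lt_of_le_of_ne
    (by rw [hs, symProb_eq_mass_push P]
        exact mass_nonneg (push_nonneg P (stdSimplex.zero_le z) w)) hw.symm
  set A := ∑ x, if w.2.1 x = w.1 then |p x - mass p * z x| else 0 with hA
  -- With this factor `p` and `t * z` have equal mass on the cell, so their difference `m` has total
  -- mass zero and the contraction applies.
  set t := mass (push P p w) / s with ht
  let m : X → ℝ := fun x => if w.2.1 x = w.1 then p x - t * z x else 0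
  have hts : t * s = mass (push P p w) := div_mul_cancel₀ _ hw
  have hm : ∑ x, m x = 0 := by
    have h1 : ∑ x, m x = mass (push P p w) - t * s := by
      rw [mass_push, hs, symProb, Finset.mul_sum, ← Finset.sum_sub_distrib]
      refine Finset.sum_congr rfl fun x _ => ?_
      simp only [m]
      split_ifs <;> ring
    rw [h1, hts, sub_self]
  have h2 : gap (push P p w) (update P z w)
      = ∑ j, |∑ x, P x (w.2.2 w.2.1 w.1) j * m x| := by
    refine Finset.sum_congr rfl fun j _ => ?_
    have h3 : mass (push P p w) * update P z w j = t * push P z w j := by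
      rw [← symProb_mul_update P z w j, ← mul_assoc, hts]
    rw [h3, push, push, Finset.mul_sum, ← Finset.sum_sub_distrib]
    congr 1
    refine Finset.sum_congr rfl fun x _ => ?_
    simp only [m]
    split_ifs <;> ring
  have h4 : ∑ x, |m x| ≤ A + |mass p - t| * s := by
    rw [hA, hs, symProb, Finset.mul_sum, ← Finset.sum_add_distrib]
    refine Finset.sum_le_sum fun x _ => ?_
    simp only [m]
    split_ifs
    · have h5 : p x - t * z x = (p x - mass p * z x) + (mass p - t) * z x := by ring
      rw [h5]
      refine (abs_add_le _ _).trans_eq ?_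
      rw [abs_mul _ (z x), abs_of_nonneg (stdSimplex.zero_le z x)]
    · simp
  have h6 : |mass p - t| * s ≤ A := by
    have h7 : |mass p - t| * s = |mass (push P p w) - mass p * s| := by
      rw [abs_sub_comm (mass _), ← hts, ← sub_mul, abs_mul, abs_of_pos hs0]
    rw [h7]
    exact abs_mass_push_sub_le P p z w
  rw [h2]
  refine (hP.sum_abs_le _ hm).trans ?_
  calc (1 - δ) * ∑ x, |m x| ≤ (1 - δ) * (A + A) :=
        mul_le_mul_of_nonneg_left (h4.trans (by linarith)) (by linarith)
    _ = 2 * (1 - δ) * A := by ring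

variable [Fintype M]

theorem sum_sum_ite_symbol (a : Act X U M) (f : X → ℝ) :
    ∑ q : M, ∑ x, (if a.1 x = q then f x else 0) = ∑ x, f x := by
  rw [Finset.sum_comm]
  exact Finset.sum_congr rfl fun x _ => by simp

theorem Overlap.sum_gap_push_le (hP : Overlap P δ) (hδ : δ ≤ 1) (p : X → ℝ) (z : stdSimplex ℝ X)
    (a : Act X U M) :
    ∑ q : M, (if symProb z (q, a) ≠ 0 then gap (push P p (q, a)) (update P z (q, a)) else 0)
      ≤ 2 * (1 - δ) * gap p z := by
  rw [gap, ← sum_sum_ite_symbol a, Finset.mul_sum]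
  refine Finset.sum_le_sum fun q _ => ?_
  split_ifs with h
  · exact hP.gap_push_le hδ p z (q, a) h
  · exact mul_nonneg (by linarith) (Finset.sum_nonneg fun x _ => by
      split_ifs
      exacts [abs_nonneg _, le_rfl])

/-- On cells that `z` does not charge, all the mass of `p` is discrepancy. This bounds the
probability of a symbol which the model considers impossible. -/
theorem sum_mass_push_le_gap (P : X → U → stdSimplex ℝ X) {p : X → ℝ} (z : stdSimplex ℝ X)
    (a : Act X U M) :
    ∑ q : M, (if symProb z (q, a) ≠ 0 then 0 else mass (push P p (q, a))) ≤ gap p z := by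
  rw [gap, ← sum_sum_ite_symbol a]
  refine Finset.sum_le_sum fun q _ => ?_
  split_ifs with h
  · exact Finset.sum_nonneg fun x _ => by
      split_ifs
      exacts [abs_nonneg _, le_rfl]
  · have h1 := (le_abs_self _).trans (abs_mass_push_sub_le P p z (q, a))
    rwa [not_not.1 h, mul_zero, sub_zero] at h1

end Contraction

/-! ### Elementary bounds for minima and discounted sums -/

section Analysis

theorem abs_iInf_sub_iInf_le {ι : Type*} [Finite ι] [Nonempty ι] {f g : ι → ℝ} {C : ℝ}
    (h : ∀ i, |f i - g i| ≤ C) : |(⨅ i, f i) - ⨅ i, g i| ≤ C := by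
  have hf := (Set.finite_range f).bddBelow
  have hg := (Set.finite_range g).bddBelow
  obtain ⟨i, hi⟩ := exists_eq_ciInf_of_finite (f := f)
  obtain ⟨j, hj⟩ := exists_eq_ciInf_of_finite (f := g)
  have h1 := ciInf_le hf j
  have h2 := ciInf_le hg i
  have h3 := abs_le.1 (h i)
  have h4 := abs_le.1 (h j)
  rw [abs_le]
  constructor <;> linarith

theorem abs_iInf_le {ι : Type*} [Finite ι] [Nonempty ι] {f : ι → ℝ} {C : ℝ}
    (h : ∀ i, |f i| ≤ C) : |⨅ i, f i| ≤ C := by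
  obtain ⟨i, hi⟩ := exists_eq_ciInf_of_finite (f := f)
  exact hi ▸ h i

variable {β : ℝ} {a : ℕ → ℝ} {C : ℝ}

theorem summable_discounted (hβ0 : 0 < β) (hβ1 : β < 1) (ha : ∀ k, |a k| ≤ C) :
    Summable fun k => β ^ k * a k := by
  refine Summable.of_norm_bounded ((summable_geometric_of_lt_one hβ0.le hβ1).mul_right C)
    fun k => ?_
  rw [Real.norm_eq_abs, abs_mul, abs_of_pos (pow_pos hβ0 k)]
  exact mul_le_mul_of_nonneg_left (ha k) (pow_pos hβ0 k).le

theorem abs_tsum_sub_sum_le (hβ0 : 0 < β) (hβ1 : β < 1) (ha : ∀ k, |a k| ≤ C) (n : ℕ) :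
    |∑' k, β ^ k * a k - ∑ k ∈ Finset.range n, β ^ k * a k| ≤ β ^ n * (C / (1 - β)) := by
  have hs := summable_discounted hβ0 hβ1 ha
  rw [← hs.sum_add_tsum_nat_add n, add_sub_cancel_left]
  have hg : HasSum (fun k => β ^ n * (C * β ^ k)) (β ^ n * (C * (1 - β)⁻¹)) :=
    ((hasSum_geometric_of_lt_one hβ0.le hβ1).mul_left C).mul_left _
  rw [← Real.norm_eq_abs]
  refine tsum_of_norm_bounded hg fun k => ?_
  rw [Real.norm_eq_abs, abs_mul, abs_of_pos (pow_pos hβ0 _), pow_add]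
  have h := mul_le_mul_of_nonneg_left (ha (k + n)) (mul_pos (pow_pos hβ0 k) (pow_pos hβ0 n)).le
  linarith

end Analysis

/-! ### The finite window model and its optimality equation -/

section FiniteModel

variable {X U M : Type*} [Fintype X] [DecidableEq X] [Fintype U] [DecidableEq U] [Fintype M]
  [DecidableEq M] [Nonempty U] [Nonempty M]
  (P : X → U → stdSimplex ℝ X) (c : X → U → ℝ) (β : ℝ) (ζ : stdSimplex ℝ X)

theorem sum_mdpKernel_mul {N : ℕ} (I : Window X U M N) (a : Act X U M)
    (φ : Window X U M N → ℝ) :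
    ∑ I', mdpKernel P ζ I a I' * φ I' = ∑ x, psi P ζ I x * φ (shift I (record (x, a))) :=
  sum_map_mul _ _ _

/-- The Bellman operator of the finite window model on functions of (window, action). -/
def bellman (N : ℕ) (q : Window X U M N → Act X U M → ℝ) : Window X U M N → Act X U M → ℝ :=
  fun I a => mdpStageCost P c ζ I a + β * ∑ I', mdpKernel P ζ I a I' * ⨅ a', q I' a'

variable {β}

/-- Minima and averages do not increase the sup distance, so the operator contracts by `β`. -/
theorem exists_bellman_fixedPoint (hβ0 : 0 < β) (hβ1 : β < 1) (N : ℕ) :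
    ∃ q : Window X U M N → Act X U M → ℝ, bellman P c β ζ N q = q := by
  have hc : ContractingWith ⟨β, hβ0.le⟩ (bellman (M := M) P c β ζ N) := by
    refine ⟨by exact_mod_cast hβ1, LipschitzWith.of_dist_le_mul fun q q' => ?_⟩
    have h0 : 0 ≤ β * dist q q' := mul_nonneg hβ0.le dist_nonneg
    refine (dist_pi_le_iff h0).2 fun I => (dist_pi_le_iff h0).2 fun a => ?_
    rw [Real.dist_eq, bellman, bellman, add_sub_add_left_eq_sub, ← mul_sub, abs_mul,
      abs_of_pos hβ0, ← Finset.sum_sub_distrib]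
    refine mul_le_mul_of_nonneg_left ?_ hβ0.le
    simp only [← mul_sub]
    refine abs_sum_stdSimplex_mul_le _ fun I' => abs_iInf_sub_iInf_le fun a' => ?_
    rw [← Real.dist_eq]
    exact (dist_le_pi_dist (q I') (q' I') a').trans (dist_le_pi_dist q q' I')
  exact ⟨_, hc.fixedPoint_isFixedPt⟩

variable {P c ζ}

theorem abs_mdpStageCost_le {C : ℝ} (hc : ∀ x u, |c x u| ≤ C) {N : ℕ} (I : Window X U M N)
    (a : Act X U M) : |mdpStageCost P c ζ I a| ≤ C :=
  abs_sum_stdSimplex_mul_le _ fun x => hc x _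

theorem abs_fixedPoint_le (hβ0 : 0 < β) (hβ1 : β < 1) {C : ℝ} (hc : ∀ x u, |c x u| ≤ C) {N : ℕ}
    {q : Window X U M N → Act X U M → ℝ} (hq : bellman P c β ζ N q = q)
    (I : Window X U M N) (a : Act X U M) : |q I a| ≤ C / (1 - β) := by
  have : Nonempty (Window X U M N) := ⟨I⟩
  obtain ⟨⟨I₀, a₀⟩, h0⟩ :=
    Finite.exists_max fun z : Window X U M N × Act X U M => |q z.1 z.2|
  set B := |q I₀ a₀| with hB
  have h1 : B ≤ C + β * B := by
    rw [hB]
    conv_lhs => rw [← hq]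
    refine (abs_add_le _ _).trans (add_le_add (abs_mdpStageCost_le hc _ _) ?_)
    rw [abs_mul, abs_of_pos hβ0]
    exact mul_le_mul_of_nonneg_left
      (abs_sum_stdSimplex_mul_le _ fun I' => abs_iInf_le fun a' => h0 (I', a')) hβ0.le
  refine (h0 (I, a)).trans ?_
  rw [le_div_iff₀ (by linarith)]
  linarith

variable [MeasurableSpace X] [MeasurableSingletonClass X] [MeasurableSpace U]
  [MeasurableSingletonClass U] [MeasurableSpace M] [MeasurableSingletonClass M]

instance {N : ℕ} (I : Window X U M N) (d : MdpPolicy X U M N) :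
    IsProbabilityMeasure (mdpLaw P ζ I d) :=
  inferInstanceAs (IsProbabilityMeasure (processLaw _ _))

theorem integrable_path {S : Type*} [Finite S] [MeasurableSpace S] [MeasurableSingletonClass S]
    (μ : Measure (ℕ → S)) [IsFiniteMeasure μ] (k : ℕ) (f : S → ℝ) :
    Integrable (fun ω => f (ω k)) μ := by
  obtain ⟨C, hC⟩ := (Set.finite_range fun s => ‖f s‖).bddAbove
  refine Integrable.of_bound
    ((Measurable.of_discrete (f := f)).comp (measurable_pi_apply k)).aestronglyMeasurable C
    (Eventually.of_forall fun ω => hC ⟨ω k, rfl⟩)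

theorem integral_mdpLaw_succ {N : ℕ} (I : Window X U M N) (d : MdpPolicy X U M N) (k : ℕ)
    (φ : Window X U M N → ℝ) :
    ∫ ω, φ (ω (k + 1)).1 ∂mdpLaw P ζ I d
      = ∫ ω, ∑ I', mdpKernel P ζ (ω k).1 (ω k).2 I' * φ I' ∂mdpLaw P ζ I d := by
  refine (integral_processLaw_succ _ _ k fun _ (s : Window X U M N × Act X U M) => φ s.1).trans ?_
  simp only [sum_map_mul]
  rfl

theorem integral_mdpLaw_stationary {N : ℕ} (I : Window X U M N)
    (γ : Window X U M N → Act X U M) (k : ℕ) (φ : Window X U M N × Act X U M → ℝ) :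
    ∫ ω, φ (ω k) ∂mdpLaw P ζ I (stationary γ)
      = ∫ ω, φ ((ω k).1, γ (ω k).1) ∂mdpLaw P ζ I (stationary γ) := by
  cases k with
  | zero =>
    refine (integral_processLaw_zero _ _ φ).trans
      (Eq.trans ?_ (integral_processLaw_zero _ _ fun (s : Window X U M N × Act X U M) => φ (s.1, γ s.1)).symm)
    rw [sum_vertex_mul, sum_vertex_mul]
    rfl
  | succ k =>
    refine (integral_processLaw_succ _ _ k fun _ (s : Window X U M N × Act X U M) => φ s).trans
      (Eq.trans ?_ (integral_processLaw_succ _ _ k fun _ (s : Window X U M N × Act X U M) => φ (s.1, γ s.1)).symm)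
    simp only [sum_map_mul]
    simp [stationary]

variable {N : ℕ} {q : Window X U M N → Act X U M → ℝ}

/-- The optimality equation in expectation: it makes the discounted cost telescope, both for the
lower bound `le_mdpCost` and for the greedy policy. -/
theorem integral_stageCost_mdpLaw (hq : bellman P c β ζ N q = q) (I : Window X U M N)
    (d : MdpPolicy X U M N) (k : ℕ) :
    ∫ ω, mdpStageCost P c ζ (ω k).1 (ω k).2 ∂mdpLaw P ζ I d
      = ∫ ω, q (ω k).1 (ω k).2 ∂mdpLaw P ζ I d
        - β * ∫ ω, (⨅ a, q (ω (k + 1)).1 a) ∂mdpLaw P ζ I d := by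
  rw [integral_mdpLaw_succ I d k fun I' => ⨅ a, q I' a, ← integral_const_mul, ← integral_sub]
  · refine integral_congr_ae (Eventually.of_forall fun ω => ?_)
    have h := congrFun (congrFun hq (ω k).1) (ω k).2
    simp only [bellman] at h
    simp only
    linarith
  · exact integrable_path _ k fun (s : Window X U M N × Act X U M) => q s.1 s.2
  · exact integrable_path _ k fun (s : Window X U M N × Act X U M) => β * ∑ I', mdpKernel P ζ s.1 s.2 I' * ⨅ a, q I' a

theorem integral_mdpLaw_zero (I : Window X U M N) (d : MdpPolicy X U M N)
    (φ : Window X U M N → ℝ) : ∫ ω, φ (ω 0).1 ∂mdpLaw P ζ I d = φ I := by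
  refine (integral_processLaw_zero _ _ fun (s : Window X U M N × Act X U M) => φ s.1).trans ?_
  rw [sum_vertex_mul]

theorem abs_integral_path_le {S : Type*} [MeasurableSpace S] (μ : Measure (ℕ → S))
    [IsProbabilityMeasure μ] (k : ℕ) {f : S → ℝ} {C : ℝ} (hf : ∀ s, |f s| ≤ C) :
    |∫ ω, f (ω k) ∂μ| ≤ C := by
  have h := norm_integral_le_of_norm_le_const (μ := μ) (f := fun ω => f (ω k)) (C := C)
    (Eventually.of_forall fun ω => hf (ω k))
  simpa using h

theorem tendsto_discounted_value (hβ0 : 0 < β) (hβ1 : β < 1) {v : ℕ → ℝ} {C : ℝ}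
    (hv : ∀ k, |v k| ≤ C) (a : ℝ) : Tendsto (fun n => a - β ^ n * v n) atTop (𝓝 a) := by
  have h : Tendsto (fun n => β ^ n * v n) atTop (𝓝 0) := by
    refine squeeze_zero_norm (a := fun n => β ^ n * C) (fun n => ?_) ?_
    · rw [Real.norm_eq_abs, abs_mul, abs_of_pos (pow_pos hβ0 n)]
      exact mul_le_mul_of_nonneg_left (hv n) (pow_pos hβ0 n).le
    · simpa using (tendsto_pow_atTop_nhds_zero_of_lt_one hβ0.le hβ1).mul_const C
  simpa using tendsto_const_nhds.sub h

theorem exists_abs_le_cost (c : X → U → ℝ) : ∃ C, 0 ≤ C ∧ ∀ x u, |c x u| ≤ C := by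
  obtain ⟨C, hC⟩ := (Set.finite_range fun z : X × U => |c z.1 z.2|).bddAbove
  exact ⟨max C 0, le_max_right _ _, fun x u => (hC ⟨(x, u), rfl⟩).trans (le_max_left _ _)⟩

theorem tendsto_sum_mdpCost (hβ0 : 0 < β) (hβ1 : β < 1) (I : Window X U M N)
    (d : MdpPolicy X U M N) :
    Tendsto (fun n => ∑ k ∈ Finset.range n,
      β ^ k * ∫ ω, mdpStageCost P c ζ (ω k).1 (ω k).2 ∂mdpLaw P ζ I d) atTop
      (𝓝 (mdpCost P c β ζ I d)) := by
  obtain ⟨C, -, hC⟩ := exists_abs_le_cost c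
  refine (summable_discounted hβ0 hβ1 (C := C) fun k => ?_).hasSum.tendsto_sum_nat
  exact abs_integral_path_le _ k (f := fun (s : Window X U M N × Act X U M) => mdpStageCost P c ζ s.1 s.2)
    fun s => abs_mdpStageCost_le hC _ _

/-- Replacing `q` at the chosen action by its minimum only decreases it, so the partial sums
dominate the initial value minus `β ^ n` times a bounded term. For greedy actions nothing is lost,
which gives `mdpCost_greedy`. -/
theorem le_mdpCost (hβ0 : 0 < β) (hβ1 : β < 1) (hq : bellman P c β ζ N q = q)
    (I : Window X U M N) (d : MdpPolicy X U M N) : ⨅ a, q I a ≤ mdpCost P c β ζ I d := by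
  obtain ⟨C, -, hC⟩ := exists_abs_le_cost c
  have hv : ∀ k, |∫ ω, (⨅ a, q (ω k).1 a) ∂mdpLaw P ζ I d| ≤ C / (1 - β) := fun k =>
    abs_integral_path_le _ k (f := fun (s : Window X U M N × Act X U M) => ⨅ a, q s.1 a) fun s =>
      abs_iInf_le fun a => abs_fixedPoint_le hβ0 hβ1 hC hq _ a
  refine le_of_tendsto_of_tendsto' (tendsto_discounted_value hβ0 hβ1 hv _)
    (tendsto_sum_mdpCost hβ0 hβ1 I d) fun n => ?_
  induction n with
  | zero => simp [integral_mdpLaw_zero I d fun I => ⨅ a, q I a]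
  | succ n ih =>
    rw [Finset.sum_range_succ, integral_stageCost_mdpLaw hq]
    have h1 : ∫ ω, (⨅ a, q (ω n).1 a) ∂mdpLaw P ζ I d ≤ ∫ ω, q (ω n).1 (ω n).2 ∂mdpLaw P ζ I d :=
      integral_mono (integrable_path _ n fun (s : Window X U M N × Act X U M) => ⨅ a, q s.1 a)
        (integrable_path _ n fun (s : Window X U M N × Act X U M) => q s.1 s.2)
        fun ω => ciInf_le (Set.finite_range _).bddBelow _
    have h2 := mul_le_mul_of_nonneg_left h1 (pow_pos hβ0 n).le
    rw [pow_succ]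
    linarith

theorem mdpCost_greedy (hβ0 : 0 < β) (hβ1 : β < 1) (hq : bellman P c β ζ N q = q)
    {γ : Window X U M N → Act X U M} (hγ : ∀ I a, q I (γ I) ≤ q I a) (I : Window X U M N) :
    mdpCost P c β ζ I (stationary γ) = ⨅ a, q I a := by
  obtain ⟨C, -, hC⟩ := exists_abs_le_cost c
  have hv : ∀ k, |∫ ω, (⨅ a, q (ω k).1 a) ∂mdpLaw P ζ I (stationary γ)| ≤ C / (1 - β) := fun k =>
    abs_integral_path_le _ k (f := fun (s : Window X U M N × Act X U M) => ⨅ a, q s.1 a) fun s =>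
      abs_iInf_le fun a => abs_fixedPoint_le hβ0 hβ1 hC hq _ a
  refine tendsto_nhds_unique (tendsto_sum_mdpCost hβ0 hβ1 I _)
    (Tendsto.congr (fun n => ?_) (tendsto_discounted_value hβ0 hβ1 hv (⨅ a, q I a)))
  have hmin : ∀ I, q I (γ I) = ⨅ a, q I a := fun I =>
    le_antisymm (le_ciInf (hγ I)) (ciInf_le (Set.finite_range _).bddBelow _)
  induction n with
  | zero => simp [integral_mdpLaw_zero I (stationary γ) fun I => ⨅ a, q I a]
  | succ n ih =>
    rw [Finset.sum_range_succ, integral_stageCost_mdpLaw hq,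
      integral_mdpLaw_stationary I γ n fun (s : Window X U M N × Act X U M) => q s.1 s.2, ← ih]
    simp only [hmin]
    ring

theorem mdpOptCost_eq (hβ0 : 0 < β) (hβ1 : β < 1) (hq : bellman P c β ζ N q = q)
    (I : Window X U M N) : mdpOptCost P c β ζ I = ⨅ a, q I a := by
  choose γ hγ using fun I => Finite.exists_min (q I)
  have h := mdpCost_greedy hβ0 hβ1 hq hγ I
  have : Nonempty (MdpPolicy X U M N) := ⟨stationary γ⟩
  refine le_antisymm (h ▸ ciInf_le ?_ (stationary γ)) (le_ciInf fun d => le_mdpCost hβ0 hβ1 hq I d)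
  exact ⟨⨅ a, q I a, by rintro _ ⟨d, rfl⟩; exact le_mdpCost hβ0 hβ1 hq I d⟩

end FiniteModel

/-! ### A strong law under geometrically decaying covariances -/

section StrongLaw

variable {Ω : Type*} [MeasurableSpace Ω] {μ : Measure Ω}

/-- The series of the `f n` has finite expectation, hence converges almost surely, and its terms
tend to zero. -/
theorem ae_tendsto_zero_of_summable_integral {f : ℕ → Ω → ℝ} (hf : ∀ n, Integrable (f n) μ)
    (hf0 : ∀ n ω, 0 ≤ f n ω) {b : ℕ → ℝ} (hb : Summable b) (hfb : ∀ n, ∫ ω, f n ω ∂μ ≤ b n) :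
    ∀ᵐ ω ∂μ, Tendsto (fun n => f n ω) atTop (𝓝 0) := by
  have hm : ∀ n, AEMeasurable (fun ω => ENNReal.ofReal (f n ω)) μ := fun n =>
    (hf n).aemeasurable.ennreal_ofReal
  have h1 : ∫⁻ ω, ∑' n, ENNReal.ofReal (f n ω) ∂μ ≠ ⊤ := by
    rw [lintegral_tsum hm]
    refine ne_top_of_le_ne_top hb.tsum_ofReal_ne_top (ENNReal.tsum_le_tsum fun n => ?_)
    rw [← ofReal_integral_eq_lintegral_ofReal (hf n) (Eventually.of_forall (hf0 n))]
    exact ENNReal.ofReal_le_ofReal (hfb n)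
  filter_upwards [ae_lt_top' (AEMeasurable.tsum hm) h1] with ω hω
  have h2 := ENNReal.tendsto_atTop_zero_of_tsum_ne_top hω.ne
  have h3 := (ENNReal.tendsto_toReal ENNReal.zero_ne_top).comp h2
  refine h3.congr fun n => ?_
  exact ENNReal.toReal_ofReal (hf0 n ω)

variable [IsProbabilityMeasure μ] {Y : ℕ → Ω → ℝ} {C D r : ℝ}

/-- Adding one term raises the second moment by twice a cross term, at most `D / (1 - r)` by the
geometric series, and a square, at most `D ≤ D / (1 - r)`; hence the 3. -/
theorem integral_sq_sum_le (hY : ∀ k, Measurable (Y k)) (hC : ∀ k ω, |Y k ω| ≤ C)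
    (hr0 : 0 ≤ r) (hr1 : r < 1) (hcov : ∀ j k, |∫ ω, Y j ω * Y (j + k) ω ∂μ| ≤ D * r ^ k) (n : ℕ) :
    ∫ ω, (∑ k ∈ Finset.range n, Y k ω) ^ 2 ∂μ ≤ n * (3 * (D / (1 - r))) := by
  have hD : 0 ≤ D := by simpa using (abs_nonneg _).trans (hcov 0 0)
  have h1r : 0 < 1 - r := by linarith
  have hi : ∀ j k, Integrable (fun ω => Y j ω * Y k ω) μ := fun j k => by
    refine Integrable.of_bound ((hY j).mul (hY k)).aestronglyMeasurable (C * C)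
      (Eventually.of_forall fun ω => ?_)
    rw [norm_mul]
    exact mul_le_mul (hC j ω) (hC k ω) (abs_nonneg _) ((abs_nonneg _).trans (hC j ω))
  have hS : ∀ n k, Integrable (fun ω => (∑ j ∈ Finset.range n, Y j ω) * Y k ω) μ := fun n k => by
    simp only [Finset.sum_mul]
    exact integrable_finsetSum _ fun j _ => hi j k
  have hS2 : ∀ n, Integrable (fun ω => (∑ j ∈ Finset.range n, Y j ω) ^ 2) μ := fun n => by
    have h : (fun ω => (∑ j ∈ Finset.range n, Y j ω) ^ 2)
        = fun ω => ∑ k ∈ Finset.range n, (∑ j ∈ Finset.range n, Y j ω) * Y k ω :=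
      funext fun ω => by rw [sq, Finset.mul_sum]
    rw [h]
    exact integrable_finsetSum _ fun j _ => hS n j
  have hcross : ∀ n, ∫ ω, (∑ j ∈ Finset.range n, Y j ω) * Y n ω ∂μ ≤ D / (1 - r) := fun n => by
    simp only [Finset.sum_mul]
    rw [integral_finsetSum _ fun j _ => hi j n]
    have h : ∀ j ∈ Finset.range n, ∫ ω, Y j ω * Y n ω ∂μ ≤ D * r ^ (n - j) := fun j hj => by
      have h := hcov j (n - j)
      rw [Nat.add_sub_cancel' (Finset.mem_range.1 hj).le] at h
      exact (le_abs_self _).trans h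
    refine (Finset.sum_le_sum h).trans ?_
    rw [← Finset.mul_sum, div_eq_mul_inv]
    refine mul_le_mul_of_nonneg_left ?_ hD
    have h2 : ∑ j ∈ Finset.range n, r ^ (n - j) ≤ ∑ j ∈ Finset.range (n + 1), r ^ j := by
      rw [← Finset.sum_range_reflect, Finset.sum_range_succ]
      refine (Finset.sum_le_sum fun j hj => ?_).trans
        (le_add_of_nonneg_right (pow_nonneg hr0 _))
      have := Finset.mem_range.1 hj
      exact (pow_le_pow_of_le_one hr0 hr1.le (by omega))
    refine h2.trans ?_
    rw [← tsum_geometric_of_lt_one hr0 hr1]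
    exact (summable_geometric_of_lt_one hr0 hr1).sum_le_tsum _ fun j _ => pow_nonneg hr0 j
  have hDr : D ≤ D / (1 - r) := by
    rw [le_div_iff₀ h1r]
    nlinarith
  induction n with
  | zero => simp
  | succ n ih =>
    have h : ∀ ω, (∑ k ∈ Finset.range (n + 1), Y k ω) ^ 2
        = (∑ k ∈ Finset.range n, Y k ω) ^ 2
          + (2 * ((∑ k ∈ Finset.range n, Y k ω) * Y n ω) + Y n ω * Y n ω) := fun ω => by
      rw [Finset.sum_range_succ]; ring
    simp only [h]
    have hadd : Integrable (fun ω => 2 * ((∑ k ∈ Finset.range n, Y k ω) * Y n ω)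
        + Y n ω * Y n ω) μ := ((hS n n).const_mul 2).add (hi n n)
    rw [integral_add (hS2 n) hadd,
      integral_add ((hS n n).const_mul 2) (hi n n), integral_const_mul]
    have h3 : ∫ ω, Y n ω * Y n ω ∂μ ≤ D := by
      simpa using (le_abs_self _).trans (hcov n 0)
    have h4 := hcross n
    push_cast
    linarith

theorem eventually_succ_sq_le {a : ℝ} (ha : 1 < a) :
    ∀ᶠ n : ℕ in atTop, (((n + 1) ^ 2 : ℕ) : ℝ) ≤ a * ((n ^ 2 : ℕ) : ℝ) := by
  obtain ⟨m, hm⟩ := exists_nat_ge (3 / (a - 1))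
  filter_upwards [eventually_ge_atTop (max m 1)] with n hn
  have h1 : (1 : ℝ) ≤ n := by exact_mod_cast (le_max_right m 1).trans hn
  have h2 : 3 / (a - 1) ≤ n := hm.trans (by exact_mod_cast (le_max_left m 1).trans hn)
  rw [div_le_iff₀ (by linarith)] at h2
  push_cast
  nlinarith

/-- Along the squares the averages have second moments of order `1 / n ^ 2`, which are summable.
Adding `C * n` makes the partial sums monotone, and consecutive squares have ratio tending to 1, so
convergence along squares gives full convergence. -/
theorem ae_tendsto_average_zero (hY : ∀ k, Measurable (Y k)) (hC : ∀ k ω, |Y k ω| ≤ C)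
    (hr0 : 0 ≤ r) (hr1 : r < 1) (hcov : ∀ j k, |∫ ω, Y j ω * Y (j + k) ω ∂μ| ≤ D * r ^ k) :
    ∀ᵐ ω ∂μ, Tendsto (fun n : ℕ => (∑ k ∈ Finset.range n, Y k ω) / n) atTop (𝓝 0) := by
  set E := 3 * (D / (1 - r))
  have hSm : ∀ n, Measurable fun ω => ∑ k ∈ Finset.range n, Y k ω := fun n =>
    Finset.measurable_fun_sum _ fun k _ => hY k
  have hSb : ∀ n ω, |∑ k ∈ Finset.range n, Y k ω| ≤ n * C := fun n ω => by
    refine (Finset.abs_sum_le_sum_abs _ _).trans ((Finset.sum_le_sum fun k _ => hC k ω).trans_eq ?_)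
    simp
  have hsq : ∀ᵐ ω ∂μ, Tendsto
      (fun n : ℕ => ((∑ k ∈ Finset.range (n ^ 2), Y k ω) / ((n ^ 2 : ℕ) : ℝ)) ^ 2) atTop (𝓝 0) := by
    have hsum : Summable fun n : ℕ => E * (1 / (n : ℝ) ^ 2) :=
      (Real.summable_one_div_nat_pow.2 one_lt_two).mul_left E
    refine ae_tendsto_zero_of_summable_integral (fun n => ?_) (fun n ω => sq_nonneg _) hsum
      fun n => ?_
    · refine Integrable.of_bound (((hSm _).div_const _).pow_const 2).aestronglyMeasurable (C ^ 2)
        (Eventually.of_forall fun ω => ?_)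
      rw [Real.norm_eq_abs, abs_of_nonneg (sq_nonneg _), ← sq_abs]
      refine pow_le_pow_left₀ (abs_nonneg _) ?_ 2
      rw [abs_div, Nat.abs_cast]
      have hC0 : 0 ≤ C := (abs_nonneg _).trans (hC 0 ω)
      refine div_le_of_le_mul₀ (Nat.cast_nonneg _) hC0 ?_
      rw [mul_comm]
      exact hSb _ ω
    · simp only [div_pow]
      rw [integral_div]
      have h := integral_sq_sum_le hY hC hr0 hr1 hcov (n ^ 2)
      rcases Nat.eq_zero_or_pos n with rfl | hn
      · simp
      · have hn' : (0 : ℝ) < n := Nat.cast_pos.2 hn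
        refine (div_le_div_of_nonneg_right h (by positivity)).trans_eq ?_
        push_cast
        field_simp
        exact mul_div_assoc _ _ _
  filter_upwards [hsq] with ω hω
  have h1 : Tendsto (fun n : ℕ => (∑ k ∈ Finset.range (n ^ 2), Y k ω) / ((n ^ 2 : ℕ) : ℝ))
      atTop (𝓝 0) := by
    rw [tendsto_zero_iff_abs_tendsto_zero]
    have h2 := (Real.continuous_sqrt.tendsto 0).comp hω
    rw [Real.sqrt_zero] at h2
    exact h2.congr fun n => Real.sqrt_sq_eq_abs _
  have hC0 : 0 ≤ C := (abs_nonneg _).trans (hC 0 ω)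
  have hmono : Monotone fun n : ℕ => (∑ k ∈ Finset.range n, Y k ω) + C * n := by
    refine monotone_nat_of_le_succ fun n => ?_
    rw [Finset.sum_range_succ]
    have := (abs_le.1 (hC n ω)).1
    push_cast
    linarith
  have hshift : ∀ u : ℕ → ℕ, Tendsto u atTop atTop →
      Tendsto (fun n => (∑ k ∈ Finset.range (u n), Y k ω) / (u n : ℝ)) atTop (𝓝 0) →
      Tendsto (fun n => ((∑ k ∈ Finset.range (u n), Y k ω) + C * (u n : ℝ)) / (u n : ℝ))
        atTop (𝓝 C) := fun u hu h => by
    have h3 := h.add_const C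
    rw [zero_add] at h3
    refine h3.congr' ?_
    filter_upwards [hu.eventually_gt_atTop 0] with n hn
    have hn' : (u n : ℝ) ≠ 0 := (Nat.cast_pos.2 hn).ne'
    field_simp
  have hpow : Tendsto (fun n : ℕ => n ^ 2) atTop atTop := tendsto_pow_atTop two_ne_zero
  have h4 := tendsto_div_of_monotone_of_exists_subseq_tendsto_div _ C hmono fun a ha =>
    ⟨fun n => n ^ 2, eventually_succ_sq_le ha, hpow, hshift _ hpow h1⟩
  have h5 := h4.sub_const C
  rw [sub_self] at h5
  refine h5.congr' ?_
  filter_upwards [eventually_gt_atTop 0] with n hn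
  have hn' : (n : ℝ) ≠ 0 := (Nat.cast_pos.2 hn).ne'
  field_simp
  ring

end StrongLaw

/-! ### Geometric mixing and ergodic averages under uniform exploration -/

section Ergodic

/-- The function `Y` of the path depends on the coordinates up to time `t` only. -/
def DependsUpTo {S : Type*} (t : ℕ) (Y : (ℕ → S) → ℝ) : Prop :=
  ∀ ω ω' : ℕ → S, (∀ i ≤ t, ω i = ω' i) → Y ω = Y ω'

/-- The path from time `t` on. -/
def shiftPath {S : Type*} (t : ℕ) (ω : ℕ → S) : ℕ → S := fun i => ω (t + i)

theorem DependsUpTo.mono {S : Type*} {t t' : ℕ} (h : t ≤ t') {Y : (ℕ → S) → ℝ}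
    (hY : DependsUpTo t Y) : DependsUpTo t' Y :=
  fun ω ω' H => hY ω ω' fun i hi => H i (hi.trans h)

theorem DependsUpTo.comp_shiftPath {S : Type*} {m : ℕ} {F : (ℕ → S) → ℝ} (hF : DependsUpTo m F)
    (t : ℕ) : DependsUpTo (t + m) fun ω => F (shiftPath t ω) :=
  fun _ _ H => hF _ _ fun i hi => H (t + i) (by omega)

/-- Continue the history `h` by its last state. -/
def extendPath {S : Type*} {t : ℕ} (h : Fin (t + 1) → S) : ℕ → S :=
  fun i => h ⟨min i t, by omega⟩

theorem DependsUpTo.eq_extendPath {S : Type*} {t : ℕ} {Y : (ℕ → S) → ℝ} (hY : DependsUpTo t Y)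
    (ω : ℕ → S) : Y ω = Y (extendPath (upTo t ω)) :=
  hY _ _ fun i hi => by simp [extendPath, upTo, min_eq_left hi]

theorem DependsUpTo.measurable {S : Type*} [Finite S] [MeasurableSpace S]
    [MeasurableSingletonClass S] {t : ℕ} {Y : (ℕ → S) → ℝ} (hY : DependsUpTo t Y) :
    Measurable Y := by
  have h : Y = (fun h => Y (extendPath h)) ∘ upTo t := funext hY.eq_extendPath
  rw [h]
  exact Measurable.of_discrete.comp (measurable_upTo t)

theorem DependsUpTo.exists_bound {S : Type*} [Finite S] {t : ℕ} {Y : (ℕ → S) → ℝ}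
    (hY : DependsUpTo t Y) : ∃ C, ∀ ω, |Y ω| ≤ C := by
  obtain ⟨C, hC⟩ :=
    (Set.finite_range fun h : Fin (t + 1) → S => |Y (extendPath h)|).bddAbove
  exact ⟨C, fun ω => hY.eq_extendPath ω ▸ hC ⟨upTo t ω, rfl⟩⟩

variable {X U M : Type*} [Fintype X] [DecidableEq X] [Fintype U] [DecidableEq U] [Fintype M]
  [DecidableEq M] [Nonempty U] [Nonempty M]

/-- The transition probabilities of (state, action) under uniform exploration. -/
def exploreStep (P : X → U → stdSimplex ℝ X) (s : X × Act X U M) : stdSimplex ℝ (X × Act X U M) :=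
  prodVec (P s.1 (control s.2 s.1)) stdSimplex.barycenter

/-- The transition operator of (state, action) under uniform exploration. -/
def exploreOp (P : X → U → stdSimplex ℝ X) (f : X × Act X U M → ℝ) (s : X × Act X U M) : ℝ :=
  ∑ s', exploreStep P s s' * f s'

/-- The average over the actions. -/
def actionMean (f : X × Act X U M → ℝ) (x : X) : ℝ :=
  ∑ a, (stdSimplex.barycenter : stdSimplex ℝ (Act X U M)) a * f (x, a)

variable (M) in
/-- The transition operator of the source under uniform exploration. -/
def sourceOp (P : X → U → stdSimplex ℝ X) (G : X → ℝ) (x : X) : ℝ :=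
  ∑ a, (stdSimplex.barycenter : stdSimplex ℝ (Act X U M)) a * ∑ x', P x (control a x) x' * G x'

variable {P : X → U → stdSimplex ℝ X} {δ : ℝ}

theorem exploreOp_eq (f : X × Act X U M → ℝ) (s : X × Act X U M) :
    exploreOp P f s = ∑ x', P s.1 (control s.2 s.1) x' * actionMean f x' :=
  sum_prodVec_mul _ _ _

/-- The next action is uniform and independent of everything before, so averaging it out reduces the
state-action chain to the source chain. -/
theorem actionMean_iterate (f : X × Act X U M → ℝ) (m : ℕ) :
    actionMean ((exploreOp P)^[m] f) = (sourceOp M P)^[m] (actionMean f) := by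
  induction m with
  | zero => rfl
  | succ m ih =>
    rw [Function.iterate_succ_apply', Function.iterate_succ_apply', ← ih]
    funext x
    exact Finset.sum_congr rfl fun a _ => congrArg _ (exploreOp_eq _ _)

theorem IsInvariant.sum_sourceOp {ζ : stdSimplex ℝ X} (hζ : IsInvariant M P ζ) (G : X → ℝ) :
    ∑ x, ζ x * sourceOp M P G x = ∑ x, ζ x * G x := by
  have h : ∀ x', ζ x' * G x' = ∑ x, ζ x * ∑ a : Act X U M,
      (Fintype.card (Act X U M) : ℝ)⁻¹ * (P x (control a x) x' * G x') := fun x' => by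
    rw [hζ x', Finset.sum_mul]
    refine Finset.sum_congr rfl fun x _ => ?_
    simp only [Finset.mul_sum, Finset.sum_mul]
    exact Finset.sum_congr rfl fun a _ => by ring
  rw [Finset.sum_congr rfl fun x' _ => h x', Finset.sum_comm]
  refine Finset.sum_congr rfl fun x _ => ?_
  rw [← Finset.mul_sum, Finset.sum_comm, sourceOp]
  congr 1
  refine Finset.sum_congr rfl fun a _ => ?_
  rw [← Finset.mul_sum, barycenter_coe]

theorem sum_sub_sum_le_of_osc (p r : stdSimplex ℝ X) {G : X → ℝ} {d : ℝ}
    (hG : ∀ x y, G x - G y ≤ d) : ∑ x, p x * G x - ∑ x, r x * G x ≤ d := by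
  have h : ∑ x, p x * G x - ∑ x, r x * G x = ∑ x, p x * ∑ y, r y * (G x - G y) := by
    simp only [mul_sub, Finset.sum_sub_distrib, ← Finset.sum_mul, stdSimplex.sum_eq_one, one_mul]
  rw [h]
  have h2 : ∀ x, ∑ y, r y * (G x - G y) ≤ d := fun x => by
    calc _ ≤ ∑ y, r y * d :=
          Finset.sum_le_sum fun y _ => mul_le_mul_of_nonneg_left (hG x y) (stdSimplex.zero_le r y)
      _ = d := by rw [← Finset.sum_mul, stdSimplex.sum_eq_one, one_mul]
  calc _ ≤ ∑ x, p x * d :=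
        Finset.sum_le_sum fun x _ => mul_le_mul_of_nonneg_left (h2 x) (stdSimplex.zero_le p x)
    _ = d := by rw [← Finset.sum_mul, stdSimplex.sum_eq_one, one_mul]

/-- A contraction factor of the source under uniform exploration. -/
def exploreRate (X U M : Type*) [Fintype X] [DecidableEq X] [Fintype U] [Fintype M]
    [DecidableEq M] (δ : ℝ) : ℝ := 1 - δ / (2 * Fintype.card (Act X U M))

/-- The 2 in the rate is slack: it keeps the rate positive even for `δ = 1` and a single action, so
that one may divide by its powers. -/
theorem exploreRate_mem (hδ0 : 0 < δ) (hδ1 : δ ≤ 1) :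
    0 < exploreRate X U M δ ∧ exploreRate X U M δ < 1 := by
  have hc : (1 : ℝ) ≤ Fintype.card (Act X U M) := by exact_mod_cast Fintype.card_pos
  have h1 : 0 < δ / (2 * Fintype.card (Act X U M)) := by positivity
  have h2 : δ / (2 * Fintype.card (Act X U M)) < 1 := by
    rw [div_lt_one (by positivity)]
    linarith
  rw [exploreRate]
  constructor <;> linarith

/-- Constant quantizers make the control independent of the state, so they contract. -/
theorem Overlap.sourceOp_sub_le (hP : Overlap P δ) (hδ0 : 0 < δ) {G : X → ℝ} {d : ℝ}
    (hG : ∀ x y, G x - G y ≤ d) (x y : X) :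
    sourceOp M P G x - sourceOp M P G y ≤ exploreRate X U M δ * d := by
  obtain ⟨q₀⟩ := ‹Nonempty M›
  obtain ⟨u₀⟩ := ‹Nonempty U›
  have hd : 0 ≤ d := by simpa using hG x x
  let a₀ : Act X U M := (fun _ => q₀, fun _ _ => u₀)
  let D : Act X U M → ℝ := fun a =>
    ∑ x', P x (control a x) x' * G x' - ∑ x', P y (control a y) x' * G x'
  -- Only the constant action `a₀` needs to contract; under any other action the two averages still
  -- differ by at most the oscillation.
  have hD : ∀ a, D a ≤ d - if a = a₀ then δ * d else 0 := fun a => by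
    split_ifs with h
    · subst h
      have := hP.sum_sub_sum_le hG u₀ x y
      simp only [D, control, a₀]
      linarith
    · rw [sub_zero]
      exact sum_sub_sum_le_of_osc _ _ hG
  have h1 : sourceOp M P G x - sourceOp M P G y
      = (Fintype.card (Act X U M) : ℝ)⁻¹ * ∑ a, D a := by
    simp only [sourceOp, barycenter_coe, D, ← Finset.mul_sum, ← mul_sub, Finset.sum_sub_distrib]
  have hc : (1 : ℝ) ≤ Fintype.card (Act X U M) := by exact_mod_cast Fintype.card_pos
  have h2 : ∑ a, D a ≤ Fintype.card (Act X U M) * d - δ * d := by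
    refine (Finset.sum_le_sum fun a _ => hD a).trans_eq ?_
    rw [Finset.sum_sub_distrib]
    simp only [Finset.sum_const, Finset.card_univ, nsmul_eq_mul, Finset.sum_ite_eq',
      Finset.mem_univ, if_true]
  rw [h1]
  refine (mul_le_mul_of_nonneg_left h2 (by positivity)).trans ?_
  rw [exploreRate, sub_mul, one_mul, mul_sub, inv_mul_cancel_left₀ (by positivity)]
  have h3 : δ / (2 * Fintype.card (Act X U M)) * d
      = (Fintype.card (Act X U M) : ℝ)⁻¹ * (δ * d) / 2 := by
    field_simp
  have h4 : 0 ≤ (Fintype.card (Act X U M) : ℝ)⁻¹ * (δ * d) := by positivity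
  linarith

/-- Oscillations decay geometrically, invariance keeps the `ζ`-average fixed along the iteration,
and any two averages of a function differ by at most its oscillation. The first application only
averages out the initial action, hence `m + 1` against `m`. -/
theorem Overlap.abs_exploreOp_iterate_sub_le (hP : Overlap P δ) (hδ0 : 0 < δ)
    {ζ : stdSimplex ℝ X} (hζ : IsInvariant M P ζ) {f : X × Act X U M → ℝ} {C : ℝ}
    (hf : ∀ s, |f s| ≤ C) (m : ℕ) (s : X × Act X U M) :
    |(exploreOp P)^[m + 1] f s - ∑ x, ζ x * actionMean f x| ≤ exploreRate X U M δ ^ m * (2 * C) := by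
  have hosc : ∀ m x y, (sourceOp M P)^[m] (actionMean f) x - (sourceOp M P)^[m] (actionMean f) y
      ≤ exploreRate X U M δ ^ m * (2 * C) := fun m => by
    induction m with
    | zero =>
      intro x y
      have h := fun x => abs_le.1 (abs_sum_stdSimplex_mul_le
        (stdSimplex.barycenter : stdSimplex ℝ (Act X U M)) fun a => hf (x, a))
      have h1 := (h x).2
      have h2 := (h y).1
      simp only [Function.iterate_zero, id, pow_zero, one_mul, actionMean]
      linarith
    | succ m ih =>
      intro x y
      rw [Function.iterate_succ_apply', pow_succ', mul_assoc]
      exact hP.sourceOp_sub_le hδ0 ih x y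
  have hinv : ∑ x, ζ x * actionMean f x = ∑ x, ζ x * (sourceOp M P)^[m] (actionMean f) x := by
    clear hosc
    induction m with
    | zero => rfl
    | succ m ih => rw [Function.iterate_succ_apply', hζ.sum_sourceOp, ← ih]
  rw [Function.iterate_succ_apply', exploreOp_eq, actionMean_iterate, hinv, abs_sub_le_iff]
  exact ⟨sum_sub_sum_le_of_osc _ _ (hosc m), sum_sub_sum_le_of_osc _ _ (hosc m)⟩

variable [MeasurableSpace X] [MeasurableSingletonClass X] [MeasurableSpace U]
  [MeasurableSingletonClass U] [MeasurableSpace M] [MeasurableSingletonClass M]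

theorem integral_explore_step (ν : stdSimplex ℝ X) (t : ℕ)
    (G : (ℕ → X × Act X U M) → X × Act X U M → ℝ) (hG : ∀ s, DependsUpTo t fun ω => G ω s) :
    ∫ ω, G ω (ω (t + 1)) ∂commonLaw P ν explore
      = ∫ ω, ∑ s, exploreStep P (ω t) s * G ω s ∂commonLaw P ν explore := by
  have h := integral_processLaw_succ (prodVec ν ((explore : CommonPolicy X U M) 0 Fin.elim0))
    (fun n h => prodVec (P (h (Fin.last n)).1 (control (h (Fin.last n)).2 (h (Fin.last n)).1))
        ((explore : CommonPolicy X U M) (n + 1) fun i => record (h i))) t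
    fun h s => G (extendPath h) s
  refine Eq.trans (integral_congr_ae (Eventually.of_forall fun ω => ?_))
    (h.trans (integral_congr_ae (Eventually.of_forall fun ω => ?_)))
  · exact (hG (ω (t + 1))).eq_extendPath ω
  · refine Finset.sum_congr rfl fun s _ => ?_
    rw [(hG s).eq_extendPath ω]
    rfl

theorem integral_explore_iterate (ν : stdSimplex ℝ X) {t : ℕ} {Y : (ℕ → X × Act X U M) → ℝ}
    (hY : DependsUpTo t Y) (f : X × Act X U M → ℝ) (m : ℕ) :
    ∫ ω, Y ω * f (ω (t + m)) ∂commonLaw P ν explore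
      = ∫ ω, Y ω * (exploreOp P)^[m] f (ω t) ∂commonLaw P ν explore := by
  induction m generalizing f with
  | zero => rfl
  | succ m ih =>
    rw [Function.iterate_succ_apply, ← ih]
    refine (integral_explore_step ν (t + m) (fun ω s => Y ω * f s) fun s ω ω' H => ?_).trans ?_
    · simp only
      rw [hY.mono (Nat.le_add_right t m) ω ω' H]
    · simp only [exploreOp, Finset.mul_sum]
      refine integral_congr_ae (Eventually.of_forall fun ω => ?_)
      exact Finset.sum_congr rfl fun s _ => by ring

/-- The conditional expectation of a function of finitely many future coordinates. -/
theorem exists_future_mean (P : X → U → stdSimplex ℝ X) {m : ℕ} {F : (ℕ → X × Act X U M) → ℝ}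
    (hF : DependsUpTo m F) {C : ℝ} (hC : ∀ ω, |F ω| ≤ C) :
    ∃ f : X × Act X U M → ℝ, (∀ s, |f s| ≤ C) ∧ ∀ (ν : stdSimplex ℝ X) (t : ℕ)
      (Y : (ℕ → X × Act X U M) → ℝ), DependsUpTo t Y →
      ∫ ω, Y ω * F (shiftPath t ω) ∂commonLaw P ν explore
        = ∫ ω, Y ω * f (ω t) ∂commonLaw P ν explore := by
  induction m generalizing F with
  | zero =>
    refine ⟨fun s => F fun _ => s, fun s => hC _, fun ν t Y _ => ?_⟩
    refine integral_congr_ae (Eventually.of_forall fun ω => ?_)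
    refine congrArg (Y ω * ·) (hF _ _ fun i hi => ?_)
    rw [Nat.le_zero.1 hi]
    rfl
  | succ m ih =>
    -- The last relevant coordinate is integrated out: `cut` keeps the coordinates up to `m` and
    -- puts `s` afterwards, so `F'` depends on one coordinate fewer.
    let cut : (ℕ → X × Act X U M) → X × Act X U M → ℕ → X × Act X U M :=
      fun ω s i => if i ≤ m then ω i else s
    let F' : (ℕ → X × Act X U M) → ℝ := fun ω => ∑ s, exploreStep P (ω m) s * F (cut ω s)
    have hcut : ∀ ω ω' s, (∀ i ≤ m, ω i = ω' i) → cut ω s = cut ω' s := fun ω ω' s H => by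
      funext i
      simp only [cut]
      split_ifs with hi
      exacts [H i hi, rfl]
    have hF' : DependsUpTo m F' := fun ω ω' H => by
      simp only [F', H m le_rfl]
      exact Finset.sum_congr rfl fun s _ => by rw [hcut ω ω' s H]
    obtain ⟨f, hf, hf'⟩ := ih hF' fun ω => abs_sum_stdSimplex_mul_le _ fun s => hC _
    refine ⟨f, hf, fun ν t Y hY => ?_⟩
    rw [← hf' ν t Y hY]
    have h := integral_explore_step (P := P) ν (t + m) (fun ω s => Y ω * F (cut (shiftPath t ω) s))
      fun s ω ω' H => by
        simp only
        rw [hY.mono (Nat.le_add_right t m) ω ω' H, hcut (shiftPath t ω) (shiftPath t ω') s]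
        exact fun i hi => H (t + i) (by omega)
    refine Eq.trans (integral_congr_ae (Eventually.of_forall fun ω => ?_))
      (h.trans (integral_congr_ae (Eventually.of_forall fun ω => ?_)))
    · refine congrArg (Y ω * ·) (hF _ _ fun i hi => ?_)
      simp only [cut]
      split_ifs with him
      · rfl
      · rw [show i = m + 1 by omega]
        rfl
    · simp only [F', Finset.mul_sum]
      exact Finset.sum_congr rfl fun s _ => mul_left_comm _ _ _

/-- The ergodic theorem for functions of finitely many coordinates under uniform exploration. -/
theorem Overlap.ae_tendsto_average (hP : Overlap P δ) (hδ0 : 0 < δ) (hδ1 : δ ≤ 1)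
    {ζ : stdSimplex ℝ X} (hζ : IsInvariant M P ζ) (ν : stdSimplex ℝ X) {N : ℕ}
    {F : (ℕ → X × Act X U M) → ℝ} (hF : DependsUpTo N F) :
    ∀ᵐ ω ∂commonLaw P ν (explore : CommonPolicy X U M), Tendsto
      (fun n : ℕ => (∑ k ∈ Finset.range n, F (shiftPath k ω)) / n) atTop
      (𝓝 (∫ ω, F ω ∂commonLaw P ζ explore)) := by
  obtain ⟨C, hC⟩ := hF.exists_bound
  obtain ⟨f, hf, hfF⟩ := exists_future_mean P hF hC
  set r := exploreRate X U M δ with hr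
  obtain ⟨hr0, hr1⟩ : 0 < r ∧ r < 1 := exploreRate_mem hδ0 hδ1
  set L := ∫ ω, F ω ∂commonLaw P ζ explore with hL
  have hLf : L = ∑ x, ζ x * actionMean f x := by
    have h1 := hfF ζ 0 (fun _ => 1) fun _ _ _ => rfl
    have h2 : ∀ ω : ℕ → X × Act X U M, shiftPath 0 ω = ω := fun ω => by
      funext i; simp [shiftPath]
    simp only [one_mul, h2] at h1
    rw [hL, h1]
    refine (integral_processLaw_zero _ _ f).trans ?_
    rw [sum_prodVec_mul]
    rfl
  have hL1 : |L| ≤ C := by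
    have h := norm_integral_le_of_norm_le_const
      (μ := commonLaw P ζ (explore : CommonPolicy X U M)) (f := F) (C := C)
      (Eventually.of_forall fun ω => hC ω)
    simpa using h
  let Y : ℕ → (ℕ → X × Act X U M) → ℝ := fun k ω => F (shiftPath k ω) - L
  have hYd : ∀ k, DependsUpTo (k + N) (Y k) := fun k ω ω' H =>
    congrArg (· - L) (hF.comp_shiftPath k ω ω' H)
  have hYb : ∀ k ω, |Y k ω| ≤ 2 * C := fun k ω =>
    (abs_sub _ _).trans (by linarith [hC (shiftPath k ω)])
  have hYi : ∀ k, Integrable (Y k) (commonLaw P ν explore) := fun k =>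
    Integrable.of_bound (hYd k).measurable.aestronglyMeasurable (2 * C)
      (Eventually.of_forall (hYb k))
  have hfi : ∀ (j t : ℕ) (h : X × Act X U M → ℝ),
      Integrable (fun ω => Y j ω * h (ω t)) (commonLaw P ν explore) := fun j t h =>
    (integrable_path _ t h).bdd_mul (hYd j).measurable.aestronglyMeasurable
      (Eventually.of_forall (hYb j))
  have hbound : ∀ (j k : ℕ) (Z : (ℕ → X × Act X U M) → ℝ) (B : ℝ), (∀ ω, |Z ω| ≤ B) →
      |∫ ω, Y j ω * Z ω ∂commonLaw P ν explore| ≤ 2 * C * B := fun j k Z B hZ => by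
    have h := norm_integral_le_of_norm_le_const (μ := commonLaw P ν (explore : CommonPolicy X U M))
      (f := fun ω => Y j ω * Z ω) (C := 2 * C * B) (Eventually.of_forall fun ω => by
        rw [norm_mul]
        exact mul_le_mul (hYb j ω) (hZ ω) (abs_nonneg _) ((abs_nonneg _).trans (hYb j ω)))
    simpa using h
  -- `Y j` is determined only at time `j + N`. For lags up to `N` the trivial bound is absorbed by
  -- the factor `(r ^ (N + 1))⁻¹`; for larger lags the Markov property and mixing apply from time `j
  -- + N` on.
  have hcov : ∀ j k, |∫ ω, Y j ω * Y (j + k) ω ∂commonLaw P ν explore|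
      ≤ (2 * C * (2 * C) * (r ^ (N + 1))⁻¹) * r ^ k := fun j k => by
    have hC0 : 0 ≤ C := (abs_nonneg _).trans hL1
    have hrN : 0 < r ^ (N + 1) := pow_pos hr0 _
    rcases Nat.lt_or_ge k (N + 1) with hk | hk
    · refine (hbound j k _ _ (hYb (j + k))).trans ?_
      rw [mul_assoc (2 * C * (2 * C))]
      refine le_mul_of_one_le_right (by positivity) ?_
      rw [inv_mul_eq_div, one_le_div hrN]
      exact pow_le_pow_of_le_one hr0.le hr1.le hk.le
    · obtain ⟨m, rfl⟩ := Nat.exists_eq_add_of_le hk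
      have h1 : ∫ ω, Y j ω * Y (j + (N + 1 + m)) ω ∂commonLaw P ν explore
          = ∫ ω, Y j ω * ((exploreOp P)^[m + 1] f (ω (j + N)) - L) ∂commonLaw P ν explore := by
        have h2 := hfF ν (j + (N + 1 + m)) (Y j) ((hYd j).mono (by omega))
        have h3 := integral_explore_iterate (P := P) ν (hYd j) f (m + 1)
        rw [show j + N + (m + 1) = j + (N + 1 + m) by omega] at h3
        have hi1 : Integrable (fun ω => Y j ω * F (shiftPath (j + (N + 1 + m)) ω))
            (commonLaw P ν explore) :=
          Integrable.bdd_mul (c := 2 * C)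
            (Integrable.of_bound (hF.comp_shiftPath _).measurable.aestronglyMeasurable C
              (Eventually.of_forall fun ω => hC _))
            (hYd j).measurable.aestronglyMeasurable (Eventually.of_forall (hYb j))
        simp only [mul_sub, Y]
        simp only [Y] at hi1 h2 h3 hYi hfi
        rw [integral_sub hi1 ((hYi j).mul_const L), h2, h3, integral_sub (hfi j _ _)
          ((hYi j).mul_const L)]
      rw [h1, hLf]
      refine (hbound j 0 _ _ fun ω =>
        hP.abs_exploreOp_iterate_sub_le hδ0 hζ hf m (ω (j + N))).trans_eq ?_
      rw [pow_add r (N + 1) m, ← hr]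
      field_simp
  filter_upwards [ae_tendsto_average_zero (fun k => (hYd k).measurable) hYb hr0.le hr1 hcov]
    with ω hω
  have h := hω.add_const L
  rw [zero_add] at h
  refine h.congr' ?_
  filter_upwards [eventually_gt_atTop 0] with n hn
  have hn' : (n : ℝ) ≠ 0 := (Nat.cast_pos.2 hn).ne'
  simp only [Y, Finset.sum_sub_distrib, Finset.sum_const, Finset.card_range, nsmul_eq_mul]
  field_simp
  ring

end Ergodic

/-! ### Pathwise convergence of asynchronous averaged value iteration -/

section AveragedIteration

variable {W A : Type*} [DecidableEq W] [DecidableEq A] [Finite W] [Finite A] [Nonempty A]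

/-- The indicator of the pair `(I, b)` at time `k`. -/
def hit (s : ℕ → W) (a : ℕ → A) (I : W) (b : A) (k : ℕ) : ℝ := if s k = I ∧ a k = b then 1 else 0

/-- The number of times before `t` at which the pair `(I, b)` occurs. -/
def hits (s : ℕ → W) (a : ℕ → A) (I : W) (b : A) (t : ℕ) : ℝ :=
  ∑ k ∈ Finset.range t, hit s a I b k

variable {s : ℕ → W} {a : ℕ → A}

theorem hit_nonneg (I : W) (b : A) (k : ℕ) : 0 ≤ hit s a I b k := by
  rw [hit]; split_ifs <;> norm_num

theorem hit_le_one (I : W) (b : A) (k : ℕ) : hit s a I b k ≤ 1 := by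
  rw [hit]; split_ifs <;> norm_num

theorem hits_nonneg (I : W) (b : A) (t : ℕ) : 0 ≤ hits s a I b t :=
  Finset.sum_nonneg fun k _ => hit_nonneg I b k

variable {Q : ℕ → W → A → ℝ} {c : W → A → ℝ} {β : ℝ}

/-- The asynchronous averaged value iteration along the path `(s, a)`. -/
def IsAveragedIteration (s : ℕ → W) (a : ℕ → A) (c : W → A → ℝ) (β : ℝ) (Q : ℕ → W → A → ℝ) :
    Prop :=
  (∀ I b, Q 0 I b = 0) ∧ ∀ t I b, Q (t + 1) I b = Q t I b +
    hit s a I b t * ((hits s a I b t + 2)⁻¹ * (c I b + β * (⨅ b', Q t (s (t + 1)) b') - Q t I b))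

/-- The step size `(hits + 2)⁻¹` makes the iterate the exact mean of its past targets, the initial
value 0 counting as one sample. Stochastic approximation thereby reduces to the convergence of
averages. -/
theorem IsAveragedIteration.mul_eq (hQ : IsAveragedIteration s a c β Q) (I : W) (b : A) (t : ℕ) :
    (hits s a I b t + 1) * Q t I b = ∑ k ∈ Finset.range t,
      hit s a I b k * (c I b + β * ⨅ b', Q k (s (k + 1)) b') := by
  induction t with
  | zero => simp [hQ.1]
  | succ t ih =>
    have h0 := hits_nonneg (s := s) (a := a) I b t
    rw [Finset.sum_range_succ, ← ih, hQ.2, hits, Finset.sum_range_succ, ← hits, hit]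
    split_ifs with h
    · have : hits s a I b t + 2 ≠ 0 := by positivity
      field_simp
      ring
    · ring

theorem IsAveragedIteration.abs_le (hQ : IsAveragedIteration s a c β Q) (hβ0 : 0 < β) {C K : ℝ}
    (hc : ∀ I b, |c I b| ≤ C) (hK : C + β * K ≤ K) (hK0 : 0 ≤ K) (t : ℕ) (I : W) (b : A) :
    |Q t I b| ≤ K := by
  induction t using Nat.strong_induction_on generalizing I b with
  | _ t ih =>
    have h0 := hits_nonneg (s := s) (a := a) I b t
    have h1 : |(hits s a I b t + 1) * Q t I b| ≤ hits s a I b t * K := by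
      rw [hQ.mul_eq, hits, Finset.sum_mul]
      refine (Finset.abs_sum_le_sum_abs _ _).trans (Finset.sum_le_sum fun k hk => ?_)
      rw [abs_mul, abs_of_nonneg (hit_nonneg I b k)]
      refine mul_le_mul_of_nonneg_left ?_ (hit_nonneg I b k)
      refine (abs_add_le _ _).trans ((add_le_add (hc I b) ?_).trans hK)
      rw [abs_mul, abs_of_pos hβ0]
      exact mul_le_mul_of_nonneg_left
        (abs_iInf_le fun b' => ih k (Finset.mem_range.1 hk) _ b') hβ0.le
    rw [abs_mul, abs_of_nonneg (by linarith)] at h1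
    have h2 : (hits s a I b t + 1) * |Q t I b| ≤ (hits s a I b t + 1) * K := by linarith
    exact le_of_mul_le_mul_left h2 (by linarith)

variable {G : W → Prop} {q : W → A → ℝ} {κ : W → A → (W → ℝ) → ℝ}

/-- If the limit points are within `L` of the fixed point, they are within `β L`. -/
theorem IsAveragedIteration.eventually_le (hQ : IsAveragedIteration s a c β Q) (hβ0 : 0 < β)
    {C K : ℝ} (hc : ∀ I b, |c I b| ≤ C) (hK : C + β * K ≤ K) (hK0 : 0 ≤ K)
    (hqK : ∀ I b, |q I b| ≤ K) (hq : ∀ I b, q I b = c I b + β * κ I b fun J => ⨅ b', q J b')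
    {I : W} {b : A} {p : ℝ} (hp : 0 < p)
    (hfreq : Tendsto (fun t : ℕ => hits s a I b t / t) atTop (𝓝 p))
    (hmean : Tendsto (fun t : ℕ => (∑ k ∈ Finset.range t, hit s a I b k *
      ((⨅ b', q (s (k + 1)) b') - κ I b fun J => ⨅ b', q J b')) / t) atTop (𝓝 0))
    [DecidablePred G]
    (hbad : Tendsto (fun t : ℕ => (∑ k ∈ Finset.range t, hit s a I b k *
      (if G (s (k + 1)) then 0 else 1)) / t) atTop (𝓝 0))
    {L : ℝ} (hL : 0 ≤ L) (hQL : ∀ᶠ t in atTop, ∀ J, G J → ∀ b', |Q t J b' - q J b'| ≤ L)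
    {ε : ℝ} (hε : 0 < ε) : ∀ᶠ t in atTop, |Q t I b - q I b| ≤ β * L + ε := by
  obtain ⟨T, hT⟩ := eventually_atTop.1 hQL
  let bad : ℕ → ℝ := fun t => ∑ k ∈ Finset.range t, hit s a I b k * (if G (s (k + 1)) then 0 else 1)
  let dev : ℕ → ℝ := fun t => ∑ k ∈ Finset.range t, hit s a I b k *
      ((⨅ b', q (s (k + 1)) b') - κ I b fun J => ⨅ b', q J b')
  -- Beside the contracted error `β * L` per hit there are four errors: the initial sample, the
  -- times before `T`, the transitions leaving `G`, and the sampling error `dev`.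
  have hmain : ∀ t, (hits s a I b t + 1) * |Q t I b - q I b|
      ≤ β * L * hits s a I b t + (K + β * (2 * K * T) + β * (2 * K) * bad t + β * |dev t|) := by
    intro t
    have h1 : (hits s a I b t + 1) * (Q t I b - q I b) = -q I b
        + β * ∑ k ∈ Finset.range t, hit s a I b k *
          ((⨅ b', Q k (s (k + 1)) b') - ⨅ b', q (s (k + 1)) b') + β * dev t := by
      have h2 : (hits s a I b t + 1) * q I b = q I b + ∑ k ∈ Finset.range t, hit s a I b k *
          (c I b + β * κ I b fun J => ⨅ b', q J b') := by
        rw [← Finset.sum_mul, ← hq, ← hits]; ring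
      have h5 : ∑ k ∈ Finset.range t, hit s a I b k * (c I b + β * ⨅ b', Q k (s (k + 1)) b')
          = ∑ k ∈ Finset.range t, hit s a I b k * (c I b + β * κ I b fun J => ⨅ b', q J b')
            + β * ∑ k ∈ Finset.range t, hit s a I b k *
              ((⨅ b', Q k (s (k + 1)) b') - ⨅ b', q (s (k + 1)) b') + β * dev t := by
        simp only [dev, Finset.mul_sum, ← Finset.sum_add_distrib]
        exact Finset.sum_congr rfl fun k _ => by ring
      rw [mul_sub, hQ.mul_eq, h2, h5]
      ring
    have h3 : |∑ k ∈ Finset.range t, hit s a I b k *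
          ((⨅ b', Q k (s (k + 1)) b') - ⨅ b', q (s (k + 1)) b')|
        ≤ L * hits s a I b t + (2 * K * T + 2 * K * bad t) := by
      have h4 : ∀ k ∈ Finset.range t, |hit s a I b k *
          ((⨅ b', Q k (s (k + 1)) b') - ⨅ b', q (s (k + 1)) b')|
          ≤ L * hit s a I b k + ((if k < T then 2 * K else 0) +
            2 * K * (hit s a I b k * (if G (s (k + 1)) then 0 else 1))) := fun k _ => by
        have hh0 := hit_nonneg (s := s) (a := a) I b k
        have hh1 := hit_le_one (s := s) (a := a) I b k
        have h5 : |(⨅ b', Q k (s (k + 1)) b') - ⨅ b', q (s (k + 1)) b'| ≤ 2 * K :=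
          abs_iInf_sub_iInf_le fun b' => (abs_sub _ _).trans
            (by linarith [hQ.abs_le hβ0 hc hK hK0 k (s (k + 1)) b', hqK (s (k + 1)) b'])
        rw [abs_mul, abs_of_nonneg hh0]
        have h6 := mul_le_mul_of_nonneg_left h5 hh0
        have h7 : hit s a I b k * (2 * K) ≤ 2 * K := mul_le_of_le_one_left (by linarith) hh1
        have h8 : 0 ≤ L * hit s a I b k := mul_nonneg hL hh0
        by_cases hG : G (s (k + 1))
        · rcases Nat.lt_or_ge k T with hk | hk
          · rw [if_pos hk, if_pos hG]
            linarith
          · rw [if_neg hk.not_gt, if_pos hG]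
            have h9 := mul_le_mul_of_nonneg_left
              (abs_iInf_sub_iInf_le fun b' => hT k hk (s (k + 1)) hG b') hh0
            linarith
        · rw [if_neg hG]
          have h10 : (0 : ℝ) ≤ if k < T then 2 * K else 0 := by split_ifs <;> linarith
          linarith
      refine (Finset.abs_sum_le_sum_abs _ _).trans ((Finset.sum_le_sum h4).trans ?_)
      rw [Finset.sum_add_distrib, Finset.sum_add_distrib, ← Finset.mul_sum, ← Finset.mul_sum]
      refine add_le_add le_rfl (add_le_add ?_ le_rfl)
      rw [← Finset.sum_filter, Finset.sum_const, nsmul_eq_mul, mul_comm]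
      refine mul_le_mul_of_nonneg_left (Nat.cast_le.2 ?_) (by linarith)
      refine (Finset.card_le_card fun k hk => ?_).trans_eq (Finset.card_range T)
      exact Finset.mem_range.2 (Finset.mem_filter.1 hk).2
    have h0 := hits_nonneg (s := s) (a := a) I b t
    have h11 : (hits s a I b t + 1) * |Q t I b - q I b|
        = |(hits s a I b t + 1) * (Q t I b - q I b)| := by
      rw [abs_mul, abs_of_nonneg (show 0 ≤ hits s a I b t + 1 by linarith)]
    rw [h11, h1]
    refine (abs_add_le _ _).trans ((add_le_add_left (abs_add_le _ _) _).trans ?_)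
    rw [abs_neg, abs_mul, abs_mul, abs_of_pos hβ0]
    have h12 := mul_le_mul_of_nonneg_left h3 hβ0.le
    have h13 := hqK I b
    linarith
  -- All four errors are of order `o(t)`, whereas `hits` grows like `p * t`; so `ε * hits`
  -- eventually absorbs them.
  have hlim : Tendsto (fun t : ℕ => (K + β * (2 * K * T)) / t + β * (2 * K) * (bad t / t)
      + β * |dev t / t| - ε * (hits s a I b t / t)) atTop (𝓝 (0 + β * (2 * K) * 0 + β * |0| - ε * p)) :=
    (((tendsto_const_div_atTop_nhds_zero_nat _).add (hbad.const_mul _)).add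
      (hmean.abs.const_mul β)).sub (hfreq.const_mul ε)
  have hneg : 0 + β * (2 * K) * 0 + β * |0| - ε * p < 0 := by
    simp only [mul_zero, abs_zero, zero_add, zero_sub, neg_lt_zero]
    positivity
  filter_upwards [hlim.eventually_lt_const hneg, eventually_gt_atTop 0] with t ht ht0
  have ht0' : (0 : ℝ) < t := Nat.cast_pos.2 ht0
  have h0 := hits_nonneg (s := s) (a := a) I b t
  have h1 : K + β * (2 * K * T) + β * (2 * K) * bad t + β * |dev t| ≤ ε * hits s a I b t := by
    have h2 := mul_lt_mul_of_pos_right ht ht0'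
    rw [abs_div, abs_of_pos ht0', zero_mul] at h2
    have h3 : ((K + β * (2 * K * T)) / t + β * (2 * K) * (bad t / t) + β * (|dev t| / t)
        - ε * (hits s a I b t / t)) * t
        = K + β * (2 * K * T) + β * (2 * K) * bad t + β * |dev t| - ε * hits s a I b t := by
      field_simp
    rw [h3] at h2
    linarith
  have h2 := hmain t
  have h3 : (hits s a I b t + 1) * |Q t I b - q I b| ≤ (hits s a I b t + 1) * (β * L + ε) := by
    have : 0 ≤ β * L := mul_nonneg hβ0.le hL
    nlinarith
  exact le_of_mul_le_mul_left h3 (by linarith)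

/-- Repeated use of `eventually_le` with `ε = (1 - β) / 2 * L` shrinks the bound by `(1 + β) / 2`
each time. The starting bound `2 * K + 1` rather than `2 * K` keeps `L`, and so `ε`, positive. -/
theorem IsAveragedIteration.tendsto (hQ : IsAveragedIteration s a c β Q) (hβ0 : 0 < β)
    (hβ1 : β < 1) {C K : ℝ} (hc : ∀ I b, |c I b| ≤ C) (hK : C + β * K ≤ K) (hK0 : 0 ≤ K)
    (hqK : ∀ I b, |q I b| ≤ K) (hq : ∀ I b, q I b = c I b + β * κ I b fun J => ⨅ b', q J b')
    [DecidablePred G]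
    (hfreq : ∀ I b, G I → ∃ p, 0 < p ∧ Tendsto (fun t : ℕ => hits s a I b t / t) atTop (𝓝 p))
    (hmean : ∀ I b, G I → Tendsto (fun t : ℕ => (∑ k ∈ Finset.range t, hit s a I b k *
      ((⨅ b', q (s (k + 1)) b') - κ I b fun J => ⨅ b', q J b')) / t) atTop (𝓝 0))
    (hbad : ∀ I b, G I → Tendsto (fun t : ℕ => (∑ k ∈ Finset.range t, hit s a I b k *
      (if G (s (k + 1)) then 0 else 1)) / t) atTop (𝓝 0))
    (I : W) (b : A) (hI : G I) : Tendsto (fun t => Q t I b) atTop (𝓝 (q I b)) := by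
  set β' := (1 + β) / 2 with hβ'
  have hβ'0 : 0 < β' := by positivity
  have hβ'1 : β' < 1 := by linarith
  have hiter : ∀ m : ℕ, ∀ᶠ t in atTop, ∀ J, G J → ∀ b', |Q t J b' - q J b'|
      ≤ β' ^ m * (2 * K + 1) := fun m => by
    induction m with
    | zero =>
      refine Eventually.of_forall fun t J _ b' => (abs_sub _ _).trans ?_
      have h1 := hQ.abs_le hβ0 hc hK hK0 t J b'
      have h2 := hqK J b'
      simp only [pow_zero, one_mul]
      linarith
    | succ m ih =>
      have hL : 0 < β' ^ m * (2 * K + 1) := by positivity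
      rw [eventually_all]
      intro J
      by_cases hJ : G J
      · simp only [hJ, forall_true_left]
        rw [eventually_all]
        intro b'
        obtain ⟨p, hp, hpt⟩ := hfreq J b' hJ
        have hε : 0 < (1 - β) / 2 * (β' ^ m * (2 * K + 1)) := mul_pos (by linarith) hL
        refine (hQ.eventually_le hβ0 hc hK hK0 hqK hq hp hpt (hmean J b' hJ) (hbad J b' hJ) hL.le ih
          hε).mono fun t ht => ht.trans_eq ?_
        rw [pow_succ, hβ']
        ring
      · simp [hJ]
  rw [tendsto_iff_dist_tendsto_zero]
  refine Metric.tendsto_atTop.2 fun ε hε => ?_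
  have hpow : Tendsto (fun m : ℕ => β' ^ m * (2 * K + 1)) atTop (𝓝 0) := by
    simpa using (tendsto_pow_atTop_nhds_zero_of_lt_one hβ'0.le hβ'1).mul_const (2 * K + 1)
  obtain ⟨m, hm⟩ := (hpow.eventually_lt_const hε).exists
  obtain ⟨T, hT⟩ := eventually_atTop.1 (hiter m)
  refine ⟨T, fun t ht => ?_⟩
  rw [Real.dist_eq, sub_zero, abs_of_nonneg dist_nonneg, Real.dist_eq]
  exact (hT t ht I hI b).trans_lt hm

end AveragedIteration

/-! ### Almost sure convergence of Q-learning -/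

section QLearning

variable {X U M : Type*} [Fintype X] [DecidableEq X] [Fintype U] [DecidableEq U] [Fintype M]
  [DecidableEq M] [Nonempty U] [Nonempty M]
  {P : X → U → stdSimplex ℝ X} {c : X → U → ℝ} {β δ : ℝ} {ζ : stdSimplex ℝ X}

/-- `visits` includes the current time while `hits` does not, so the learning rate at a hit is
`(hits + 2)⁻¹`. -/
theorem isAveragedIteration_qIter (N : ℕ) (ω : ℕ → X × Act X U M) :
    IsAveragedIteration (fun t => windowAt N t ω) (fun t => (ω (t + N)).2)
      (mdpStageCost P c ζ) β (qIter P c β ζ ω) := by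
  refine ⟨fun I b => rfl, fun t I b => ?_⟩
  rw [qIter, rate, hit]
  split_ifs with h
  · have hv : (visits ω t I b : ℝ)
        = hits (fun t => windowAt N t ω) (fun t => (ω (t + N)).2) I b t + 1 := by
      rw [visits, Finset.card_filter, Finset.sum_range_succ, if_pos h, hits]
      push_cast
      rfl
    rw [hv, h.1, h.2]
    ring
  · ring

variable [MeasurableSpace X] [MeasurableSingletonClass X] [MeasurableSpace U]
  [MeasurableSingletonClass U] [MeasurableSpace M] [MeasurableSingletonClass M]

/-- On a hit the next window is a function of the hidden state, so the summand depends on `N + 1`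
coordinates. In the stationary regime the hidden state is weighted by the filter started from `ζ`,
which is why the model uses this prior. -/
theorem ae_tendsto_hit_average (hP : Overlap P δ) (hδ0 : 0 < δ) (hδ1 : δ ≤ 1)
    (hζ : IsInvariant M P ζ) (ν : stdSimplex ℝ X) {N : ℕ} (I : Window X U M N) (a : Act X U M)
    (f : Window X U M N → ℝ) :
    ∀ᵐ ω ∂commonLaw P ν (explore : CommonPolicy X U M), Tendsto (fun t : ℕ =>
      (∑ k ∈ Finset.range t, hit (fun t => windowAt N t ω) (fun t => (ω (t + N)).2) I a k *
        f (windowAt N (k + 1) ω)) / t) atTop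
      (𝓝 ((Fintype.card (Act X U M) : ℝ)⁻¹ ^ (N + 1) *
        ∑ x, filt P ζ (rev I) x * f (shift I (record (x, a))))) := by
  let φ : (Fin N → Rec X U M) → X × Act X U M → ℝ := fun K s =>
    if K = I ∧ s.2 = a then f (shift I (record (s.1, a))) else 0
  let F : (ℕ → X × Act X U M) → ℝ := fun ω => φ (recs N ω) (ω N)
  have hF : DependsUpTo N F := fun ω ω' H => by
    have h : recs N ω = recs N ω' := funext fun i => congrArg record (H i i.2.le)
    simp only [F, h, H N le_rfl]
  have h := hP.ae_tendsto_average hδ0 hδ1 hζ ν hF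
  have hint := integral_explore P ζ N φ
  rw [Finset.sum_eq_single I (fun K _ hK => by simp [φ, hK]) (by simp)] at hint
  simp only [φ, true_and, Finset.sum_ite_eq', Finset.mem_univ, if_true] at hint
  filter_upwards [h] with ω hω
  rw [← hint]
  refine hω.congr fun t => ?_
  congr 1
  refine Finset.sum_congr rfl fun k _ => ?_
  have hrec : recs N (shiftPath k ω) = windowAt N k ω := rfl
  simp only [F, φ, hrec, hit, shiftPath]
  split_ifs with hk
  · rw [one_mul, windowAt_succ, hk.1, ← hk.2]
  · rw [zero_mul]

/-- A state charged by the filter makes its own symbol possible; invariance then allows the oldest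
record to be dropped. -/
theorem Possible.shift_record (hζ : IsInvariant M P ζ) {N : ℕ} {I : Window X U M N} {x : X}
    (hx : filt P ζ (rev I) x ≠ 0) (a : Act X U M) :
    Possible P ζ (rev (shift I (record (x, a)))) := by
  have h0 := filt_nonneg P (stdSimplex.zero_le ζ) (rev I)
  rw [rev_shift]
  refine Possible.take hζ ?_ N
  rw [Possible, filt, mass_push]
  have h1 : 0 < filt P ζ (rev I) x := lt_of_le_of_ne (h0 x) hx.symm
  refine lt_of_lt_of_le h1 ((le_of_eq ?_).trans (Finset.single_le_sum (fun y _ => ?_)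
    (Finset.mem_univ x)))
  · exact (if_pos rfl).symm
  · split_ifs
    exacts [h0 y, le_rfl]

theorem ae_tendsto_qIter (hP : Overlap P δ) (hδ0 : 0 < δ) (hδ1 : δ ≤ 1)
    (hζ : IsInvariant M P ζ) (hβ0 : 0 < β) (hβ1 : β < 1) {N : ℕ}
    {q : Window X U M N → Act X U M → ℝ} (hq : bellman P c β ζ N q = q) (ν : stdSimplex ℝ X) :
    ∀ᵐ ω ∂commonLaw P ν (explore : CommonPolicy X U M), ∀ (I : Window X U M N) (a : Act X U M),
      Possible P ζ (rev I) → Tendsto (fun t => qIter P c β ζ ω t I a) atTop (𝓝 (q I a)) := by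
  classical
  obtain ⟨C, hC0, hC⟩ := exists_abs_le_cost c
  have h1β : 0 < 1 - β := by linarith
  let V : Window X U M N → ℝ := fun I => ⨅ a, q I a
  let κ : Window X U M N → Act X U M → (Window X U M N → ℝ) → ℝ := fun I a f =>
    ∑ I', mdpKernel P ζ I a I' * f I'
  -- Three test functions of the next window: the constant 1 gives visit frequencies, the centred
  -- value gives sampling errors of mean zero, and the indicator of impossible windows shows that
  -- the latter are hit with frequency zero.
  have hall : ∀ᵐ ω ∂commonLaw P ν (explore : CommonPolicy X U M),
      ∀ (I : Window X U M N) (a : Act X U M), ∀ i : Fin 3,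
        Tendsto (fun t : ℕ =>
      (∑ k ∈ Finset.range t, hit (fun t => windowAt N t ω) (fun t => (ω (t + N)).2) I a k *
        (![fun _ => 1, fun J => V J - κ I a V, fun J => if Possible P ζ (rev J) then 0 else 1] :
          Fin 3 → Window X U M N → ℝ) i (windowAt N (k + 1) ω)) / t) atTop
      (𝓝 ((Fintype.card (Act X U M) : ℝ)⁻¹ ^ (N + 1) *
        ∑ x, filt P ζ (rev I) x * (![fun _ => 1, fun J => V J - κ I a V,
          fun J => if Possible P ζ (rev J) then 0 else 1] :
          Fin 3 → Window X U M N → ℝ) i (shift I (record (x, a))))) :=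
    ae_all_iff.2 fun I => ae_all_iff.2 fun a => ae_all_iff.2 fun i =>
      ae_tendsto_hit_average hP hδ0 hδ1 hζ ν I a _
  filter_upwards [hall] with ω hω I a hI
  have hcard : (0 : ℝ) < (Fintype.card (Act X U M) : ℝ)⁻¹ ^ (N + 1) := by
    have : 0 < Fintype.card (Act X U M) := Fintype.card_pos
    positivity
  refine (isAveragedIteration_qIter N ω).tendsto (G := fun J => Possible P ζ (rev J)) (κ := κ)
    hβ0 hβ1 (C := C) (K := C / (1 - β)) (fun I a => abs_mdpStageCost_le hC I a) ?_
    (by positivity) (fun I a => abs_fixedPoint_le hβ0 hβ1 hC hq I a)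
    (fun I a => (congrFun (congrFun hq I) a).symm) ?_ ?_ ?_ I a hI
  · refine le_of_eq ?_
    field_simp
    ring
  · intro I a hI
    refine ⟨_, mul_pos hcard hI, ?_⟩
    have h := hω I a 0
    simpa [hits, mass] using h
  · intro I a hI
    have h := hω I a 1
    have h0 : ∑ x, filt P ζ (rev I) x * (V (shift I (record (x, a))) - κ I a V) = 0 := by
      simp only [κ, sum_mdpKernel_mul, psi_eq_post]
      simp only [filt_eq_mass_mul_post P ζ (rev I), mul_assoc, ← Finset.mul_sum, mul_sub,
        Finset.sum_sub_distrib]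
      rw [← Finset.sum_mul, stdSimplex.sum_eq_one, one_mul, sub_self]
    simpa [h0] using h
  · intro I a hI
    have h := hω I a 2
    have h0 : ∑ x, filt P ζ (rev I) x *
        (if Possible P ζ (rev (shift I (record (x, a)))) then 0 else 1) = 0 := by
      refine Finset.sum_eq_zero fun x _ => ?_
      by_cases hx : filt P ζ (rev I) x = 0
      · rw [hx, zero_mul]
      · rw [if_pos (Possible.shift_record hζ hx a), mul_zero]
    change Tendsto _ _ (𝓝 (_ * ∑ x, filt P ζ (rev I) x *
        (if Possible P ζ (rev (shift I (record (x, a)))) then 0 else 1))) at h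
    rw [h0, mul_zero] at h
    exact h

end QLearning

/-! ### Finite-horizon values and the accumulated predictor error -/

section ErrorRecursion

variable {X U M : Type*} [Fintype X] [DecidableEq X] [Fintype U] [DecidableEq U] [Fintype M]
  [DecidableEq M]

open scoped Classical in
/-- The distance between a (true, unnormalised) predictor `p` and the predictor of the finite
window model after the records `l` (newest first). -/
def err (P : X → U → stdSimplex ℝ X) (ζ : stdSimplex ℝ X) (N : ℕ) (p : X → ℝ)
    (l : List (Rec X U M)) : ℝ :=
  if Possible P ζ (l.take N) then gap p (post P ζ (l.take N)) else 2 * mass p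

/-- The sum of the distances over all continuations by `t` records. -/
def errSum (P : X → U → stdSimplex ℝ X) (ζ : stdSimplex ℝ X) (N : ℕ) :
    ℕ → (X → ℝ) → List (Rec X U M) → ℝ
  | 0, p, l => err P ζ N p l
  | t + 1, p, l => ∑ w, errSum P ζ N t (push P p w) (w :: l)

/-- The discounted sum of the distances up to the horizon `n`. -/
def accErr (P : X → U → stdSimplex ℝ X) (ζ : stdSimplex ℝ X) (β : ℝ) (N n : ℕ) (p : X → ℝ)
    (l : List (Rec X U M)) : ℝ :=
  ∑ t ∈ Finset.range n, β ^ t * errSum P ζ N t p l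

variable {P : X → U → stdSimplex ℝ X} {c : X → U → ℝ} {β : ℝ} {ζ : stdSimplex ℝ X} {N : ℕ}

theorem err_nonneg {p : X → ℝ} (hp : ∀ x, 0 ≤ p x) (l : List (Rec X U M)) :
    0 ≤ err P ζ N p l := by
  rw [err]
  split_ifs
  exacts [gap_nonneg _ _, mul_nonneg zero_le_two (mass_nonneg hp)]

theorem errSum_nonneg (t : ℕ) {p : X → ℝ} (hp : ∀ x, 0 ≤ p x) (l : List (Rec X U M)) :
    0 ≤ errSum P ζ N t p l := by
  induction t generalizing p l with
  | zero => exact err_nonneg hp l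
  | succ t ih => exact Finset.sum_nonneg fun w _ => ih (push_nonneg P hp w) _

theorem errSum_mul (t : ℕ) {r : ℝ} (hr : 0 ≤ r) (p : X → ℝ) (l : List (Rec X U M)) :
    errSum P ζ N t (fun x => r * p x) l = r * errSum P ζ N t p l := by
  induction t generalizing p l with
  | zero =>
    simp only [errSum, err, gap_mul hr, mass_mul]
    split_ifs <;> ring
  | succ t ih =>
    simp only [errSum, push_mul, Finset.mul_sum]
    exact Finset.sum_congr rfl fun w _ => ih _ _

theorem accErr_nonneg (hβ0 : 0 < β) (n : ℕ) {p : X → ℝ} (hp : ∀ x, 0 ≤ p x)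
    (l : List (Rec X U M)) : 0 ≤ accErr P ζ β N n p l :=
  Finset.sum_nonneg fun t _ => mul_nonneg (pow_pos hβ0 t).le (errSum_nonneg t hp l)

theorem accErr_succ (n : ℕ) (p : X → ℝ) (l : List (Rec X U M)) :
    accErr P ζ β N (n + 1) p l
      = err P ζ N p l + β * ∑ w, accErr P ζ β N n (push P p w) (w :: l) := by
  simp only [accErr]
  rw [Finset.sum_range_succ', add_comm, Finset.sum_comm, Finset.mul_sum]
  congr 1
  · simp [errSum]
  · refine Finset.sum_congr rfl fun t _ => ?_
    rw [errSum, ← Finset.mul_sum, pow_succ']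
    ring

theorem take_cons_take (w : Rec X U M) (l : List (Rec X U M)) (N : ℕ) :
    (w :: l.take N).take N = (w :: l).take N := by
  cases N with
  | zero => rfl
  | succ N => simp [List.take_take]

theorem take_cons_eq_rev_shift {I : Window X U M N} {l : List (Rec X U M)} (hl : l.take N = rev I)
    (w : Rec X U M) : (w :: l).take N = rev (shift I w) := by
  rw [rev_shift, ← hl, take_cons_take]

/-- On impossible windows only the triangle inequality is available, which accounts for the value `2
* mass p` of `err` there. -/
theorem abs_sum_mul_sub_le_err {p : X → ℝ} (hp : ∀ x, 0 ≤ p x) {I : Window X U M N}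
    {l : List (Rec X U M)} (hl : l.take N = rev I) {f : X → ℝ} {B : ℝ} (hf : ∀ x, |f x| ≤ B) :
    |∑ x, p x * f x - mass p * ∑ x, psi P ζ I x * f x| ≤ B * err P ζ N p l := by
  rw [err, hl]
  split_ifs
  · rw [Finset.mul_sum, ← Finset.sum_sub_distrib, psi_eq_post, gap, Finset.mul_sum]
    refine (Finset.abs_sum_le_sum_abs _ _).trans (Finset.sum_le_sum fun x _ => ?_)
    rw [← mul_assoc, ← sub_mul, abs_mul, mul_comm B]
    exact mul_le_mul_of_nonneg_left (hf x) (abs_nonneg _)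
  · have h1 : |∑ x, p x * f x| ≤ mass p * B := abs_sum_mul_le hp hf
    have h2 := mul_le_mul_of_nonneg_left (abs_sum_stdSimplex_mul_le (psi P ζ I) hf)
      (mass_nonneg hp)
    have h3 := abs_sub (∑ x, p x * f x) (mass p * ∑ x, psi P ζ I x * f x)
    rw [abs_mul, abs_of_nonneg (mass_nonneg hp)] at h3
    linarith

theorem sum_mul_record (p : X → ℝ) (a : Act X U M) (f : Rec X U M → ℝ) :
    ∑ x, p x * f (record (x, a)) = ∑ q, mass (push P p (q, a)) * f (q, a) := by
  have h := sum_sum_push_mul P p a fun w _ => f w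
  simp only [← Finset.sum_mul, stdSimplex.sum_eq_one, one_mul] at h
  exact h.symm

variable [Nonempty U] [Nonempty M] {C K : ℝ} {q : Window X U M N → Act X U M → ℝ}

/-- The finite window model is consistent with the true dynamics up to the distance of the
predictors. -/
theorem abs_lookahead_sub_le (hβ0 : 0 < β) (hc : ∀ x u, |c x u| ≤ C) (hK : C + β * K = K)
    (hq : bellman P c β ζ N q = q) (hqK : ∀ I a, |q I a| ≤ K) {p : X → ℝ} (hp : ∀ x, 0 ≤ p x)
    {I : Window X U M N} {l : List (Rec X U M)} (hl : l.take N = rev I) (a : Act X U M) :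
    |(∑ x, p x * c x (control a x)
        + β * ∑ s, mass (push P p (s, a)) * ⨅ b, q (shift I (s, a)) b) - mass p * q I a|
      ≤ K * err P ζ N p l := by
  -- The one-step lookahead as a function of the hidden state. Its mean under the model predictor is
  -- `q I a` by the Bellman equation, and it is bounded by `K`, so only the change of predictor
  -- remains.
  let f : X → ℝ := fun x => c x (control a x) + β * ⨅ b, q (shift I (record (x, a))) b
  have hf : ∀ x, |f x| ≤ K := fun x => by
    refine (abs_add_le _ _).trans ((add_le_add (hc _ _) ?_).trans_eq hK)
    rw [abs_mul, abs_of_pos hβ0]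
    exact mul_le_mul_of_nonneg_left (abs_iInf_le fun b => hqK _ b) hβ0.le
  have hsum : ∀ r : X → ℝ, ∑ x, r x * f x = ∑ x, r x * c x (control a x)
      + β * ∑ x, r x * ⨅ b, q (shift I (record (x, a))) b := fun r => by
    rw [Finset.mul_sum, ← Finset.sum_add_distrib]
    exact Finset.sum_congr rfl fun x _ => by ring
  have h := abs_sum_mul_sub_le_err (P := P) (ζ := ζ) hp hl hf
  have hqa : ∑ x, psi P ζ I x * f x = q I a := by
    rw [hsum, ← sum_mdpKernel_mul P ζ I a fun J => ⨅ b, q J b]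
    exact congrFun (congrFun hq I) a
  rw [hqa, hsum, sum_mul_record (P := P) p a fun w => ⨅ b, q (shift I w) b] at h
  exact h

/-- The finite horizon cost of a sliding window policy. -/
def windowValue (P : X → U → stdSimplex ℝ X) (c : X → U → ℝ) (β : ℝ) {N : ℕ}
    (γ : Window X U M N → Act X U M) : ℕ → (X → ℝ) → Window X U M N → ℝ
  | 0, _, _ => 0
  | n + 1, p, I => ∑ x, p x * c x (control (γ I) x)
      + β * ∑ s, windowValue P c β γ n (push P p (s, γ I)) (shift I (s, γ I))

variable (M) in
/-- The optimal finite horizon cost from an unnormalised predictor. -/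
def optValue (P : X → U → stdSimplex ℝ X) (c : X → U → ℝ) (β : ℝ) : ℕ → (X → ℝ) → ℝ
  | 0, _ => 0
  | n + 1, p => ⨅ a : Act X U M, (∑ x, p x * c x (control a x)
      + β * ∑ s, optValue P c β n (push P p (s, a)))

/-- Bounding the chosen action by the sum over all actions makes the accumulated error independent
of the policy. -/
theorem sum_symbol_le_sum_rec {f : Rec X U M → ℝ} (hf : ∀ w, 0 ≤ f w) (a : Act X U M) :
    ∑ s, f (s, a) ≤ ∑ w, f w := by
  rw [sum_rec]
  exact Finset.single_le_sum (f := fun a => ∑ s, f (s, a))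
    (fun b _ => Finset.sum_nonneg fun s _ => hf _) (Finset.mem_univ a)

/-- Induction on the horizon. Each stage costs `K * err` for the wrong predictor and another `K *
err` because `γ` is greedy only on possible windows; elsewhere the loss is at most `2 * K * mass p`,
which is `K * err` there. -/
theorem abs_windowValue_sub_le (hβ0 : 0 < β) (hc : ∀ x u, |c x u| ≤ C) (hK : C + β * K = K)
    (hq : bellman P c β ζ N q = q) (hqK : ∀ I a, |q I a| ≤ K)
    {γ : Window X U M N → Act X U M}
    (hγ : ∀ I, Possible P ζ (rev I) → ∀ a, q I (γ I) ≤ q I a) (n : ℕ) {p : X → ℝ}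
    (hp : ∀ x, 0 ≤ p x) {I : Window X U M N} {l : List (Rec X U M)} (hl : l.take N = rev I) :
    |windowValue P c β γ n p I - mass p * ⨅ a, q I a|
      ≤ β ^ n * K * mass p + 2 * K * accErr P ζ β N n p l := by
  have hK0 : 0 ≤ K := (abs_nonneg _).trans (hqK I (Classical.arbitrary _))
  have hm := mass_nonneg hp
  induction n generalizing p I l with
  | zero =>
    have h1 : |⨅ a, q I a| ≤ K := abs_iInf_le fun a => hqK I a
    simp only [windowValue, accErr, Finset.range_zero, Finset.sum_empty, mul_zero, add_zero,
      pow_zero, one_mul, zero_sub, abs_neg]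
    rw [abs_mul, abs_of_nonneg hm, mul_comm]
    exact mul_le_mul_of_nonneg_right h1 hm
  | succ n ih =>
    have h1 := abs_lookahead_sub_le hβ0 hc hK hq hqK hp hl (γ I)
    have h2 : |mass p * q I (γ I) - mass p * ⨅ a, q I a| ≤ K * err P ζ N p l := by
      rw [err, hl]
      split_ifs with hI
      · rw [le_antisymm (le_ciInf (hγ I hI)) (ciInf_le (Set.finite_range _).bddBelow _), sub_self,
          abs_zero]
        exact mul_nonneg hK0 (gap_nonneg _ _)
      · rw [← mul_sub, abs_mul, abs_of_nonneg hm]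
        have h3 : |q I (γ I) - ⨅ a, q I a| ≤ 2 * K :=
          (abs_sub _ _).trans (by linarith [hqK I (γ I), abs_iInf_le fun a => hqK I a])
        linarith [mul_le_mul_of_nonneg_left h3 hm]
    have h4 : |∑ s, windowValue P c β γ n (push P p (s, γ I)) (shift I (s, γ I))
        - ∑ s, mass (push P p (s, γ I)) * ⨅ b, q (shift I (s, γ I)) b|
        ≤ β ^ n * K * mass p + 2 * K * ∑ w, accErr P ζ β N n (push P p w) (w :: l) := by
      rw [← Finset.sum_sub_distrib]
      refine (Finset.abs_sum_le_sum_abs _ _).trans ((Finset.sum_le_sum fun s _ =>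
        ih (push_nonneg P hp (s, γ I)) (take_cons_eq_rev_shift hl (s, γ I))
          (mass_nonneg (push_nonneg P hp (s, γ I)))).trans ?_)
      rw [Finset.sum_add_distrib, ← Finset.mul_sum, sum_mass_push, ← Finset.mul_sum]
      refine add_le_add le_rfl (mul_le_mul_of_nonneg_left ?_ (by linarith))
      exact sum_symbol_le_sum_rec (f := fun w => accErr P ζ β N n (push P p w) (w :: l))
        (fun w => accErr_nonneg hβ0 n (push_nonneg P hp w) _) (γ I)
    have h5 := mul_le_mul_of_nonneg_left h4 hβ0.le
    rw [← abs_of_pos hβ0, ← abs_mul, abs_of_pos hβ0] at h5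
    rw [accErr_succ, windowValue, pow_succ']
    have h6 : (∑ x, p x * c x (control (γ I) x)
        + β * ∑ s, windowValue P c β γ n (push P p (s, γ I)) (shift I (s, γ I)))
          - mass p * ⨅ a, q I a
        = ((∑ x, p x * c x (control (γ I) x)
          + β * ∑ s, mass (push P p (s, γ I)) * ⨅ b, q (shift I (s, γ I)) b) - mass p * q I (γ I))
        + (mass p * q I (γ I) - mass p * ⨅ a, q I a)
        + β * (∑ s, windowValue P c β γ n (push P p (s, γ I)) (shift I (s, γ I))
          - ∑ s, mass (push P p (s, γ I)) * ⨅ b, q (shift I (s, γ I)) b) := by ring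
    rw [h6]
    refine (abs_add_three _ _ _).trans ?_
    linarith

/-- The same induction for an arbitrary action, whose `q`-value is at least the minimum. Only the
predictor error enters; `2 * K` is kept to match `abs_windowValue_sub_le`. -/
theorem mul_iInf_le_optValue (hβ0 : 0 < β) (hc : ∀ x u, |c x u| ≤ C) (hK : C + β * K = K)
    (hq : bellman P c β ζ N q = q) (hqK : ∀ I a, |q I a| ≤ K) (n : ℕ) {p : X → ℝ}
    (hp : ∀ x, 0 ≤ p x) {I : Window X U M N} {l : List (Rec X U M)} (hl : l.take N = rev I) :
    mass p * ⨅ a, q I a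
      ≤ optValue M P c β n p + (β ^ n * K * mass p + 2 * K * accErr P ζ β N n p l) := by
  have hK0 : 0 ≤ K := (abs_nonneg _).trans (hqK I (Classical.arbitrary _))
  have hm := mass_nonneg hp
  induction n generalizing p I l with
  | zero =>
    have h1 : |⨅ a, q I a| ≤ K := abs_iInf_le fun a => hqK I a
    simp only [optValue, accErr, Finset.range_zero, Finset.sum_empty, mul_zero, add_zero,
      pow_zero, one_mul, zero_add]
    rw [mul_comm K]
    exact mul_le_mul_of_nonneg_left ((le_abs_self _).trans h1) hm
  | succ n ih =>
    rw [← sub_le_iff_le_add, optValue]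
    refine le_ciInf fun a => ?_
    have h1 := neg_le_of_abs_le (abs_lookahead_sub_le hβ0 hc hK hq hqK hp hl a)
    have h2 : mass p * ⨅ a, q I a ≤ mass p * q I a :=
      mul_le_mul_of_nonneg_left (ciInf_le (Set.finite_range _).bddBelow a) hm
    have h4 : ∑ s, mass (push P p (s, a)) * ⨅ b, q (shift I (s, a)) b
        ≤ ∑ s, optValue M P c β n (push P p (s, a)) +
          (β ^ n * K * mass p + 2 * K * ∑ w, accErr P ζ β N n (push P p w) (w :: l)) := by
      refine (Finset.sum_le_sum fun s _ => ih (push_nonneg P hp (s, a))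
        (take_cons_eq_rev_shift hl (s, a)) (mass_nonneg (push_nonneg P hp (s, a)))).trans ?_
      rw [Finset.sum_add_distrib, Finset.sum_add_distrib, ← Finset.mul_sum, sum_mass_push,
        ← Finset.mul_sum]
      refine add_le_add le_rfl (add_le_add le_rfl (mul_le_mul_of_nonneg_left ?_ (by linarith)))
      exact sum_symbol_le_sum_rec (f := fun w => accErr P ζ β N n (push P p w) (w :: l))
        (fun w => accErr_nonneg hβ0 n (push_nonneg P hp w) _) a
    have h5 := mul_le_mul_of_nonneg_left h4 hβ0.le
    have h6 : 0 ≤ K * err P ζ N p l := mul_nonneg hK0 (err_nonneg hp l)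
    rw [accErr_succ, pow_succ']
    linarith

end ErrorRecursion

/-! ### The discounted cost of a sliding window policy as a recursion -/

section WindowCost

variable {X U M : Type*} [Fintype X] [DecidableEq X] [Fintype U] [DecidableEq U] [Fintype M]
  [DecidableEq M] [MeasurableSpace X] [MeasurableSingletonClass X] [MeasurableSpace U]
  [MeasurableSingletonClass U] [MeasurableSpace M] [MeasurableSingletonClass M]
  {P : X → U → stdSimplex ℝ X} {c : X → U → ℝ} {β : ℝ} {N : ℕ}

theorem windowPolicy_extend (κ : WState X U M N) (γ : Window X U M N → Act X U M) (n : ℕ)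
    (h : Fin n → Rec X U M) :
    windowPolicy P κ (extend γ) n h = stdSimplex.vertex (γ (winAfter κ.2 h)) := by
  rw [windowPolicy, extend, stateAfter_snd]

theorem integral_windowPolicy (κ : WState X U M N) (γ : Window X U M N → Act X U M)
    (π : stdSimplex ℝ X) (n : ℕ) (φ : (Fin n → Rec X U M) → X × Act X U M → ℝ) :
    ∫ ω, φ (recs n ω) (ω n) ∂commonLaw P π (windowPolicy P κ (extend γ))
      = wsum (windowPolicy P κ (extend γ)).weights n fun K =>
        ∑ x, filt P π (rev K) x * φ K (x, γ (winAfter κ.2 K)) := by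
  rw [integral_commonLaw]
  congr 1
  funext K
  refine Finset.sum_congr rfl fun x _ => ?_
  rw [windowPolicy_extend, sum_vertex_mul]

theorem sum_windowPolicy_mul (κ : WState X U M N) (γ : Window X U M N → Act X U M) (n : ℕ)
    (K : Fin n → Rec X U M) (φ : Rec X U M → ℝ) :
    ∑ w, (windowPolicy P κ (extend γ)).weights n K w.2 * φ w
      = ∑ s, φ (s, γ (winAfter κ.2 K)) := by
  rw [sum_rec]
  simp only [← Finset.mul_sum, CommonPolicy.weights, windowPolicy_extend]
  exact sum_vertex_mul _ fun a => ∑ s, φ (s, a)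

theorem sum_windowCost_eq (κ : WState X U M N) (γ : Window X U M N → Act X U M)
    (π : stdSimplex ℝ X) (n k : ℕ) :
    ∑ i ∈ Finset.range n, β ^ i * ∫ ω, c (ω (k + i)).1 (control (ω (k + i)).2 (ω (k + i)).1)
        ∂commonLaw P π (windowPolicy P κ (extend γ))
      = wsum (windowPolicy P κ (extend γ)).weights k fun K =>
        windowValue P c β γ n (filt P π (rev K)) (winAfter κ.2 K) := by
  induction n generalizing k with
  | zero =>
    have h := wsum_mul (g := (windowPolicy P κ (extend γ)).weights) (n := k) 0 fun _ => 0
    simp only [mul_zero, zero_mul] at h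
    simp [windowValue, h]
  | succ n ih =>
    rw [Finset.sum_range_succ']
    have h1 : ∀ i ∈ Finset.range n, β ^ (i + 1) *
        ∫ ω, c (ω (k + (i + 1))).1 (control (ω (k + (i + 1))).2 (ω (k + (i + 1))).1)
          ∂commonLaw P π (windowPolicy P κ (extend γ))
        = β * (β ^ i * ∫ ω, c (ω (k + 1 + i)).1 (control (ω (k + 1 + i)).2 (ω (k + 1 + i)).1)
          ∂commonLaw P π (windowPolicy P κ (extend γ))) := fun i _ => by
      rw [show k + (i + 1) = k + 1 + i by omega, pow_succ']
      ring
    rw [Finset.sum_congr rfl h1, ← Finset.mul_sum, ih (k + 1), pow_zero, one_mul, add_zero,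
      integral_windowPolicy κ γ π k fun _ s => c s.1 (control s.2 s.1), wsum, ← wsum_mul,
      ← wsum_add]
    congr 1
    funext K
    rw [sum_windowPolicy_mul, add_comm, windowValue]
    simp only [rev_snoc, winAfter_snoc, filt]

theorem abs_windowCost_sub_le (hβ0 : 0 < β) (hβ1 : β < 1) {C : ℝ} (hc : ∀ x u, |c x u| ≤ C)
    (κ : WState X U M N) (γ : Window X U M N → Act X U M) (n : ℕ) :
    |windowCost P c β κ (extend γ) - windowValue P c β γ n (psi P κ.1 κ.2) κ.2|
      ≤ β ^ n * (C / (1 - β)) := by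
  have h := sum_windowCost_eq (P := P) (c := c) (β := β) κ γ (psi P κ.1 κ.2) n 0
  simp only [wsum, rev_zero, filt, zero_add, winAfter] at h
  rw [← h]
  exact abs_tsum_sub_sum_le hβ0 hβ1 (fun k => abs_integral_path_le _ k
    (f := fun s : X × Act X U M => c s.1 (control s.2 s.1)) fun s => hc _ _) n

end WindowCost

/-! ### Concavity of the optimal cost and randomized quantizers -/

section RandomizedQuantizer

variable {X U M : Type*} [Fintype X] [DecidableEq X] [Fintype U] [DecidableEq U] [Fintype M]
  [DecidableEq M] [Nonempty U] [Nonempty M]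
  {P : X → U → stdSimplex ℝ X} {c : X → U → ℝ} {β : ℝ}

/-- For the merged vector one action must serve both parts, so merging cannot lower the cost. With
`optValue_mul` this is concavity in the belief. -/
theorem optValue_add_le (hβ0 : 0 < β) (n : ℕ) (p p' : X → ℝ) :
    optValue M P c β n p + optValue M P c β n p' ≤ optValue M P c β n fun x => p x + p' x := by
  induction n generalizing p p' with
  | zero => simp [optValue]
  | succ n ih =>
    simp only [optValue]
    refine le_ciInf fun a => (add_le_add (ciInf_le (Set.finite_range _).bddBelow a)
      (ciInf_le (Set.finite_range _).bddBelow a)).trans ?_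
    have h := mul_le_mul_of_nonneg_left (Finset.sum_le_sum fun (s : M) (_ : s ∈ Finset.univ) =>
      ih (push P p (s, a)) (push P p' (s, a))) hβ0.le
    simp only [push_add, add_mul, Finset.sum_add_distrib] at h ⊢
    linarith

theorem optValue_mul (n : ℕ) {r : ℝ} (hr : 0 ≤ r) (p : X → ℝ) :
    optValue M P c β n (fun x => r * p x) = r * optValue M P c β n p := by
  induction n generalizing p with
  | zero => simp [optValue]
  | succ n ih =>
    simp only [optValue]
    rw [Real.mul_iInf_of_nonneg hr]
    refine iInf_congr fun a => ?_
    simp only [push_mul, ih, mul_assoc, mul_add, Finset.mul_sum]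
    congr 1
    exact Finset.sum_congr rfl fun s _ => by ring

theorem optValue_zero_vec (n : ℕ) : optValue M P c β n (fun _ => 0) = 0 := by
  simpa using optValue_mul (M := M) (P := P) (c := c) (β := β) n le_rfl fun _ => 0

theorem sum_optValue_le (hβ0 : 0 < β) (n : ℕ) {ι : Type*} (t : Finset ι) (p : ι → X → ℝ) :
    ∑ i ∈ t, optValue M P c β n (p i) ≤ optValue M P c β n fun x => ∑ i ∈ t, p i x := by
  classical
  induction t using Finset.induction_on with
  | empty => simp [optValue_zero_vec]
  | insert i t hi ih =>
    simp only [Finset.sum_insert hi]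
    exact (add_le_add le_rfl ih).trans (optValue_add_le hβ0 n _ _)

theorem sum_prod_mul_ite {k : X → M → ℝ} (hk : ∀ x, ∑ s, k x s = 1) (x : X) (s : M) :
    ∑ Q : X → M, (∏ y, k y (Q y)) * (if Q x = s then 1 else 0) = k x s := by
  let f : X → M → ℝ := fun y t => k y t * if y = x then (if t = s then 1 else 0) else 1
  have h : ∀ Q : X → M, (∏ y, k y (Q y)) * (if Q x = s then 1 else 0) = ∏ y, f y (Q y) := by
    intro Q
    simp only [f]
    rw [Finset.prod_mul_distrib, Finset.prod_ite_eq' Finset.univ x]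
    simp
  rw [Finset.sum_congr rfl fun Q _ => h Q, ← Fintype.piFinset_univ, ← Finset.prod_univ_sum,
    Finset.prod_eq_single x]
  · simp [f]
  · intro y _ hy
    simp [f, hy, hk]
  · simp

/-- Randomizing the quantizer does not help. -/
theorem optValue_succ_le_randomized (hβ0 : 0 < β) (n : ℕ) {d : X → M → ℝ}
    (hd : ∀ x s, 0 ≤ d x s) (u : M → U) :
    optValue M P c β (n + 1) (fun x => ∑ s, d x s)
      ≤ ∑ s, (∑ x, d x s * c x (u s)
        + β * optValue M P c β n fun x' => ∑ x, P x (u s) x' * d x s) := by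
  set m : X → ℝ := fun x => ∑ s, d x s with hm
  have hm0 : ∀ x, 0 ≤ m x := fun x => Finset.sum_nonneg fun s _ => hd x s
  -- The conditional law of the symbol given the state; on states without mass any probability
  -- vector would do.
  let k : X → M → ℝ := fun x s => if m x = 0 then (Fintype.card M : ℝ)⁻¹ else d x s / m x
  have hk1 : ∀ x, ∑ s, k x s = 1 := fun x => by
    simp only [k]
    split_ifs with h
    · simp
    · rw [← Finset.sum_div, div_self h]
  have hk0 : ∀ x s, 0 ≤ k x s := fun x s => by
    simp only [k]
    split_ifs
    exacts [by positivity, div_nonneg (hd x s) (hm0 x)]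
  have hkd : ∀ x s, m x * k x s = d x s := fun x s => by
    simp only [k]
    split_ifs with h
    · rw [h, zero_mul]
      exact ((Finset.sum_eq_zero_iff_of_nonneg fun s _ => hd x s).1 h s (Finset.mem_univ s)).symm
    · exact mul_div_cancel₀ _ h
  -- A random quantizer, with symbols drawn independently over the states. Stage cost and
  -- unnormalised update are linear in the state-symbol law, so only the one-state marginals `k`
  -- matter; concavity handles the cost to go.
  let w : (X → M) → ℝ := fun Q => ∏ y, k y (Q y)
  have hw0 : ∀ Q, 0 ≤ w Q := fun Q => Finset.prod_nonneg fun y _ => hk0 y _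
  have hw1 : ∑ Q, w Q = 1 := by
    simp only [w]
    rw [← Fintype.piFinset_univ, ← Finset.prod_univ_sum]
    simp [hk1]
  have hdw : ∀ x s, d x s = ∑ Q, w Q * (if Q x = s then m x else 0) := fun x s => by
    rw [← hkd, ← sum_prod_mul_ite hk1 x s, Finset.mul_sum]
    refine Finset.sum_congr rfl fun Q _ => ?_
    split_ifs <;> simp [w, mul_comm]
  let act : (X → M) → Act X U M := fun Q => (Q, fun _ s => u s)
  have h1 : ∀ s, (fun x' => ∑ x, P x (u s) x' * d x s)
      = fun x' => ∑ Q, w Q * push P m (s, act Q) x' := fun s => by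
    funext x'
    simp only [push, act, hdw, Finset.mul_sum]
    rw [Finset.sum_comm]
    refine Finset.sum_congr rfl fun Q _ => Finset.sum_congr rfl fun x _ => ?_
    split_ifs
    · ring
    · simp
  have h2 : ∑ s, ∑ x, d x s * c x (u s) = ∑ Q, w Q * ∑ x, m x * c x (control (act Q) x) := by
    simp only [hdw, Finset.sum_mul, Finset.mul_sum]
    rw [Finset.sum_comm, Finset.sum_comm (s := (Finset.univ : Finset (X → M)))]
    refine Finset.sum_congr rfl fun x _ => ?_
    rw [Finset.sum_comm]
    refine Finset.sum_congr rfl fun Q _ => ?_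
    simp [act, control, mul_assoc]
  have h3 : ∀ s, ∑ Q, w Q * optValue M P c β n (push P m (s, act Q))
      ≤ optValue M P c β n fun x' => ∑ x, P x (u s) x' * d x s := fun s => by
    rw [h1]
    refine le_trans (le_of_eq ?_) (sum_optValue_le hβ0 n Finset.univ fun Q x' =>
      w Q * push P m (s, act Q) x')
    exact Finset.sum_congr rfl fun Q _ => (optValue_mul n (hw0 Q) _).symm
  rw [Finset.sum_add_distrib, h2, ← Finset.mul_sum]
  have h4 := mul_le_mul_of_nonneg_left (Finset.sum_le_sum fun s (_ : s ∈ Finset.univ) => h3 s)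
    hβ0.le
  refine le_trans ?_ (add_le_add le_rfl h4)
  rw [Finset.sum_comm, Finset.mul_sum, ← Finset.sum_add_distrib]
  have h5 : ∀ Q, w Q * optValue M P c β (n + 1) m
      ≤ w Q * (∑ x, m x * c x (control (act Q) x))
        + β * ∑ s, w Q * optValue M P c β n (push P m (s, act Q)) := fun Q => by
    rw [← Finset.mul_sum, mul_left_comm, ← mul_add]
    exact mul_le_mul_of_nonneg_left (ciInf_le (Set.finite_range _).bddBelow (act Q)) (hw0 Q)
  refine le_trans (le_of_eq ?_) (Finset.sum_le_sum fun Q _ => h5 Q)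
  rw [← Finset.sum_mul, hw1, one_mul]

end RandomizedQuantizer

/-! ### Admissible joint policies: comparison with window policies and lower bound -/

section JointPolicies

variable {X U M : Type*} [Fintype X] [DecidableEq X] [Fintype U] [DecidableEq U] [Fintype M]
  [DecidableEq M] [MeasurableSpace X] [MeasurableSingletonClass X] [MeasurableSpace U]
  [MeasurableSingletonClass U] [MeasurableSpace M] [MeasurableSingletonClass M]
  {P : X → U → stdSimplex ℝ X} {c : X → U → ℝ} {β : ℝ}

instance (π : stdSimplex ℝ X) (γ : JointPolicy X U M) : IsProbabilityMeasure (jointLaw P π γ) :=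
  inferInstanceAs (IsProbabilityMeasure (processLaw _ _))

/-- The first `k` entries of a path. -/
def before {S : Type*} (k : ℕ) (ω : ℕ → S) : Fin k → S := fun i => ω i

theorem integral_jointLaw_zero (π : stdSimplex ℝ X) (γ : JointPolicy X U M)
    (φ : (Fin 0 → X × M × U) → X × M × U → ℝ) :
    ∫ ω, φ (before 0 ω) (ω 0) ∂jointLaw P π γ
      = ∑ x, π x * φ Fin.elim0 (γ.act 0 Fin.elim0 x) := by
  refine Eq.trans (integral_congr_ae (Eventually.of_forall fun ω => ?_))
    ((integral_processLaw_zero _ _ (φ Fin.elim0)).trans (sum_map_mul _ _ _))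
  simp only
  congr 1
  exact Subsingleton.elim _ _

theorem integral_jointLaw_succ (π : stdSimplex ℝ X) (γ : JointPolicy X U M) (k : ℕ)
    (φ : (Fin (k + 1) → X × M × U) → X × M × U → ℝ) :
    ∫ ω, φ (before (k + 1) ω) (ω (k + 1)) ∂jointLaw P π γ
      = ∫ ω, ∑ x, P (ω k).1 (ω k).2.2 x *
        φ (before (k + 1) ω) (γ.act (k + 1) (before (k + 1) ω) x) ∂jointLaw P π γ := by
  refine (integral_processLaw_succ _ _ k φ).trans
    (integral_congr_ae (Eventually.of_forall fun ω => ?_))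
  exact sum_map_mul _ _ _

/-- Any function of the past and the present triple may be replaced by one that agrees with it on
the triples produced by the policy. -/
theorem integral_jointLaw_congr (π : stdSimplex ℝ X) (γ : JointPolicy X U M) (k : ℕ)
    {φ ψ : (Fin k → X × M × U) → X × M × U → ℝ}
    (h : ∀ K x, φ K (γ.act k K x) = ψ K (γ.act k K x)) :
    ∫ ω, φ (before k ω) (ω k) ∂jointLaw P π γ = ∫ ω, ψ (before k ω) (ω k) ∂jointLaw P π γ := by
  cases k with
  | zero => rw [integral_jointLaw_zero, integral_jointLaw_zero]; simp only [h]
  | succ k => rw [integral_jointLaw_succ, integral_jointLaw_succ]; simp only [h]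

/-! ### Sliding window policies are admissible -/

section FromWindow

variable {N : ℕ} (I : Window X U M N) (γ : Window X U M N → Act X U M)

/-- The records determined by the channel symbols when a sliding window policy is used. -/
def recordsOf : ∀ {k : ℕ}, (Fin k → M) → Fin k → Rec X U M
  | 0, _ => Fin.elim0
  | k + 1, h => Fin.snoc (α := fun _ => Rec X U M) (recordsOf (Fin.init h))
      (h (Fin.last k), γ (winAfter I (recordsOf (Fin.init h))))

/-- The action determined by the past channel symbols when a sliding window policy is used. -/
def actionOf {k : ℕ} (h : Fin k → M) : Act X U M := γ (winAfter I (recordsOf I γ h))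

/-- A sliding window policy as a joint coding-control policy. -/
def jointOfWindow : JointPolicy X U M where
  enc _ xs h := sym (actionOf I γ h) (xs (Fin.last _))
  ctl _ h _ := (actionOf I γ (Fin.init h)).2 (actionOf I γ (Fin.init h)).1 (h (Fin.last _))

theorem jointOfWindow_act {k : ℕ} (K : Fin k → X × M × U) (x : X) :
    (jointOfWindow I γ).act k K x = (x, sym (actionOf I γ fun i => (K i).2.1) x,
      control (actionOf I γ fun i => (K i).2.1) x) := by
  simp [JointPolicy.act, jointOfWindow, sym, control]

theorem recordsOf_snoc {k : ℕ} (h : Fin k → M) (s : M) :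
    recordsOf I γ (Fin.snoc (α := fun _ => M) h s)
      = Fin.snoc (α := fun _ => Rec X U M) (recordsOf I γ h) (s, actionOf I γ h) := by
  simp [recordsOf, actionOf]

theorem symbols_before_succ (k : ℕ) (ω : ℕ → X × M × U) :
    (fun i => (before (k + 1) ω i).2.1)
      = Fin.snoc (α := fun _ => M) (fun i => (before k ω i).2.1) (ω k).2.1 := by
  funext i
  refine Fin.lastCases ?_ (fun i => ?_) i <;> simp [before]

/-- Under a window policy the actions, hence the records, can be reconstructed from the symbols
alone, by the encoder and the controller alike. The prior `π₀` does not influence the actions. -/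
theorem integral_jointOfWindow (π₀ π : stdSimplex ℝ X) (k : ℕ)
    (φ : (Fin k → Rec X U M) → X × M × U → ℝ) :
    ∫ ω, φ (recordsOf I γ fun i => (before k ω i).2.1) (ω k) ∂jointLaw P π (jointOfWindow I γ)
      = wsum (windowPolicy P (π₀, I) (extend γ)).weights k fun K => ∑ x, filt P π (rev K) x *
        φ K (x, sym (γ (winAfter I K)) x, control (γ (winAfter I K)) x) := by
  induction k with
  | zero =>
    rw [integral_jointLaw_zero π (jointOfWindow I γ)
      fun K s => φ (recordsOf I γ fun i => (K i).2.1) s]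
    simp only [wsum, rev_zero, filt, jointOfWindow_act, actionOf]
    simp only [recordsOf]
  | succ k ih =>
    rw [integral_jointLaw_succ π (jointOfWindow I γ) k
      fun K s => φ (recordsOf I γ fun i => (K i).2.1) s]
    simp only [jointOfWindow_act, symbols_before_succ, recordsOf_snoc, actionOf]
    rw [ih fun K s => ∑ x, P s.1 s.2.2 x *
      φ (Fin.snoc (α := fun _ => Rec X U M) K (s.2.1, γ (winAfter I K)))
      (x, sym (γ (winAfter I (Fin.snoc (α := fun _ => Rec X U M) K
        (s.2.1, γ (winAfter I K))))) x, control (γ (winAfter I (Fin.snoc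
        (α := fun _ => Rec X U M) K (s.2.1, γ (winAfter I K))))) x), wsum]
    congr 1
    funext K
    rw [sum_windowPolicy_mul]
    simp only [rev_snoc, filt]
    exact (sum_sum_push_mul P (filt P π (rev K)) (γ (winAfter I K)) fun w x =>
      φ (Fin.snoc (α := fun _ => Rec X U M) K w)
        (x, sym (γ (winAfter I (Fin.snoc (α := fun _ => Rec X U M) K w))) x,
          control (γ (winAfter I (Fin.snoc (α := fun _ => Rec X U M) K w))) x)).symm

theorem jointCost_jointOfWindow (π₀ : stdSimplex ℝ X) :
    jointCost P c β (psi P π₀ I) (jointOfWindow I γ) = windowCost P c β (π₀, I) (extend γ) := by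
  refine tsum_congr fun k => congrArg (β ^ k * ·) ?_
  rw [integral_windowPolicy (π₀, I) γ _ k fun _ s => c s.1 (control s.2 s.1)]
  exact integral_jointOfWindow I γ π₀ _ k fun _ s => c s.1 s.2.2

end FromWindow

/-! ### The lower bound for admissible policies -/

section LowerBound

/-- The past channel symbols and controls. -/
def common {k : ℕ} (K : Fin k → X × M × U) : Fin k → M × U := fun i => (K i).2

/-- The control determined by the past symbols and controls and the present symbol. -/
def JointPolicy.controlOf (γ : JointPolicy X U M) {k : ℕ} (h : Fin k → M × U) (s : M) : U :=
  γ.ctl k (Fin.snoc (α := fun _ => M) (fun i => (h i).1) s) fun i => (h i).2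

theorem JointPolicy.act_control (γ : JointPolicy X U M) {k : ℕ} (K : Fin k → X × M × U) (x : X) :
    (γ.act k K x).2.2 = γ.controlOf (common K) (γ.act k K x).2.1 := rfl

/-- The joint probability of the past symbols and controls, the present state and the present
symbol. -/
def jointProb (P : X → U → stdSimplex ℝ X) (π : stdSimplex ℝ X) (γ : JointPolicy X U M) (k : ℕ)
    (h : Fin k → M × U) (x : X) (s : M) : ℝ :=
  ∫ ω, (if common (before k ω) = h ∧ (ω k).1 = x ∧ (ω k).2.1 = s then 1 else 0) ∂jointLaw P π γ

variable (π : stdSimplex ℝ X) (γ : JointPolicy X U M)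

theorem jointProb_nonneg (k : ℕ) (h : Fin k → M × U) (x : X) (s : M) :
    0 ≤ jointProb P π γ k h x s :=
  integral_nonneg fun ω => by dsimp only; split_ifs <;> norm_num

theorem measurable_before {S : Type*} [MeasurableSpace S] (k : ℕ) :
    Measurable (before (S := S) k) :=
  measurable_pi_lambda _ fun _ => measurable_pi_apply _

theorem integral_eq_sum_jointProb (k : ℕ) (φ : (Fin k → M × U) → X → M → ℝ) :
    ∫ ω, φ (common (before k ω)) (ω k).1 (ω k).2.1 ∂jointLaw P π γ
      = ∑ h, ∑ x, ∑ s, jointProb P π γ k h x s * φ h x s := by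
  have hm : ∀ (h : Fin k → M × U) (x : X) (s : M), Integrable (fun ω : ℕ → X × M × U =>
      (if common (before k ω) = h ∧ (ω k).1 = x ∧ (ω k).2.1 = s then (1 : ℝ) else 0) * φ h x s)
      (jointLaw P π γ) := fun h x s => by
    refine Integrable.mul_const (Integrable.of_bound (C := 1) ?_
      (Eventually.of_forall fun ω => by split_ifs <;> simp)) _
    let f : (Fin k → X × M × U) × (X × M × U) → ℝ := fun z =>
      if common z.1 = h ∧ z.2.1 = x ∧ z.2.2.1 = s then 1 else 0
    exact ((Measurable.of_discrete (f := f)).comp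
      ((measurable_before k).prodMk (measurable_pi_apply k))).aestronglyMeasurable
  have hpt : ∀ ω : ℕ → X × M × U, φ (common (before k ω)) (ω k).1 (ω k).2.1
      = ∑ h, ∑ x, ∑ s, (if common (before k ω) = h ∧ (ω k).1 = x ∧ (ω k).2.1 = s
        then (1 : ℝ) else 0) * φ h x s := fun ω => by
    rw [Finset.sum_eq_single (common (before k ω)), Finset.sum_eq_single (ω k).1,
      Finset.sum_eq_single (ω k).2.1]
    · simp
    · intro s _ hs
      simp [hs.symm]
    · simp
    · intro x _ hx
      simp [hx.symm]
    · simp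
    · intro h _ hh
      simp [hh.symm]
    · simp
  simp only [jointProb, ← integral_mul_const]
  rw [integral_congr_ae (Eventually.of_forall hpt),
    integral_finsetSum _ fun h _ => integrable_finsetSum _ fun x _ =>
      integrable_finsetSum _ fun s _ => hm h x s]
  refine Finset.sum_congr rfl fun h _ => ?_
  rw [integral_finsetSum _ fun x _ => integrable_finsetSum _ fun s _ => hm h x s]
  refine Finset.sum_congr rfl fun x _ => ?_
  rw [integral_finsetSum _ fun s _ => hm h x s]

theorem integral_joint_cost (k : ℕ) :
    ∫ ω, c (ω k).1 (ω k).2.2 ∂jointLaw P π γ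
      = ∑ h, ∑ s, ∑ x, jointProb P π γ k h x s * c x (γ.controlOf h s) := by
  rw [integral_jointLaw_congr π γ k (φ := fun _ s => c s.1 s.2.2)
    (ψ := fun K s => c s.1 (γ.controlOf (common K) s.2.1)) fun K x => by rw [γ.act_control],
    integral_eq_sum_jointProb π γ k fun h x s => c x (γ.controlOf h s)]
  exact Finset.sum_congr rfl fun h _ => Finset.sum_comm

theorem common_before_succ (k : ℕ) (ω : ℕ → X × M × U) :
    common (before (k + 1) ω)
      = Fin.snoc (α := fun _ => M × U) (common (before k ω)) (ω k).2 := by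
  funext i
  refine Fin.lastCases ?_ (fun i => ?_) i <;> simp [before, common]

theorem sum_jointProb_zero (h : Fin 0 → M × U) (x : X) :
    ∑ s, jointProb P π γ 0 h x s = π x := by
  have h1 : ∀ s, jointProb P π γ 0 h x s
      = ∑ y, π y * if y = x ∧ (γ.act 0 Fin.elim0 y).2.1 = s then 1 else 0 := fun s => by
    rw [jointProb, integral_jointLaw_zero π γ fun K z =>
      if common K = h ∧ z.1 = x ∧ z.2.1 = s then 1 else 0]
    refine Finset.sum_congr rfl fun y _ => ?_
    have h2 : common (Fin.elim0 : Fin 0 → X × M × U) = h := Subsingleton.elim _ _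
    simp only [h2, true_and]
    rfl
  simp only [h1]
  rw [Finset.sum_comm, Finset.sum_eq_single x]
  · simp
  · intro y _ hy
    simp [hy]
  · simp

/-- The control is determined by the common past and the present symbol, so only one continuation
`v` carries mass; along it the unnormalised belief moves by the transition matrix of that control.
This is the form required by `optValue_succ_le_randomized`. -/
theorem sum_jointProb_succ (k : ℕ) (h : Fin k → M × U) (s : M) (v : U) (x' : X) :
    ∑ s', jointProb P π γ (k + 1) (Fin.snoc (α := fun _ => M × U) h (s, v)) x' s'
      = if v = γ.controlOf h s then ∑ x, P x v x' * jointProb P π γ k h x s else 0 := by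
  have h1 : ∑ s', jointProb P π γ (k + 1) (Fin.snoc (α := fun _ => M × U) h (s, v)) x' s'
      = ∫ ω, (if common (before (k + 1) ω) = Fin.snoc (α := fun _ => M × U) h (s, v) ∧
        (ω (k + 1)).1 = x' then 1 else 0) ∂jointLaw P π γ := by
    have h2 := integral_eq_sum_jointProb (P := P) π γ (k + 1) fun h' x _ =>
      if h' = Fin.snoc (α := fun _ => M × U) h (s, v) ∧ x = x' then 1 else 0
    rw [h2, Finset.sum_eq_single (Fin.snoc (α := fun _ => M × U) h (s, v)),
      Finset.sum_eq_single x']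
    · simp
    · intro y _ hy
      simp [hy]
    · simp
    · intro h' _ hh'
      simp [hh']
    · simp
  rw [h1, integral_jointLaw_succ π γ k fun K z =>
    if common K = Fin.snoc (α := fun _ => M × U) h (s, v) ∧ z.1 = x' then 1 else 0]
  have h3 : ∀ ω : ℕ → X × M × U, ∑ x, P (ω k).1 (ω k).2.2 x *
      (if common (before (k + 1) ω) = Fin.snoc (α := fun _ => M × U) h (s, v) ∧
        (γ.act (k + 1) (before (k + 1) ω) x).1 = x' then 1 else 0)
      = if common (before k ω) = h ∧ (ω k).2.1 = s ∧ (ω k).2.2 = v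
        then P (ω k).1 v x' else 0 := fun ω => by
    rw [Finset.sum_eq_single x']
    · have h4 : (γ.act (k + 1) (before (k + 1) ω) x').1 = x' := rfl
      rw [common_before_succ]
      simp only [h4, and_true, mul_ite, mul_one, mul_zero]
      have h5 : (Fin.snoc (α := fun _ => M × U) (common (before k ω)) (ω k).2
          = Fin.snoc (α := fun _ => M × U) h (s, v))
          ↔ common (before k ω) = h ∧ (ω k).2.1 = s ∧ (ω k).2.2 = v := by
        rw [Fin.snoc_inj, Prod.ext_iff]
      simp only [h5]
      split_ifs with h6
      · rw [h6.2.2]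
      · rfl
    · intro y _ hy
      have h4 : (γ.act (k + 1) (before (k + 1) ω) y).1 = y := rfl
      simp [h4, hy]
    · simp
  simp only [h3]
  rw [integral_jointLaw_congr π γ k (φ := fun K z =>
      if common K = h ∧ z.2.1 = s ∧ z.2.2 = v then P z.1 v x' else 0)
    (ψ := fun K z => if common K = h ∧ z.2.1 = s ∧ γ.controlOf (common K) z.2.1 = v
      then P z.1 v x' else 0) fun K x => by rw [γ.act_control],
    integral_eq_sum_jointProb (P := P) π γ k fun h' x s' =>
      if h' = h ∧ s' = s ∧ γ.controlOf h' s' = v then P x v x' else 0,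
    Finset.sum_eq_single h]
  · split_ifs with hv
    · refine Finset.sum_congr rfl fun x _ => ?_
      rw [Finset.sum_eq_single s]
      · simp [hv, mul_comm]
      · intro s' _ hs'
        simp [hs']
      · simp
    · refine Finset.sum_eq_zero fun x _ => Finset.sum_eq_zero fun s' _ => ?_
      rw [if_neg, mul_zero]
      rintro ⟨-, rfl, rfl⟩
      exact hv rfl
  · intro h' _ hh'
    simp [hh']
  · simp

variable [Nonempty U] [Nonempty M]

/-- Dynamic programming over common histories. The encoder may use old source states, but after
these are averaged out it acts at each common history as a randomized quantizer; past source states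
therefore give no advantage. -/
theorem sum_optValue_jointProb_le (hβ0 : 0 < β) (n k : ℕ) :
    ∑ h, optValue M P c β n (fun x => ∑ s, jointProb P π γ k h x s)
      ≤ ∑ i ∈ Finset.range n, β ^ i * ∫ ω, c (ω (k + i)).1 (ω (k + i)).2.2 ∂jointLaw P π γ := by
  induction n generalizing k with
  | zero => simp [optValue]
  | succ n ih =>
    have h1 : ∀ i ∈ Finset.range n, β ^ (i + 1) *
        ∫ ω, c (ω (k + (i + 1))).1 (ω (k + (i + 1))).2.2 ∂jointLaw P π γ
        = β * (β ^ i * ∫ ω, c (ω (k + 1 + i)).1 (ω (k + 1 + i)).2.2 ∂jointLaw P π γ) :=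
      fun i _ => by
        rw [show k + (i + 1) = k + 1 + i by omega, pow_succ']
        ring
    rw [Finset.sum_range_succ', Finset.sum_congr rfl h1, ← Finset.mul_sum, pow_zero, one_mul,
      add_zero, integral_joint_cost]
    refine le_trans (Finset.sum_le_sum fun h _ => optValue_succ_le_randomized hβ0 n
      (fun x s => jointProb_nonneg π γ k h x s) (γ.controlOf h)) ?_
    simp only [Finset.sum_add_distrib, ← Finset.mul_sum]
    rw [add_comm]
    refine add_le_add (mul_le_mul_of_nonneg_left (le_trans (le_of_eq ?_) (ih (k + 1))) hβ0.le)
      le_rfl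
    rw [← (Fin.snocEquiv fun _ : Fin (k + 1) => M × U).sum_comp,
      Fintype.sum_prod_type_right]
    refine Finset.sum_congr rfl fun h _ => ?_
    rw [Fintype.sum_prod_type]
    refine Finset.sum_congr rfl fun s _ => ?_
    rw [Finset.sum_eq_single (γ.controlOf h s)]
    · congr 1
      funext x'
      exact ((sum_jointProb_succ π γ k h s _ x').trans (if_pos rfl)).symm
    · intro v _ hv
      have h2 : (fun x' => ∑ s', jointProb P π γ (k + 1)
          (Fin.snoc (α := fun _ => M × U) h (s, v)) x' s') = fun _ => 0 :=
        funext fun x' => (sum_jointProb_succ π γ k h s v x').trans (if_neg hv)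
      exact (congrArg _ h2).trans (optValue_zero_vec n)
    · simp

theorem optValue_sub_le_jointCost (hβ0 : 0 < β) (hβ1 : β < 1) {C : ℝ} (hc : ∀ x u, |c x u| ≤ C)
    (n : ℕ) : optValue M P c β n π - β ^ n * (C / (1 - β)) ≤ jointCost P c β π γ := by
  have h1 := sum_optValue_jointProb_le (P := P) (c := c) π γ hβ0 n 0
  simp only [sum_jointProb_zero, zero_add, Finset.univ_unique, Finset.sum_singleton] at h1
  have h2 := abs_tsum_sub_sum_le hβ0 hβ1 (a := fun k => ∫ ω, c (ω k).1 (ω k).2.2 ∂jointLaw P π γ)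
    (fun k => abs_integral_path_le _ k (f := fun s : X × M × U => c s.1 s.2.2) fun s => hc _ _) n
  have h3 := neg_le_of_abs_le h2
  rw [jointCost]
  linarith

end LowerBound

theorem optCost_bounds [Nonempty U] [Nonempty M] (hβ0 : 0 < β) (hβ1 : β < 1) {C : ℝ}
    (hc : ∀ x u, |c x u| ≤ C) {N : ℕ} (κ : WState X U M N) (γ : Window X U M N → Act X U M)
    (n : ℕ) :
    optValue M P c β n (psi P κ.1 κ.2) - β ^ n * (C / (1 - β)) ≤ optCost P c β κ ∧
      optCost P c β κ ≤ windowCost P c β κ (extend γ) := by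
  have : Nonempty (JointPolicy X U M) := ⟨jointOfWindow κ.2 γ⟩
  refine ⟨le_ciInf fun d => optValue_sub_le_jointCost _ d hβ0 hβ1 hc n, ?_⟩
  rw [← jointCost_jointOfWindow κ.2 γ κ.1]
  refine ciInf_le ⟨optValue M P c β 0 (psi P κ.1 κ.2) - β ^ 0 * (C / (1 - β)), ?_⟩ _
  rintro _ ⟨d, rfl⟩
  exact optValue_sub_le_jointCost _ d hβ0 hβ1 hc 0

end JointPolicies

/-! ### Filter stability and the mass of impossible histories -/

section FilterStability

variable {X U M : Type*} [Fintype X] [DecidableEq X] [Fintype U] [DecidableEq U] [Fintype M]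
  [DecidableEq M]

/-- The weights of a randomized policy: for each past they form a probability vector. -/
def IsPolicy (g : Weights X U M) : Prop := (∀ n h a, 0 ≤ g n h a) ∧ ∀ n h, ∑ a, g n h a = 1

theorem CommonPolicy.isPolicy (g : CommonPolicy X U M) : IsPolicy g.weights :=
  ⟨fun n h a => stdSimplex.zero_le (g n h) a, fun n h => stdSimplex.sum_eq_one (g n h)⟩

variable {P : X → U → stdSimplex ℝ X} {ζ : stdSimplex ℝ X} {g : Weights X U M} {δ : ℝ}

theorem IsPolicy.sum_mul_mass_push (hg : IsPolicy g) {n : ℕ} (K : Fin n → Rec X U M) (p : X → ℝ) :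
    ∑ w, g n K w.2 * mass (push P p w) = mass p := by
  rw [sum_rec]
  simp only [← Finset.mul_sum, sum_mass_push, ← Finset.sum_mul, hg.2, one_mul]

theorem IsPolicy.wsum_mass (hg : IsPolicy g) (ν : stdSimplex ℝ X) (n : ℕ) :
    wsum g n (fun K => mass (filt P ν (rev K))) = 1 := by
  induction n with
  | zero => simp [wsum, filt]
  | succ n ih =>
    rw [wsum, ← ih]
    congr 1
    funext K
    simp only [rev_snoc, filt]
    exact hg.sum_mul_mass_push K _

theorem IsPolicy.sum_mul_le (hg : IsPolicy g) {n : ℕ} (K : Fin n → Rec X U M)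
    {f : Rec X U M → ℝ} {B : ℝ} (hf : ∀ a, ∑ s, f (s, a) ≤ B) : ∑ w, g n K w.2 * f w ≤ B := by
  rw [sum_rec]
  simp only [← Finset.mul_sum]
  refine (Finset.sum_le_sum fun a _ => mul_le_mul_of_nonneg_left (hf a) (hg.1 n K a)).trans_eq ?_
  rw [← Finset.sum_mul, hg.2, one_mul]

open scoped Classical in
/-- The filter forgets its prior: the expected distance between the predictor from the true prior
and the predictor restarted `m` steps ago from `ζ`. -/
theorem Overlap.wsum_gap_le (hP : Overlap P δ) (hδ : δ ≤ 1) (hg : IsPolicy g)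
    (ν : stdSimplex ℝ X) (m n : ℕ) (hmn : m ≤ n) :
    wsum g n (fun K => if Possible P ζ ((rev K).take m)
      then gap (filt P ν (rev K)) (post P ζ ((rev K).take m)) else 0)
      ≤ (2 * (1 - δ)) ^ m * 2 := by
  induction m generalizing n with
  | zero =>
    have h := wsum_mono hg.1 (n := n) (Φ := fun K => if Possible P ζ ((rev K).take 0)
      then gap (filt P ν (rev K)) (post P ζ ((rev K).take 0)) else 0)
      (Ψ := fun K => 2 * mass (filt P ν (rev K))) fun K => by
        have hp := filt_nonneg P (stdSimplex.zero_le ν) (rev K)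
        split_ifs
        exacts [gap_le hp _, mul_nonneg zero_le_two (mass_nonneg hp)]
    rw [wsum_mul, hg.wsum_mass] at h
    simpa using h
  | succ m ih =>
    -- The newest record is peeled off, lowering `m` and `n` together, so the restart time stays
    -- fixed and `sum_gap_push_le` applies to the last step.
    obtain ⟨n, rfl⟩ : ∃ n', n = n' + 1 := ⟨n - 1, by omega⟩
    rw [pow_succ', mul_assoc]
    refine le_trans ?_ (mul_le_mul_of_nonneg_left (ih n (by omega)) (by linarith))
    rw [wsum, ← wsum_mul]
    refine wsum_mono hg.1 fun K => ?_
    refine hg.sum_mul_le K fun a => ?_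
    simp only [rev_snoc, List.take_succ_cons, filt, post]
    split_ifs with hK
    · refine le_trans (le_of_eq ?_) (hP.sum_gap_push_le hδ _ _ a)
      refine Finset.sum_congr rfl fun s _ => ?_
      simp only [possible_cons_iff, hK, true_and]
    · rw [mul_zero]
      refine le_of_eq (Finset.sum_eq_zero fun s _ => if_neg fun h => hK ?_)
      exact h.of_cons (stdSimplex.zero_le ζ)

variable (P ζ g) in
open scoped Classical in
/-- The probability that the first `n` records are possible. -/
def possMass (ν : stdSimplex ℝ X) (n : ℕ) : ℝ :=
  wsum g n fun K => if Possible P ζ (rev K) then mass (filt P ν (rev K)) else 0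

/-- The mass lost in one step sits on symbols excluded by the predictor started from `ζ`. It is at
most the gap, whose expectation is bounded by `wsum_gap_le` with the restart at time 0. -/
theorem Overlap.possMass_sub_le (hP : Overlap P δ) (hδ : δ ≤ 1) (hg : IsPolicy g)
    (ν : stdSimplex ℝ X) (n : ℕ) :
    possMass P ζ g ν n - possMass P ζ g ν (n + 1) ≤ (2 * (1 - δ)) ^ n * 2 := by
  classical
  refine le_trans ?_ (hP.wsum_gap_le (ζ := ζ) hδ hg ν n n le_rfl)
  rw [possMass, possMass, wsum, ← wsum_sub]
  refine wsum_mono hg.1 fun K => ?_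
  have htake : (rev K).take n = rev K := List.take_of_length_le (by simp)
  simp only [rev_snoc, htake, filt]
  split_ifs with hK
  · rw [← hg.sum_mul_mass_push (P := P) K (filt P ν (rev K)), ← Finset.sum_sub_distrib]
    simp only [← mul_sub]
    refine hg.sum_mul_le K fun a =>
      le_trans (le_of_eq ?_) (sum_mass_push_le_gap P (post P ζ (rev K)) a)
    refine Finset.sum_congr rfl fun s _ => ?_
    simp only [possible_cons_iff, hK, true_and]
    split_ifs <;> ring
  · have h : ∀ w, ¬ Possible P ζ (w :: rev K) := fun w h => hK (h.of_cons (stdSimplex.zero_le ζ))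
    simp [h]

theorem Overlap.possMass_sub_add_le (hP : Overlap P δ) (hδ0 : 1 / 2 ≤ δ) (hδ : δ ≤ 1)
    (hg : IsPolicy g) (ν : stdSimplex ℝ X) (n t : ℕ) :
    possMass P ζ g ν n - possMass P ζ g ν (n + t) ≤ t * ((2 * (1 - δ)) ^ n * 2) := by
  induction t with
  | zero => simp
  | succ t ih =>
    have h1 := hP.possMass_sub_le (ζ := ζ) hδ hg ν (n + t)
    have h2 : (2 * (1 - δ)) ^ (n + t) ≤ (2 * (1 - δ)) ^ n :=
      pow_le_pow_of_le_one (by linarith) (by linarith) (Nat.le_add_right n t)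
    push_cast
    rw [← add_assoc n t 1]
    linarith

/-- Here the newest records are removed, which needs no invariance, unlike `Possible.take`. -/
theorem Possible.drop {l : List (Rec X U M)} (h : Possible P ζ l) (t : ℕ) :
    Possible P ζ (l.drop t) := by
  induction t with
  | zero => exact h
  | succ t ih =>
    rw [← List.drop_drop]
    cases hl : l.drop t with
    | nil => rw [hl] at ih; simpa using ih
    | cons w l' =>
      rw [hl] at ih
      simpa using ih.of_cons (stdSimplex.zero_le ζ)

open scoped Classical in
theorem IsPolicy.wsum_drop (hg : IsPolicy g) (ν : stdSimplex ℝ X) (N t : ℕ) :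
    wsum g (N + t) (fun K => if Possible P ζ ((rev K).drop t) then mass (filt P ν (rev K)) else 0)
      = possMass P ζ g ν N := by
  induction t with
  | zero => simp [possMass]
  | succ t ih =>
    rw [← ih]
    refine (congrArg (wsum g (N + t)) (funext fun K => ?_))
    simp only [rev_snoc, List.drop_succ_cons, filt]
    split_ifs
    · exact hg.sum_mul_mass_push K _
    · simp

variable [Nonempty U] [Nonempty M]

/-- Follow `g` for `N` steps and choose uniform actions afterwards. -/
def thenUniform (g : Weights X U M) (N : ℕ) : Weights X U M := fun n h a =>
  if n < N then g n h a else (Fintype.card (Act X U M) : ℝ)⁻¹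

theorem IsPolicy.thenUniform (hg : IsPolicy g) (N : ℕ) : IsPolicy (thenUniform g N) := by
  refine ⟨fun n h a => ?_, fun n h => ?_⟩
  · rw [NetCtrl.thenUniform]
    split_ifs
    exacts [hg.1 n h a, by positivity]
  · simp only [NetCtrl.thenUniform]
    split_ifs
    · exact hg.2 n h
    · simp only [Finset.sum_const, Finset.card_univ, nsmul_eq_mul]
      exact mul_inv_cancel₀ (Nat.cast_ne_zero.2 Fintype.card_ne_zero)

open scoped Classical in
-- The unweighted sum over continuations is `card ^ t` times an expectation under uniform actions,
-- so the stability estimates apply to it. The offset `s` serves the induction; dropping `s` records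
-- keeps the condition on the first `N` records.
theorem wsum_errSum_eq (g : Weights X U M) (ν : stdSimplex ℝ X) (N t s : ℕ) :
    wsum (thenUniform g N) (N + s) (fun K => if Possible P ζ ((rev K).drop s)
      then errSum P ζ N t (filt P ν (rev K)) (rev K) else 0)
      = (Fintype.card (Act X U M) : ℝ) ^ t * wsum (thenUniform g N) (N + (s + t))
        (fun K => if Possible P ζ ((rev K).drop (s + t))
          then err P ζ N (filt P ν (rev K)) (rev K) else 0) := by
  induction t generalizing s with
  | zero => simp [errSum]
  | succ t ih =>
    have hc : (Fintype.card (Act X U M) : ℝ) ≠ 0 := Nat.cast_ne_zero.2 Fintype.card_ne_zero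
    rw [pow_succ', mul_assoc, show s + (t + 1) = s + 1 + t by omega, ← ih (s + 1)]
    rw [show N + (s + 1) = N + s + 1 from rfl, wsum, ← wsum_mul]
    congr 1
    funext K
    simp only [rev_snoc, List.drop_succ_cons, filt, errSum]
    have hw : ∀ a, thenUniform g N (N + s) K a = (Fintype.card (Act X U M) : ℝ)⁻¹ := fun a =>
      if_neg (by omega)
    simp only [hw, ← Finset.mul_sum]
    rw [mul_inv_cancel_left₀ hc]
    split_ifs <;> simp

open scoped Classical in
-- If the last `N` records are possible the error is a gap, contributing 2. Otherwise, by
-- invariance, the whole history is impossible although its first `N` records were possible; the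
-- mass of such histories is at most `t` one-step losses of 2, counted twice, which contributes `4 *
-- t`.
theorem Overlap.wsum_errSum_le (hP : Overlap P δ) (hδ0 : 1 / 2 ≤ δ) (hδ : δ ≤ 1)
    (hζ : IsInvariant M P ζ) (hg : IsPolicy g) (ν : stdSimplex ℝ X) (N t : ℕ) :
    wsum g N (fun K => if Possible P ζ (rev K)
      then errSum P ζ N t (filt P ν (rev K)) (rev K) else 0)
      ≤ (Fintype.card (Act X U M) : ℝ) ^ t * ((2 + 4 * t) * (2 * (1 - δ)) ^ N) := by
  have h0 := wsum_errSum_eq (P := P) (ζ := ζ) g ν N t 0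
  rw [Nat.zero_add, Nat.add_zero] at h0
  simp only [List.drop_zero] at h0
  rw [wsum_congr_weights (g' := thenUniform g N) fun m hm => by
    funext h a; exact (if_pos hm).symm, h0]
  refine mul_le_mul_of_nonneg_left ?_ (by positivity)
  have hg' := hg.thenUniform N
  set g' := thenUniform g N
  have h1 := hP.wsum_gap_le (ζ := ζ) hδ hg' ν N (N + t) (Nat.le_add_right N t)
  have h2 := hP.possMass_sub_add_le (ζ := ζ) hδ0 hδ hg' ν N t
  rw [← hg'.wsum_drop ν N t, possMass, ← wsum_sub] at h2
  have h3 : wsum g' (N + t) (fun K => if Possible P ζ ((rev K).drop t)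
      then err P ζ N (filt P ν (rev K)) (rev K) else 0)
      ≤ wsum g' (N + t) (fun K => (if Possible P ζ ((rev K).take N)
          then gap (filt P ν (rev K)) (post P ζ ((rev K).take N)) else 0)
        + 2 * ((if Possible P ζ ((rev K).drop t) then mass (filt P ν (rev K)) else 0)
          - if Possible P ζ (rev K) then mass (filt P ν (rev K)) else 0)) := by
    refine wsum_mono hg'.1 fun K => ?_
    have hm := mass_nonneg (filt_nonneg P (stdSimplex.zero_le ν) (rev K))
    rw [err]
    by_cases ht : Possible P ζ ((rev K).take N)
    · simp only [ht, if_true]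
      have hgap := gap_nonneg (filt P ν (rev K)) (post P ζ ((rev K).take N))
      by_cases hK : Possible P ζ (rev K)
      · simp [hK, hK.drop t]
      · simp only [hK, if_false]
        split_ifs <;> linarith
    · have hK : ¬ Possible P ζ (rev K) := fun h => ht (h.take hζ N)
      simp only [ht, hK, if_false]
      split_ifs <;> linarith
  rw [wsum_add, wsum_mul] at h3
  refine h3.trans ?_
  linarith

end FilterStability

/-! ### Asymptotic optimality of the learned policies -/

section NearOptimality

variable {X U M : Type*} [Fintype X] [DecidableEq X] [Fintype U] [DecidableEq U] [Fintype M]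
  [DecidableEq M] [Nonempty U] [Nonempty M]
  [MeasurableSpace X] [MeasurableSingletonClass X] [MeasurableSpace U]
  [MeasurableSingletonClass U] [MeasurableSpace M] [MeasurableSingletonClass M]
  {P : X → U → stdSimplex ℝ X} {c : X → U → ℝ} {β δ : ℝ} {ζ : stdSimplex ℝ X}

/-- Both costs are compared with the minimum of `q` at `J`. Two truncations at horizon `n` and two
terminal errors give the first 4; two accumulated errors with constant `2 * K` give the second. -/
theorem abs_windowCost_sub_optCost_le (hβ0 : 0 < β) (hβ1 : β < 1) {C : ℝ}
    (hc : ∀ x u, |c x u| ≤ C) {N : ℕ} {q : Window X U M N → Act X U M → ℝ}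
    (hq : bellman P c β ζ N q = q) {γ : Window X U M N → Act X U M}
    (hγ : ∀ I, Possible P ζ (rev I) → ∀ a, q I (γ I) ≤ q I a) (ν : stdSimplex ℝ X)
    (J : Window X U M N) (n : ℕ) :
    |windowCost P c β (ν, J) (extend γ) - optCost P c β (ν, J)|
      ≤ 4 * (C / (1 - β)) * β ^ n
        + 4 * (C / (1 - β)) * accErr P ζ β N n (psi P ν J) (rev J) := by
  have hK : C + β * (C / (1 - β)) = C / (1 - β) := by
    have : 1 - β ≠ 0 := by linarith
    field_simp
    ring
  have hqK := abs_fixedPoint_le hβ0 hβ1 hc hq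
  have hl : (rev J).take N = rev J := List.take_of_length_le (by simp)
  have h1 := abs_le.1 (abs_windowCost_sub_le hβ0 hβ1 hc (P := P) (ν, J) γ n)
  have h2 := abs_le.1 (abs_windowValue_sub_le hβ0 hc hK hq hqK hγ n
    (stdSimplex.zero_le (psi P ν J)) hl)
  have h3 := mul_iInf_le_optValue hβ0 hc hK hq hqK n (stdSimplex.zero_le (psi P ν J)) hl
  have h4 := optCost_bounds (P := P) hβ0 hβ1 hc (ν, J) γ n
  simp only [mass_stdSimplex, mul_one] at h1 h2 h3 h4
  rw [abs_of_nonneg (sub_nonneg.2 h4.2)]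
  linarith [h1.2, h2.2, h4.1]

open scoped Classical in
/-- The error of a possible window. -/
def possErr (P : X → U → stdSimplex ℝ X) (ζ ν : stdSimplex ℝ X) (t : ℕ) {N : ℕ}
    (J : Window X U M N) : ℝ :=
  if Possible P ζ (rev J) then errSum P ζ N t (psi P ν J) (rev J) else 0

theorem possErr_nonneg (ν : stdSimplex ℝ X) (t : ℕ) {N : ℕ} (J : Window X U M N) :
    0 ≤ possErr P ζ ν t J := by
  rw [possErr]
  split_ifs
  exacts [errSum_nonneg t (stdSimplex.zero_le _) _, le_rfl]

theorem Overlap.integral_possErr_le (hP : Overlap P δ) (hδ0 : 1 / 2 ≤ δ) (hδ : δ ≤ 1)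
    (hζ : IsInvariant M P ζ) (ν : stdSimplex ℝ X) (g : CommonPolicy X U M) (N t : ℕ) :
    ∫ J, possErr P ζ ν t J ∂(commonLaw P ν g).map (windowAt N 0)
      ≤ (Fintype.card (Act X U M) : ℝ) ^ t * ((2 + 4 * t) * (2 * (1 - δ)) ^ N) := by
  classical
  rw [integral_map (measurable_windowAt N 0).aemeasurable
    (measurable_of_finite _).aestronglyMeasurable]
  simp only [windowAt_zero]
  rw [integral_recs_commonLaw P ν g N fun J => possErr P ζ ν t J]
  refine le_trans (le_of_eq ?_) (hP.wsum_errSum_le hδ0 hδ hζ g.isPolicy ν N t)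
  congr 1
  funext K
  have hm := mass_nonneg (filt_nonneg P (stdSimplex.zero_le ν) (rev K))
  rw [possErr, psi_eq_post, mul_ite, mul_zero, ← errSum_mul t hm]
  congr 2
  funext x
  exact (filt_eq_mass_mul_post P ν (rev K) x).symm

/-- For fixed `t` the expected errors decay geometrically in `N` and are summable. Only the
marginals of `Λ` enter, so the coupling of the windows is arbitrary. -/
theorem Overlap.ae_tendsto_possErr (hP : Overlap P δ) (hδ0 : 1 / 2 < δ) (hδ : δ ≤ 1)
    (hζ : IsInvariant M P ζ) (ν : ℕ → stdSimplex ℝ X) (g : ℕ → CommonPolicy X U M)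
    {Λ : Measure (∀ N : ℕ, Window X U M N)}
    (hΛ : ∀ N, Λ.map (fun I => I N) = (commonLaw P (ν N) (g N)).map (windowAt N 0)) :
    ∀ᵐ I ∂Λ, ∀ t, Tendsto (fun N => possErr P ζ (ν N) t (I N)) atTop (𝓝 0) := by
  rw [ae_all_iff]
  intro t
  have hpm : ∀ N, IsProbabilityMeasure ((commonLaw P (ν N) (g N)).map (windowAt N 0)) := fun N =>
    Measure.isProbabilityMeasure_map (measurable_windowAt N 0).aemeasurable
  have hint : ∀ N, Integrable (fun J : Window X U M N => possErr P ζ (ν N) t J)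
      (Λ.map fun I => I N) := fun N => by
    rw [hΛ N]
    exact Integrable.of_finite
  have hsum : Summable fun N : ℕ =>
      (Fintype.card (Act X U M) : ℝ) ^ t * ((2 + 4 * t) * (2 * (1 - δ)) ^ N) :=
    ((summable_geometric_of_lt_one (by linarith) (by linarith)).mul_left _).mul_left _
  refine ae_tendsto_zero_of_summable_integral
    (fun N => (hint N).comp_measurable (measurable_pi_apply N))
    (fun N I => possErr_nonneg _ _ _) hsum fun N => ?_
  refine le_trans (le_of_eq ?_) (hP.integral_possErr_le hδ0.le hδ hζ (ν N) (g N) N t)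
  rw [← hΛ N, integral_map (measurable_pi_apply N).aemeasurable
    (measurable_of_finite _).aestronglyMeasurable]

/-- The order of limits matters: `n` is chosen first to make the `β ^ n` term small, and then
finitely many errors vanish as `N → ∞`, whatever their dependence on `t < n`. -/
theorem Overlap.ae_tendsto_windowCost (hP : Overlap P δ) (hδ0 : 1 / 2 < δ) (hδ : δ ≤ 1)
    (hζ : IsInvariant M P ζ) (hβ0 : 0 < β) (hβ1 : β < 1)
    {q : ∀ N, Window X U M N → Act X U M → ℝ} (hq : ∀ N, bellman P c β ζ N (q N) = q N)
    {γ : ∀ N, Window X U M N → Act X U M}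
    (hγ : ∀ N I, Possible P ζ (rev I) → ∀ a, q N I (γ N I) ≤ q N I a)
    (ν : ℕ → stdSimplex ℝ X) (g : ℕ → CommonPolicy X U M)
    {Λ : Measure (∀ N : ℕ, Window X U M N)}
    (hΛ : ∀ N, Λ.map (fun I => I N) = (commonLaw P (ν N) (g N)).map (windowAt N 0)) :
    ∀ᵐ I ∂Λ, Tendsto (fun N => {J : Window X U M N | PosWindow P ζ J}.indicator
      (fun J => |windowCost P c β (ν N, J) (extend (γ N)) - optCost P c β (ν N, J)|) (I N))
      atTop (𝓝 0) := by
  obtain ⟨C, hC0, hC⟩ := exists_abs_le_cost c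
  have hK0 : 0 ≤ 4 * (C / (1 - β)) := mul_nonneg (by norm_num) (div_nonneg hC0 (by linarith))
  filter_upwards [hP.ae_tendsto_possErr hδ0 hδ hζ ν g hΛ] with I hI
  have hbound : ∀ n N, {J : Window X U M N | PosWindow P ζ J}.indicator
      (fun J => |windowCost P c β (ν N, J) (extend (γ N)) - optCost P c β (ν N, J)|) (I N)
      ≤ 4 * (C / (1 - β)) * β ^ n + 4 * (C / (1 - β)) *
        ∑ t ∈ Finset.range n, β ^ t * possErr P ζ (ν N) t (I N) := fun n N => by
    by_cases h : PosWindow P ζ (I N)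
    · have h' := (posWindow_iff P ζ (I N)).1 h
      rw [Set.indicator_of_mem (show I N ∈ {J | PosWindow P ζ J} from h)]
      simp only [possErr, if_pos h']
      exact abs_windowCost_sub_optCost_le hβ0 hβ1 hC (hq N) (hγ N) (ν N) (I N) n
    · rw [Set.indicator_of_notMem (show I N ∉ {J | PosWindow P ζ J} from h)]
      have : 0 ≤ ∑ t ∈ Finset.range n, β ^ t * possErr P ζ (ν N) t (I N) :=
        Finset.sum_nonneg fun t _ => mul_nonneg (pow_pos hβ0 t).le (possErr_nonneg _ _ _)
      positivity
  refine tendsto_order.2 ⟨fun b hb => Eventually.of_forall fun N =>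
    hb.trans_le (Set.indicator_nonneg (fun _ _ => abs_nonneg _) _), fun ε hε => ?_⟩
  have hpow : Tendsto (fun n : ℕ => 4 * (C / (1 - β)) * β ^ n) atTop (𝓝 0) := by
    simpa using (tendsto_pow_atTop_nhds_zero_of_lt_one hβ0.le hβ1).const_mul (4 * (C / (1 - β)))
  obtain ⟨n, hn⟩ := (hpow.eventually_lt_const hε).exists
  have hlim : Tendsto (fun N => 4 * (C / (1 - β)) * β ^ n + 4 * (C / (1 - β)) *
        ∑ t ∈ Finset.range n, β ^ t * possErr P ζ (ν N) t (I N)) atTop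
      (𝓝 (4 * (C / (1 - β)) * β ^ n + 4 * (C / (1 - β)) *
        ∑ t ∈ Finset.range n, β ^ t * 0)) :=
    ((tendsto_finsetSum _ fun t _ => (hI t).const_mul _).const_mul _).const_add _
  simp only [mul_zero, Finset.sum_const_zero, add_zero] at hlim
  filter_upwards [hlim.eventually_lt_const hn] with N hN
  exact (hbound n N).trans_lt hN

end NearOptimality

end NetCtrl

end

/-! ### The main theorem -/

theorem mainTheorem6 {X U M : Type*}
    [Fintype X] [DecidableEq X] [Nonempty X] [MeasurableSpace X] [MeasurableSingletonClass X]
    [Fintype U] [DecidableEq U] [Nonempty U] [MeasurableSpace U] [MeasurableSingletonClass U]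
    [Fintype M] [DecidableEq M] [Nonempty M] [MeasurableSpace M] [MeasurableSingletonClass M]
    (P : X → U → stdSimplex ℝ X) (c : X → U → ℝ) (β : ℝ) (hβ0 : 0 < β) (hβ1 : β < 1)
    (hδ : ∀ u, 1 / 2 < dobrushin P u)
    (hPHR : SourcePHR M P)
    (ζ : stdSimplex ℝ X) (hζ : IsInvariant M P ζ) :
    ∃ Qs : ∀ N : ℕ, Window X U M N → Act X U M → ℝ,
      (∀ N : ℕ,
        -- almost sure convergence of Q-learning, from every initial distribution
        (∀ ν : stdSimplex ℝ X, ∀ᵐ ω ∂(commonLaw P ν (explore : CommonPolicy X U M)),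
          ∀ (I : Window X U M N) (a : Act X U M), PosWindow P ζ I →
            Tendsto (fun t => qIter P c β ζ ω t I a) atTop (𝓝 (Qs N I a))) ∧
        -- the limit solves the optimality equation of the finite window model
        (∀ (I : Window X U M N) (a : Act X U M),
          Qs N I a = mdpStageCost P c ζ I a +
            β * ∑ I' : Window X U M N, mdpKernel P ζ I a I' * ⨅ a' : Act X U M, Qs N I' a') ∧
        (∀ I : Window X U M N, mdpOptCost P c β ζ I = ⨅ a : Act X U M, Qs N I a) ∧
        -- greedy policies are optimal for the finite window model
        (∀ γ : Window X U M N → Act X U M, (∀ I a, Qs N I (γ I) ≤ Qs N I a) →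
          ∀ I, mdpCost P c β ζ I (stationary γ) = mdpOptCost P c β ζ I)) ∧
      -- greedy policies are asymptotically optimal for the original problem
      (∀ γ : ∀ N : ℕ, Window X U M N → Act X U M,
        (∀ N I, PosWindow P ζ I → ∀ a, Qs N I (γ N I) ≤ Qs N I a) →
        ∀ (ν : ℕ → stdSimplex ℝ X) (g : ℕ → CommonPolicy X U M)
          (Λ : Measure (∀ N : ℕ, Window X U M N)),
          (∀ N, Λ.map (fun I => I N) = (commonLaw P (ν N) (g N)).map (windowAt N 0)) →
          ∀ᵐ I ∂Λ, Tendsto (fun N => {J : Window X U M N | PosWindow P ζ J}.indicator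
              (fun J => |windowCost P c β (ν N, J) (extend (γ N)) - optCost P c β (ν N, J)|) (I N))
            atTop (𝓝 0)) := by
  obtain ⟨δ, hδ0, hδ1, hP⟩ := exists_overlap hδ
  choose q hq using fun N => exists_bellman_fixedPoint (M := M) P c ζ hβ0 hβ1 N
  refine ⟨q, fun N => ⟨fun ν => ?_, fun I a => (congrFun (congrFun (hq N) I) a).symm,
    fun I => mdpOptCost_eq hβ0 hβ1 (hq N) I, fun γ hγ I => ?_⟩, fun γ hγ ν g Λ hΛ => ?_⟩
  · filter_upwards [ae_tendsto_qIter hP (by linarith) hδ1 hζ hβ0 hβ1 (hq N) ν] with ω hω I a hI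
    exact hω I a ((posWindow_iff P ζ I).1 hI)
  · rw [mdpCost_greedy hβ0 hβ1 (hq N) hγ, mdpOptCost_eq hβ0 hβ1 (hq N)]
  · exact hP.ae_tendsto_windowCost hδ0 hδ1 hζ hβ0 hβ1 hq
      (fun N I hI => hγ N I ((posWindow_iff P ζ I).2 hI)) ν g hΛ
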